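/- Let $p$ be a prime, $n\in\mathbb{N}$, and equip $\mathbb{Q}_p^n$ with $\|\xi\|_p=\max_i|\xi_i|_p$ and the Haar measure giving $\mathbb{Z}_p^n$ measure $1$. Let $\chi_p(y)=e^{2\pi i\{y\}_p}$, and let $\mathcal{F}f(\xi)=\int\chi_p(\xi\cdot x)f(x)\,d^nx$ be the Fourier transform, extended to $L^2(\mathbb{Q}_p^n)$; we also write $\widehat f=\mathcal{F}f$. A function $\psi:\mathbb{Q}_p^n\to\mathbb{C}$ is negative definite if $\sum_{i,j}\big(\psi(x_i)+\overline{\psi(x_j)}-\psi(x_i-x_j)\big)\lambda_i\overline{\lambda_j}\ge 0$ for all finite families $x_i\in\mathbb{Q}_p^n$, $\lambda_i\in\mathbb{C}$. A function $\psi:\mathbb{Q}_p^n\to\mathbb{R}$ is of type 0 if it is bounded; of type 1 if there are $C_0,C_1>0$ and $\beta_1\ge\beta_0>0$ with $C_0\max\{1,\|\xi\|_p\}^{\beta_0}\le\max\{1,|\psi(\xi)|\}\le C_1\max\{1,\|\xi\|_p\}^{\beta_1}$ for all $\xi$; of type 2 if for every $\beta\ge1$ there is $C>0$ with $\max\{1,|\psi(\xi)|\}>C\max\{1,\|\xi\|_p\}^{\beta}$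 for all $\xi$. Let $\psi_1,\dots,\psi_m:\mathbb{Q}_p^n\to[0,\infty)$ be radial (depending only on $\|\xi\|_p$), continuous, negative definite functions, each of type 0, 1 or 2, let $b_1,\dots,b_m>0$, and put $p(\xi)=\sum_{j=1}^m b_j\psi_j(\xi)$. Let $\boldsymbol{\psi}$ be one of the following functions. (i) If all $\psi_j$ are of type 0 or 1 and at least one is of type 1: $\boldsymbol{\psi}(\xi)=\|\xi\|_p^{\beta}$, where $\beta\ge1$ is any number such that $p(\xi)\le C\max\{1,\|\xi\|_p\}^{\beta}$ for some $C>0$ and all $\xi$. (ii) If at least one $\psi_j$ is of type 2: $\boldsymbol{\psi}(\xi)=C\sum_{j\in J}\psi_j(\xi)$, where $J$ is the set of all $j$ such that $\psi_j$ is of type 2 and $C>0$ is any constant. For $l\in\mathbb{N}$ let $B_{\boldsymbol{\psi},l}(\mathbb{R})\subset L^2$ be the completion of the space of real-valued locally constant functions with compact support for the norm $\|\varphi\|_{\boldsymbol{\psi},l}^2=\int\max\{1,|\boldsymbol{\psi}(\xi)|\}^l|\widehat\varphi(\xi)|^2\,d^n\xi$, and let $B_{\boldsymbol{\psi},\infty}(\mathbb{R})=\bigcap_{l}B_{\boldsymbol{\psi},l}(\mathbb{R})$.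 Let $C_0(\mathbb{Q}_p^n,\mathbb{R})$ be the Banach space of continuous real functions vanishing at infinity, with the sup norm. Then every element of $B_{\boldsymbol{\psi},\infty}(\mathbb{R})$ has a representative in $C_0(\mathbb{Q}_p^n,\mathbb{R})$; the formula $P(\partial)u=-\mathcal{F}^{-1}(p\,\mathcal{F}u)$ defines a linear operator in $C_0(\mathbb{Q}_p^n,\mathbb{R})$ with domain $B_{\boldsymbol{\psi},\infty}(\mathbb{R})$; this operator is closable; and its closure $\overline{P(\partial)}$ is m-dissipative: for every $\lambda>0$ one has $\|u-\lambda\overline{P(\partial)}u\|_{\infty}\ge\|u\|_{\infty}$ for all $u\in \mathrm{Dom}(\overline{P(\partial)})$, and for every $\lambda>0$ and $f\in C_0(\mathbb{Q}_p^n,\mathbb{R})$ there is $u\in \mathrm{Dom}(\overline{P(\partial)})$ with $u-\lambda\overline{P(\partial)}u=f$. -/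

import Mathlib

open MeasureTheory Filter Topology
open scoped ZeroAtInfty ENNReal ComplexOrder

noncomputable section

namespace PadicFeller

variable {p : ℕ} [Fact p.Prime] {n m : ℕ}

/-! ### Analysis on `ℚ_p^n`

The space `ℚ_p^n` is `Fin n → ℚ_[p]`, whose norm is the maximum norm `max_i |x_i|_p`. -/

/-- The Borel `σ`-algebra on `ℚ_p`. -/
instance instMeasurableSpacePadic : MeasurableSpace ℚ_[p] := borel ℚ_[p]

instance instBorelSpacePadic : BorelSpace ℚ_[p] := ⟨rfl⟩

/-- The ball `ℤ_p^n`, a compact set with non-empty interior. -/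
def unitBall (p : ℕ) [Fact p.Prime] (n : ℕ) :
    TopologicalSpace.PositiveCompacts (Fin n → ℚ_[p]) where
  carrier := Metric.closedBall 0 1
  isCompact' := isCompact_closedBall 0 1
  interior_nonempty' := ⟨0, Metric.ball_subset_interior_closedBall (Metric.mem_ball_self one_pos)⟩

/-- The Haar measure `d^n x` of `ℚ_p^n`, normalized so that `ℤ_p^n` has measure `1`. -/
def haar (p : ℕ) [Fact p.Prime] (n : ℕ) : Measure (Fin n → ℚ_[p]) :=
  Measure.addHaarMeasure (unitBall p n)

/-- The number of digits of `y` after the `p`-adic point: `max (0, -ord y)`. -/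
def polarOrder (y : ℚ_[p]) : ℕ := (-y.valuation).toNat

lemma norm_mul_pow_polarOrder_le (y : ℚ_[p]) : ‖y * (p : ℚ_[p]) ^ polarOrder y‖ ≤ 1 := by
  rcases eq_or_ne y 0 with rfl | hy
  · simp
  · have hp : (1 : ℝ) < p := by exact_mod_cast (Fact.out : p.Prime).one_lt
    have hp0 : (p : ℝ) ≠ 0 := by positivity
    rw [norm_mul, Padic.norm_eq_zpow_neg_valuation hy, norm_pow, Padic.norm_p, inv_pow,
      ← zpow_natCast, ← zpow_neg, ← zpow_add₀ hp0]
    apply zpow_le_one_of_nonpos₀ hp.le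
    have := Int.self_le_toNat (-y.valuation)
    unfold polarOrder
    linarith

/-- The `p`-adic integer `p ^ k * y` with `k = polarOrder y`. -/
def scaled (y : ℚ_[p]) : ℤ_[p] :=
  ⟨y * (p : ℚ_[p]) ^ polarOrder y, norm_mul_pow_polarOrder_le y⟩

/-- The fractional part `{y}_p`: if `y = p ^ (-k) * ∑ y_j p ^ j` with `k = max (0, -ord y)` and
digits `y_j`, it is `p ^ (-k) * ∑_{j < k} y_j p ^ j`. (`PadicInt.appr x k` is the natural number
`∑_{j < k} x_j p ^ j` made of the first `k` digits of the `p`-adic integer `x`.) -/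
def fractPart (y : ℚ_[p]) : ℚ :=
  (PadicInt.appr (scaled y) (polarOrder y) : ℚ) / (p : ℚ) ^ polarOrder y

/-- The standard additive character `χ_p(y) = exp(2πi{y}_p)`. -/
def chi (y : ℚ_[p]) : ℂ := Complex.exp (2 * Real.pi * Complex.I * ((fractPart y : ℚ) : ℂ))

/-- Real-valued Bruhat-Schwartz (test) functions. -/
def IsTestFunction (φ : (Fin n → ℚ_[p]) → ℝ) : Prop :=
  IsLocallyConstant φ ∧ HasCompactSupport φ

/-- The Fourier transform of an integrable function. -/
def fourierL1 (f : (Fin n → ℚ_[p]) → ℂ) (ξ : Fin n → ℚ_[p]) : ℂ :=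
  ∫ x, chi (ξ ⬝ᵥ x) * f x ∂(haar p n)

/-- `g` is (a representative of) the Fourier transform of `f ∈ L²`, that is the `L²`-limit of
`∫_{‖x‖ ≤ p^k} χ_p(ξ·x) f(x) dx` as `k → ∞`. -/
def IsFourierL2 (f g : (Fin n → ℚ_[p]) → ℂ) : Prop :=
  MemLp f 2 (haar p n) ∧ MemLp g 2 (haar p n) ∧
    Tendsto (fun k : ℕ => eLpNorm (fun ξ =>
      (∫ x in Metric.closedBall 0 ((p : ℝ) ^ k), chi (ξ ⬝ᵥ x) * f x ∂(haar p n)) - g ξ)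
      2 (haar p n)) atTop (𝓝 0)

/-- `f` is (a representative of) the inverse Fourier transform of `g ∈ L²`, that is the `L²`-limit
of `∫_{‖ξ‖ ≤ p^k} χ_p(-x·ξ) g(ξ) dξ` as `k → ∞`. -/
def IsInvFourierL2 (g f : (Fin n → ℚ_[p]) → ℂ) : Prop :=
  MemLp g 2 (haar p n) ∧ MemLp f 2 (haar p n) ∧
    Tendsto (fun k : ℕ => eLpNorm (fun x =>
      (∫ ξ in Metric.closedBall 0 ((p : ℝ) ^ k), chi (-(x ⬝ᵥ ξ)) * g ξ ∂(haar p n)) - f x)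
      2 (haar p n)) atTop (𝓝 0)

/-! ### Negative definite functions and their types -/

/-- Negative definite functions on `ℚ_p^n`. -/
def IsNegativeDefinite (ψ : (Fin n → ℚ_[p]) → ℂ) : Prop :=
  ∀ (N : ℕ) (x : Fin N → (Fin n → ℚ_[p])) (c : Fin N → ℂ),
    0 ≤ ∑ i, ∑ j, (ψ (x i) + (starRingEnd ℂ) (ψ (x j)) - ψ (x i - x j)) * c i
      * (starRingEnd ℂ) (c j)

/-- `ψ(ξ)` depends only on `‖ξ‖`. -/
def IsRadial (ψ : (Fin n → ℚ_[p]) → ℝ) : Prop :=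
  ∀ ξ η : Fin n → ℚ_[p], ‖ξ‖ = ‖η‖ → ψ ξ = ψ η

/-- Type 0: bounded functions. -/
def IsType0 (ψ : (Fin n → ℚ_[p]) → ℝ) : Prop :=
  ∃ C : ℝ, 0 < C ∧ ∀ ξ, |ψ ξ| ≤ C

/-- Type 1: two-sided polynomial bounds. -/
def IsType1 (ψ : (Fin n → ℚ_[p]) → ℝ) : Prop :=
  ∃ C₀ C₁ β₀ β₁ : ℝ, 0 < C₀ ∧ 0 < C₁ ∧ 0 < β₀ ∧ β₀ ≤ β₁ ∧
    ∀ ξ, C₀ * (max 1 ‖ξ‖) ^ β₀ ≤ max 1 |ψ ξ| ∧ max 1 |ψ ξ| ≤ C₁ * (max 1 ‖ξ‖) ^ β₁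

/-- Type 2: growth faster than every power. -/
def IsType2 (ψ : (Fin n → ℚ_[p]) → ℝ) : Prop :=
  ∀ β : ℝ, 1 ≤ β → ∃ C : ℝ, 0 < C ∧ ∀ ξ, C * (max 1 ‖ξ‖) ^ β < max 1 |ψ ξ|

/-- The symbol `p(ξ) = ∑_j b_j ψ_j(ξ)`. -/
def symbol (b : Fin m → ℝ) (ψ : Fin m → (Fin n → ℚ_[p]) → ℝ) (ξ : Fin n → ℚ_[p]) : ℝ :=
  ∑ j, b j * ψ j ξ

open Classical in
/-- `w` is a weight function (called `𝛙` in the definition of `B_{𝛙,∞}`) attached to the symbol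
`∑_j b_j ψ_j`. Either all the `ψ_j` have type 0 or 1, at least one of them has type 1, and
`w(ξ) = ‖ξ‖ ^ β` for some `β ≥ 1` such that the symbol is `O(max(1, ‖ξ‖) ^ β)`; or all of them have
type 0, 1 or 2, at least one of them has type 2, and `w` is a positive multiple of the sum of
the `ψ_j` of type 2. -/
def IsAttachedWeight (b : Fin m → ℝ) (ψ : Fin m → (Fin n → ℚ_[p]) → ℝ)
    (w : (Fin n → ℚ_[p]) → ℝ) : Prop :=
  ((∀ j, IsType0 (ψ j) ∨ IsType1 (ψ j)) ∧ (∃ j, IsType1 (ψ j)) ∧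
    ∃ C β : ℝ, 0 < C ∧ 1 ≤ β ∧ (∀ ξ, symbol b ψ ξ ≤ C * (max 1 ‖ξ‖) ^ β) ∧
      ∀ ξ, w ξ = ‖ξ‖ ^ β) ∨
  ((∀ j, IsType0 (ψ j) ∨ IsType1 (ψ j) ∨ IsType2 (ψ j)) ∧ (∃ j, IsType2 (ψ j)) ∧
    ∃ C : ℝ, 0 < C ∧ ∀ ξ, w ξ = C * ∑ j with IsType2 (ψ j), ψ j ξ)

/-! ### The spaces `B_{w,l}(ℝ)` and `B_{w,∞}(ℝ)` -/

/-- `f ∈ B_{w,l}(ℝ)`. This space is the completion of the real test functions for the norm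
`‖φ‖_{w,l}² = ∫ max(1,|w(ξ)|)^l |φ̂(ξ)|² dξ`. Since this norm dominates that of `L²`, the completion
is realized inside `L²`: it consists of the real `f ∈ L²` which are limits of real
test functions in this norm. -/
def MemB (w : (Fin n → ℚ_[p]) → ℝ) (l : ℕ) (f : (Fin n → ℚ_[p]) → ℝ) : Prop :=
  ∃ g : (Fin n → ℚ_[p]) → ℂ, IsFourierL2 (fun x => (f x : ℂ)) g ∧
    ∃ φ : ℕ → (Fin n → ℚ_[p]) → ℝ, (∀ k, IsTestFunction (φ k)) ∧
      Tendsto (fun k => ∫⁻ ξ, ENNReal.ofReal ((max 1 |w ξ|) ^ l *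
        ‖fourierL1 (fun x => (φ k x : ℂ)) ξ - g ξ‖ ^ 2) ∂(haar p n)) atTop (𝓝 0)

/-- `f ∈ B_{w,∞}(ℝ) = ⋂_l B_{w,l}(ℝ)`. Elements of this space are functions modulo equality almost
everywhere, and membership is invariant under such equality. -/
def MemBInfty (w : (Fin n → ℚ_[p]) → ℝ) (f : (Fin n → ℚ_[p]) → ℝ) : Prop :=
  ∀ l : ℕ, MemB w l f

/-! ### The operator -/

/-- `A` is the operator `P(∂)u = -𝓕⁻¹(σ 𝓕u)` in `C₀(ℚ_p^n, ℝ)` with domain `B_{w,∞}(ℝ)`: every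
element of `B_{w,∞}(ℝ)` has a representative in `C₀(ℚ_p^n, ℝ)`, these representatives form the
domain of `A`, and `A` acts by the formula. -/
structure IsPseudoDiffOperator (σ w : (Fin n → ℚ_[p]) → ℝ)
    (A : C₀(Fin n → ℚ_[p], ℝ) →ₗ.[ℝ] C₀(Fin n → ℚ_[p], ℝ)) : Prop where
  embedding : ∀ f : (Fin n → ℚ_[p]) → ℝ, MemBInfty w f → ∃ u ∈ A.domain, f =ᵐ[haar p n] u
  mem_domain_iff : ∀ u : C₀(Fin n → ℚ_[p], ℝ), u ∈ A.domain ↔ MemBInfty w u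
  apply_eq : ∀ u : A.domain, ∃ g : (Fin n → ℚ_[p]) → ℂ,
    IsFourierL2 (fun x => ((u : C₀(Fin n → ℚ_[p], ℝ)) x : ℂ)) g ∧
    IsInvFourierL2 (fun ξ => (σ ξ : ℂ) * g ξ) (fun x => -((A u) x : ℂ))

/-- An operator `A` with domain in a normed space `X` is m-dissipative if it is dissipative, i.e.
`‖u - λ A u‖ ≥ ‖u‖` for all `u` in the domain and all `λ > 0`, and `I - λ A` is onto `X` for
all `λ > 0`. -/
def IsMDissipative {X : Type*} [NormedAddCommGroup X] [NormedSpace ℝ X] (A : X →ₗ.[ℝ] X) : Prop :=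
  (∀ c : ℝ, 0 < c → ∀ u : A.domain, ‖(u : X)‖ ≤ ‖(u : X) - c • A u‖) ∧
  (∀ c : ℝ, 0 < c → ∀ f : X, ∃ u : A.domain, (u : X) - c • A u = f)

end PadicFeller

end

open MeasureTheory Filter Topology
open scoped ZeroAtInfty ENNReal ComplexOrder

noncomputable section

namespace PadicFeller

variable {p : ℕ} [hp : Fact p.Prime] {n m : ℕ}

/-! ### The standard character -/

/-! Write q = p^n, σ for the symbol, and E_j for averaging over balls of radius p^(-j) (`ballMean`).
Since the character is trivial exactly on ℤ_p, cutting a transform off to the ball of radius p^j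
amounts to applying E_j on the other side (`fourierInv_indicator`). A radial multiplier is thus
assembled from the operators E_j, and its action can be read off from its values on spheres.

The heart is that the multiplier h = 1/(1+aσ) is a contraction for the sup norm
(`norm_fourierInv_resolvent_le`). Negative definiteness, tested with weights +1 on a finite sample
of a ball and -1 on its translate by a vector of the next sphere, shows that the mean of σ over a
ball is at most its value on the next sphere (`radMean_le_radValues`). As t ↦ 1/(1+at) is decreasing
and convex, the value of h on a sphere is at most the mean of h over the ball inside
(`resolvent_radValues_le`). Abel summation (`norm_fourierInv_cutOff_sub_le`) then writes truncations
of h as combinations, with nonnegative coefficients, of integrals over shells and of one ball mean,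
of total mass h(0) ≤ 1. This replaces convolution semigroups and Bochner's theorem.

The weight w enters through one fact: max(1,‖ξ‖) and σ are O(max(1,|w|))
(`IsAttachedWeight.bounds`). Hence for f in B_{w,∞} with transform g, Cauchy-Schwarz against
max(1,‖ξ‖)^(-n-1) puts (1+σ)g in L¹ ∩ L². By inversion f = 𝓕⁻¹g almost everywhere; 𝓕⁻¹g and 𝓕⁻¹(σg)
are continuous, vanish at infinity by Riemann-Lebesgue, and are real because σ is even.

Dissipativity is the contraction estimate applied to (1+cσ)g. Test functions lie in the domain and
are dense. For the range, the transform of a test function is multiplied by a locally constant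
truncation of h; the result is again the transform of a test function, and I - cP(∂) sends it
uniformly close to the original. The Lumer-Phillips argument (`isClosable_of_dissipative`,
`isMDissipative_closure`) concludes. -/

lemma norm_sub_fractPart_le (y : ℚ_[p]) : ‖y - ((fractPart y : ℚ) : ℚ_[p])‖ ≤ 1 := by
  have hp0 : (p : ℚ_[p]) ≠ 0 := by exact_mod_cast hp.out.ne_zero
  set k := polarOrder y with hk
  have h := (PadicInt.norm_le_pow_iff_mem_span_pow _ k).2 (PadicInt.appr_spec k (scaled y))
  rw [PadicInt.norm_def] at h
  have e : y - ((fractPart y : ℚ) : ℚ_[p]) =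
      ((scaled y - (PadicInt.appr (scaled y) k : ℤ_[p]) : ℤ_[p]) : ℚ_[p]) * ((p : ℚ_[p]) ^ k)⁻¹ := by
    rw [PadicInt.coe_sub, PadicInt.coe_natCast]
    simp only [fractPart, ← hk]
    have : ((scaled y : ℤ_[p]) : ℚ_[p]) = y * (p : ℚ_[p]) ^ k := rfl
    rw [this]
    push_cast
    field_simp
  rw [e, norm_mul, norm_inv, norm_pow, Padic.norm_p, inv_pow, inv_inv]
  have hp1 : (0 : ℝ) < p := by exact_mod_cast hp.out.pos
  calc _ ≤ (p : ℝ) ^ (-(k : ℤ)) * (p : ℝ) ^ k := by gcongr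
    _ = 1 := by rw [zpow_neg, zpow_natCast]; field_simp

lemma fractPart_form (y : ℚ_[p]) : ∃ (a : ℤ) (k : ℕ), fractPart y = (a : ℚ) / (p : ℚ) ^ k :=
  ⟨PadicInt.appr (scaled y) (polarOrder y), polarOrder y, by simp [fractPart]⟩

lemma exists_int_of_norm_le_one {r : ℚ} (h : ∃ (a : ℤ) (k : ℕ), r = (a : ℚ) / (p : ℚ) ^ k)
    (hr : ‖(r : ℚ_[p])‖ ≤ 1) : ∃ z : ℤ, r = z := by
  obtain ⟨a, k, rfl⟩ := h
  have hp1 : (0 : ℝ) < p := by exact_mod_cast hp.out.pos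
  have hp0 : (p : ℚ) ≠ 0 := by exact_mod_cast hp.out.ne_zero
  push_cast at hr
  rw [norm_div, norm_pow, Padic.norm_p, inv_pow, div_inv_eq_mul] at hr
  have : ‖(a : ℚ_[p])‖ ≤ (p : ℝ) ^ (-(k : ℤ)) := by
    rw [zpow_neg, zpow_natCast, ← one_div, le_div_iff₀ (by positivity)]
    exact hr
  obtain ⟨c, rfl⟩ := (Padic.norm_int_le_pow_iff_dvd a k).1 this
  exact ⟨c, by push_cast; field_simp⟩

/-- Two elements of ℤ[1/p] that both approximate y modulo ℤ_p differ by an element of ℤ[1/p] ∩ ℤ_p =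
ℤ, which the exponential does not see. The freedom in r gives additivity of the character without
any carrying of digits. -/
lemma chi_eq_of_norm_sub_le {y : ℚ_[p]} {r : ℚ}
    (hr : ∃ (a : ℤ) (k : ℕ), r = (a : ℚ) / (p : ℚ) ^ k) (h : ‖y - (r : ℚ_[p])‖ ≤ 1) :
    chi y = Complex.exp (2 * Real.pi * Complex.I * (r : ℂ)) := by
  have hp0 : (p : ℚ) ≠ 0 := by exact_mod_cast hp.out.ne_zero
  obtain ⟨a, k, ha⟩ := hr
  obtain ⟨b, l, hb⟩ := fractPart_form y
  have : ∃ z : ℤ, fractPart y - r = z := by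
    refine exists_int_of_norm_le_one (p := p) ⟨b * p ^ k - a * p ^ l, k + l, ?_⟩ ?_
    · rw [ha, hb]; push_cast; rw [pow_add]; field_simp
    · have e : ((fractPart y - r : ℚ) : ℚ_[p]) =
          (y - (r : ℚ_[p])) - (y - ((fractPart y : ℚ) : ℚ_[p])) := by push_cast; ring
      rw [e]
      rw [sub_eq_add_neg]
      refine (IsUltrametricDist.norm_add_le_max _ _).trans (max_le h ?_)
      rw [norm_neg]
      exact norm_sub_fractPart_le y
  obtain ⟨z, hz⟩ := this
  have hz' : fractPart y = r + z := by linarith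
  rw [chi, hz']
  push_cast
  rw [mul_add, Complex.exp_add, mul_comm (2 * (Real.pi : ℂ) * Complex.I) (z : ℂ),
    Complex.exp_int_mul_two_pi_mul_I, mul_one]

lemma chi_add (x y : ℚ_[p]) : chi (x + y) = chi x * chi y := by
  have hp0 : (p : ℚ) ≠ 0 := by exact_mod_cast hp.out.ne_zero
  obtain ⟨a, k, ha⟩ := fractPart_form x
  obtain ⟨b, l, hb⟩ := fractPart_form y
  rw [chi_eq_of_norm_sub_le (r := fractPart x + fractPart y)
    ⟨a * p ^ l + b * p ^ k, k + l, by rw [ha, hb]; push_cast; rw [pow_add]; field_simp⟩, chi, chi,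
    ← Complex.exp_add]
  · push_cast; ring_nf
  · have e : x + y - ((fractPart x + fractPart y : ℚ) : ℚ_[p]) =
        (x - ((fractPart x : ℚ) : ℚ_[p])) + (y - ((fractPart y : ℚ) : ℚ_[p])) := by
      push_cast; ring
    rw [e]
    exact (IsUltrametricDist.norm_add_le_max _ _).trans
      (max_le (norm_sub_fractPart_le x) (norm_sub_fractPart_le y))

/-- That the kernel is exactly ℤ_p, and not larger, makes the balls of radius p^j and p^(-j) exact
annihilators of each other. -/
lemma chi_eq_one_iff (y : ℚ_[p]) : chi y = 1 ↔ ‖y‖ ≤ 1 := by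
  constructor
  · intro h
    rw [chi, Complex.exp_eq_one_iff] at h
    obtain ⟨z, hz⟩ := h
    have h2 : (2 * Real.pi * Complex.I : ℂ) ≠ 0 := Complex.two_pi_I_ne_zero
    rw [mul_comm (z : ℂ)] at hz
    have h3 : ((fractPart y : ℚ) : ℂ) = (z : ℂ) := mul_left_cancel₀ h2 hz
    have h4 : fractPart y = (z : ℚ) := by exact_mod_cast h3
    have h5 := norm_sub_fractPart_le y
    rw [h4] at h5
    have e : y = (y - (((z : ℤ) : ℚ) : ℚ_[p])) + (z : ℚ_[p]) := by push_cast; ring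
    rw [e]
    exact (IsUltrametricDist.norm_add_le_max _ _).trans (max_le h5 (Padic.norm_int_le_one z))
  · intro h
    rw [chi_eq_of_norm_sub_le (r := 0) ⟨0, 0, by simp⟩ (by simpa using h)]
    simp

lemma chi_zero : chi (0 : ℚ_[p]) = 1 := (chi_eq_one_iff _).2 (by simp)

lemma norm_chi (y : ℚ_[p]) : ‖chi y‖ = 1 := by
  rw [chi, show (2 * Real.pi * Complex.I * ((fractPart y : ℚ) : ℂ) : ℂ) =
    ((2 * Real.pi * (fractPart y : ℝ) : ℝ) : ℂ) * Complex.I by push_cast; ring]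
  exact Complex.norm_exp_ofReal_mul_I _

lemma chi_neg (y : ℚ_[p]) : chi (-y) = (starRingEnd ℂ) (chi y) := by
  have h : chi (-y) * chi y = 1 := by rw [← chi_add]; simp [chi_zero]
  have h2 : (starRingEnd ℂ) (chi y) * chi y = 1 := by
    rw [mul_comm, Complex.mul_conj, Complex.normSq_eq_norm_sq, norm_chi]; simp
  have h3 : chi y ≠ 0 := by
    intro h0; rw [h0] at h; simp at h
  exact mul_right_cancel₀ h3 (h.trans h2.symm)

lemma continuous_chi : Continuous (chi : ℚ_[p] → ℂ) := by
  refine continuous_iff_continuousAt.2 fun y => ?_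
  refine ContinuousAt.congr (f := fun _ => chi y) continuousAt_const ?_
  filter_upwards [Metric.ball_mem_nhds y one_pos] with z hz
  have e : z = y + (z - y) := by ring
  rw [e, chi_add, (chi_eq_one_iff (z - y)).2, mul_one]
  rw [Metric.mem_ball, dist_eq_norm] at hz
  exact hz.le

/-! ### Balls -/

lemma one_lt_prime : (1 : ℝ) < p := by exact_mod_cast hp.out.one_lt

lemma prime_pos : (0 : ℝ) < p := by exact_mod_cast hp.out.pos

lemma zpow_prime_pos (j : ℤ) : (0 : ℝ) < (p : ℝ) ^ j := zpow_pos prime_pos j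

lemma norm_prime_zpow (j : ℤ) : ‖(p : ℚ_[p]) ^ (-j)‖ = (p : ℝ) ^ j := by
  rw [norm_zpow, Padic.norm_p, inv_zpow, ← zpow_neg, neg_neg]

/-- The ball `{x | ‖x‖ ≤ p ^ j}`, as a subgroup. -/
def pball (p : ℕ) [Fact p.Prime] (n : ℕ) (j : ℤ) : AddSubgroup (Fin n → ℚ_[p]) where
  carrier := {x | ‖x‖ ≤ (p : ℝ) ^ j}
  zero_mem' := by simpa using (zpow_prime_pos j).le
  add_mem' {x y} hx hy :=
    (IsUltrametricDist.norm_add_le_max x y).trans (max_le hx hy)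
  neg_mem' {x} hx := by simpa using hx

lemma mem_pball {j : ℤ} {x : Fin n → ℚ_[p]} : x ∈ pball p n j ↔ ‖x‖ ≤ (p : ℝ) ^ j := Iff.rfl

lemma coe_pball (j : ℤ) : (pball p n j : Set (Fin n → ℚ_[p])) =
    Metric.closedBall 0 ((p : ℝ) ^ j) := by
  ext x; simp [mem_pball]

lemma isCompact_pball (j : ℤ) : IsCompact (pball p n j : Set (Fin n → ℚ_[p])) := by
  rw [coe_pball]; exact isCompact_closedBall _ _

lemma isOpen_pball (j : ℤ) : IsOpen (pball p n j : Set (Fin n → ℚ_[p])) := by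
  rw [coe_pball]; exact IsUltrametricDist.isOpen_closedBall _ (zpow_prime_pos j).ne'

lemma measurableSet_pball (j : ℤ) : MeasurableSet (pball p n j : Set (Fin n → ℚ_[p])) :=
  (isOpen_pball j).measurableSet

lemma pball_mono {i j : ℤ} (h : i ≤ j) : pball p n i ≤ pball p n j := fun _ hx =>
  le_trans (mem_pball.1 hx) (zpow_le_zpow_right₀ one_lt_prime.le h)

lemma norm_apply_lt_iff (y : ℚ_[p]) (j : ℤ) : ‖y‖ < (p : ℝ) ^ (j + 1) ↔ ‖y‖ ≤ (p : ℝ) ^ j :=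
  (Padic.norm_le_pow_iff_norm_lt_pow_add_one y j).symm

lemma norm_lt_zpow_add_one_iff (x : Fin n → ℚ_[p]) (j : ℤ) :
    ‖x‖ < (p : ℝ) ^ (j + 1) ↔ x ∈ pball p n j := by
  rw [mem_pball, pi_norm_lt_iff (zpow_prime_pos _), pi_norm_le_iff_of_nonneg (zpow_prime_pos _).le]
  exact forall_congr' fun i => norm_apply_lt_iff _ _

lemma exists_mem_pball (x : Fin n → ℚ_[p]) : ∃ k : ℕ, x ∈ pball p n k := by
  obtain ⟨k, hk⟩ := pow_unbounded_of_one_lt ‖x‖ (one_lt_prime (p := p))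
  exact ⟨k, by rw [mem_pball, zpow_natCast]; exact hk.le⟩

lemma exists_zpow_lt {r : ℝ} (hr : 0 < r) : ∃ k : ℕ, (p : ℝ) ^ (-(k : ℤ)) < r := by
  obtain ⟨k, hk⟩ := exists_pow_lt_of_lt_one hr (inv_lt_one_of_one_lt₀ (one_lt_prime (p := p)))
  exact ⟨k, by rw [zpow_neg, zpow_natCast, ← inv_pow]; exact hk⟩

lemma exists_notMem_pball {x : Fin n → ℚ_[p]} (hx : x ≠ 0) : ∃ k : ℕ, x ∉ pball p n (-k) := by
  obtain ⟨k, hk⟩ := exists_zpow_lt (p := p) (norm_pos_iff.2 hx)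
  exact ⟨k, by rw [mem_pball, not_le]; exact hk⟩

/-! ### Haar measure of balls. -/

lemma isAddHaar_haar : (haar p n).IsAddHaarMeasure := by unfold haar; infer_instance

instance : (haar p n).IsAddHaarMeasure := isAddHaar_haar

instance : (haar p n).Regular := by unfold haar; infer_instance

lemma haar_pball_zero : haar p n (pball p n 0) = 1 := by
  have : (pball p n 0 : Set (Fin n → ℚ_[p])) = (unitBall p n : Set (Fin n → ℚ_[p])) := by
    rw [coe_pball, zpow_zero]; rfl
  rw [this]
  exact Measure.addHaarMeasure_self

/-- The vectors `p ^ (-j) d` whose coordinates are given by single digits. -/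
def digitVec (j : ℤ) (d : Fin n → Fin p) : Fin n → ℚ_[p] :=
  fun i => ((d i : ℕ) : ℚ_[p]) * (p : ℚ_[p]) ^ (-j)

lemma digitVec_mem (j : ℤ) (d : Fin n → Fin p) : digitVec j d ∈ pball p n j := by
  rw [mem_pball, pi_norm_le_iff_of_nonneg (zpow_prime_pos _).le]
  intro i
  rw [digitVec, norm_mul, norm_prime_zpow]
  have : ‖((d i : ℕ) : ℚ_[p])‖ ≤ 1 := by exact_mod_cast Padic.norm_int_le_one (p := p) (d i : ℕ)
  exact mul_le_of_le_one_left (zpow_prime_pos _).le this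

/-- Distinct digits differ by less than p in absolute value, so p does not divide their difference.
With `exists_digitVec`, the digit vectors form a complete set of representatives of `pball p n j`
modulo `pball p n (j - 1)`. -/
lemma digitVec_sub_notMem {j : ℤ} {d e : Fin n → Fin p} (h : d ≠ e) :
    digitVec j d - digitVec j e ∉ pball p n (j - 1) := by
  intro hmem
  apply h
  rw [mem_pball, pi_norm_le_iff_of_nonneg (zpow_prime_pos _).le] at hmem
  ext i
  have hi := hmem i
  have e1 : (digitVec j d - digitVec j e) i =
      (((d i : ℕ) - (e i : ℕ) : ℤ) : ℚ_[p]) * (p : ℚ_[p]) ^ (-j) := by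
    simp only [digitVec, Pi.sub_apply]; push_cast; ring
  rw [e1, ← norm_apply_lt_iff, norm_mul, norm_prime_zpow, sub_add_cancel] at hi
  have h2 : ‖(((d i : ℕ) - (e i : ℕ) : ℤ) : ℚ_[p])‖ < 1 := by
    by_contra hc
    exact absurd hi (not_lt.2 (le_mul_of_one_le_left (zpow_prime_pos _).le (not_lt.1 hc)))
  rw [Padic.norm_intCast_lt_one_iff] at h2
  have : ((d i : ℕ) : ℤ) = (e i : ℕ) := by
    have l1 := (d i).2
    have l2 := (e i).2
    obtain ⟨c, hc⟩ := h2
    have hc0 : c = 0 := by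
      have h4 : (p : ℤ) * c < p * 1 := by rw [← hc]; omega
      have h5 : (p : ℤ) * (-1) < p * c := by rw [← hc]; omega
      have hpp : (0 : ℤ) < p := by exact_mod_cast hp.out.pos
      have := lt_of_mul_lt_mul_left h4 hpp.le
      have := lt_of_mul_lt_mul_left h5 hpp.le
      omega
    rw [hc0] at hc; omega
  exact_mod_cast this

lemma exists_digitVec {j : ℤ} {x : Fin n → ℚ_[p]} (hx : x ∈ pball p n j) :
    ∃ d : Fin n → Fin p, x - digitVec j d ∈ pball p n (j - 1) := by
  rw [mem_pball, pi_norm_le_iff_of_nonneg (zpow_prime_pos _).le] at hx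
  have hp0 : (p : ℚ_[p]) ≠ 0 := by exact_mod_cast hp.out.ne_zero
  have key : ∀ i, ∃ d : Fin p, ‖x i - ((d : ℕ) : ℚ_[p]) * (p : ℚ_[p]) ^ (-j)‖ ≤ (p : ℝ) ^ (j - 1) := by
    intro i
    have h1 : ‖x i * (p : ℚ_[p]) ^ j‖ ≤ 1 := by
      have := norm_prime_zpow (p := p) (-j)
      rw [neg_neg] at this
      rw [norm_mul, this, zpow_neg]
      exact mul_inv_le_one_of_le₀ (hx i) (zpow_prime_pos _).le
    obtain ⟨d, hd, hm⟩ := PadicInt.exists_mem_range (⟨x i * (p : ℚ_[p]) ^ j, h1⟩ : ℤ_[p])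
    refine ⟨⟨d, hd⟩, ?_⟩
    rw [IsLocalRing.mem_maximalIdeal, PadicInt.mem_nonunits,
      PadicInt.norm_def] at hm
    rw [← norm_apply_lt_iff, sub_add_cancel]
    have e : x i - (d : ℚ_[p]) * (p : ℚ_[p]) ^ (-j) =
        (x i * (p : ℚ_[p]) ^ j - d) * (p : ℚ_[p]) ^ (-j) := by
      rw [sub_mul, mul_assoc, ← zpow_add₀ hp0]; simp
    rw [e, norm_mul, norm_prime_zpow]
    exact mul_lt_of_lt_one_left (zpow_prime_pos _) hm
  choose d hd using key
  exact ⟨d, by rw [mem_pball, pi_norm_le_iff_of_nonneg (zpow_prime_pos _).le]; exact hd⟩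

/-- The ball is the disjoint union of the translates of the next smaller ball by the p^n digit
vectors. -/
lemma haar_pball_succ (j : ℤ) :
    haar p n (pball p n j) = (p : ℝ≥0∞) ^ n * haar p n (pball p n (j - 1)) := by
  have hU : (pball p n j : Set (Fin n → ℚ_[p])) =
      ⋃ d : Fin n → Fin p, (fun x => x - digitVec j d) ⁻¹' (pball p n (j - 1)) := by
    ext x
    simp only [Set.mem_iUnion, Set.mem_preimage, SetLike.mem_coe]
    refine ⟨exists_digitVec, fun ⟨d, hd⟩ => ?_⟩
    have := (pball p n j).add_mem (pball_mono (by omega) hd) (digitVec_mem j d)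
    simpa using this
  rw [hU, measure_iUnion]
  · have : ∀ d : Fin n → Fin p, haar p n ((fun x => x - digitVec j d) ⁻¹' (pball p n (j - 1))) =
        haar p n (pball p n (j - 1)) := by
      intro d
      simp only [sub_eq_add_neg]
      exact measure_preimage_add_right _ _ _
    simp [this, tsum_fintype]
  · intro d e hde
    refine Set.disjoint_left.2 fun x hx hx' => digitVec_sub_notMem (j := j) hde ?_
    have := (pball p n (j - 1)).sub_mem hx' hx
    simpa using this
  · intro d
    exact (measurableSet_pball _).preimage (measurable_id.sub_const _)

lemma haar_pball_ne_top (j : ℤ) : haar p n (pball p n j) ≠ ∞ :=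
  (isCompact_pball j).measure_lt_top.ne

lemma haar_real_pball (j : ℤ) : (haar p n).real (pball p n j) = ((p : ℝ) ^ n) ^ j := by
  have hq : ((p : ℝ) ^ n) ≠ 0 := (pow_pos prime_pos n).ne'
  have step : ∀ j : ℤ, (haar p n).real (pball p n j) =
      (p : ℝ) ^ n * (haar p n).real (pball p n (j - 1)) := by
    intro j
    simp only [Measure.real]
    rw [haar_pball_succ]
    simp
  have h0 : (haar p n).real (pball p n 0) = 1 := by
    simp only [Measure.real]
    rw [haar_pball_zero]; simp
  induction j using Int.induction_on with
  | zero => simp [h0]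
  | succ i ih => rw [step, add_sub_cancel_right, ih, zpow_add_one₀ hq, mul_comm]
  | pred i ih =>
    have := step (-i)
    rw [ih] at this
    rw [zpow_sub_one₀ hq, this]
    field_simp

lemma haar_pball (j : ℤ) : haar p n (pball p n j) = ENNReal.ofReal (((p : ℝ) ^ n) ^ j) := by
  rw [← haar_real_pball, Measure.real, ENNReal.ofReal_toReal (haar_pball_ne_top j)]

/-! ### Duality of balls under the character. -/

lemma continuous_chi_dot (x : Fin n → ℚ_[p]) : Continuous fun ξ : Fin n → ℚ_[p] => chi (ξ ⬝ᵥ x) :=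
  continuous_chi.comp (continuous_id.dotProduct continuous_const)

lemma norm_dot_le (ξ x : Fin n → ℚ_[p]) : ‖ξ ⬝ᵥ x‖ ≤ ‖ξ‖ * ‖x‖ := by
  unfold dotProduct
  refine IsUltrametricDist.norm_sum_le_of_forall_le_of_nonneg (by positivity) fun i _ => ?_
  rw [norm_mul]
  gcongr
  · exact norm_le_pi_norm ξ i
  · exact norm_le_pi_norm x i

lemma chi_dot_eq_one {j : ℤ} {ξ x : Fin n → ℚ_[p]} (hξ : ξ ∈ pball p n j)
    (hx : x ∈ pball p n (-j)) : chi (ξ ⬝ᵥ x) = 1 := by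
  rw [chi_eq_one_iff]
  refine (norm_dot_le ξ x).trans ?_
  calc ‖ξ‖ * ‖x‖ ≤ (p : ℝ) ^ j * (p : ℝ) ^ (-j) := by
        exact mul_le_mul hξ hx (norm_nonneg _) (zpow_prime_pos _).le
    _ = 1 := by rw [← zpow_add₀ (prime_pos (p := p)).ne']; simp

/-- Some coordinate x_i has norm above p^(-j); the vector with the single entry p^(-j) at i, of norm
p^j, pairs with x outside ℤ_p. -/
lemma exists_chi_dot_ne_one {j : ℤ} {x : Fin n → ℚ_[p]} (hx : x ∉ pball p n (-j)) :
    ∃ t ∈ pball p n j, chi (t ⬝ᵥ x) ≠ 1 := by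
  rw [mem_pball, pi_norm_le_iff_of_nonneg (zpow_prime_pos _).le] at hx
  push Not at hx
  obtain ⟨i, hi⟩ := hx
  refine ⟨Pi.single i ((p : ℚ_[p]) ^ (-j)), ?_, ?_⟩
  · rw [mem_pball, Pi.norm_single, norm_prime_zpow]
  · rw [Ne, chi_eq_one_iff, single_dotProduct, norm_mul, norm_prime_zpow, not_le]
    calc (1 : ℝ) = (p : ℝ) ^ j * (p : ℝ) ^ (-j) := by rw [← zpow_add₀ (prime_pos (p := p)).ne']; simp
      _ < _ := by gcongr; exact zpow_prime_pos _

open Classical in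
/-- Orthogonality of characters on balls. -/
lemma integral_pball_chi (j : ℤ) (x : Fin n → ℚ_[p]) :
    ∫ ξ in (pball p n j : Set (Fin n → ℚ_[p])), chi (ξ ⬝ᵥ x) ∂(haar p n) =
      if x ∈ pball p n (-j) then (((p : ℝ) ^ n) ^ j : ℂ) else 0 := by
  split_ifs with h
  · rw [setIntegral_congr_fun (g := fun _ => (1 : ℂ)) (measurableSet_pball j)
      (fun ξ hξ => chi_dot_eq_one hξ h)]
    simp [haar_real_pball]
  · obtain ⟨t, ht, hne⟩ := exists_chi_dot_ne_one h
    set I := ∫ ξ in (pball p n j : Set (Fin n → ℚ_[p])), chi (ξ ⬝ᵥ x) ∂(haar p n) with hI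
    -- Translation by t preserves both the ball and the measure, and multiplies the integrand by a
    -- constant different from 1, so the integral is 0.
    have h1 : I = chi (t ⬝ᵥ x) * I := by
      rw [hI, ← integral_indicator (measurableSet_pball j)]
      conv_lhs => rw [← integral_add_right_eq_self _ t]
      rw [← integral_const_mul]
      congr 1
      ext ξ
      by_cases hξ : ξ ∈ pball p n j
      · rw [Set.indicator_of_mem (by exact add_mem hξ ht), Set.indicator_of_mem (by exact hξ),
          add_dotProduct, chi_add, mul_comm]
      · rw [Set.indicator_of_notMem, Set.indicator_of_notMem (by exact hξ), mul_zero]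
        intro hc
        exact hξ (by simpa using sub_mem (SetLike.mem_coe.1 hc) ht)
    have h2 : (chi (t ⬝ᵥ x) - 1) * I = 0 := by rw [sub_mul, ← h1]; ring
    exact (mul_eq_zero.1 h2).resolve_left (sub_ne_zero.2 hne)

/-! ### Test functions -/

/-- `φ` is supported in the ball `pball p n R` and invariant under translations by
`pball p n M`. -/
def TestLevel {E : Type*} [Zero E] (R M : ℤ) (φ : (Fin n → ℚ_[p]) → E) : Prop :=
  (∀ x, x ∉ pball p n R → φ x = 0) ∧ ∀ x, ∀ y ∈ pball p n M, φ (x + y) = φ x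

section TestLevel

variable {E : Type*} [NormedAddCommGroup E] {R M : ℤ} {φ : (Fin n → ℚ_[p]) → E}

lemma TestLevel.isLocallyConstant (h : TestLevel R M φ) : IsLocallyConstant φ := by
  refine (IsLocallyConstant.iff_eventually_eq φ).2 fun x => ?_
  have : (fun y => y - x) ⁻¹' (pball p n M : Set (Fin n → ℚ_[p])) ∈ 𝓝 x := by
    refine ((isOpen_pball M).preimage (continuous_id.sub continuous_const)).mem_nhds ?_
    simp [(pball p n M).zero_mem]
  filter_upwards [this] with y hy
  have := h.2 x (y - x) hy
  rwa [add_sub_cancel] at this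

lemma TestLevel.continuous (h : TestLevel R M φ) : Continuous φ := h.isLocallyConstant.continuous

lemma TestLevel.hasCompactSupport (h : TestLevel R M φ) : HasCompactSupport φ :=
  HasCompactSupport.intro (isCompact_pball R) fun x hx => h.1 x hx

lemma TestLevel.integrable (h : TestLevel R M φ) : Integrable φ (haar p n) :=
  h.continuous.integrable_of_hasCompactSupport h.hasCompactSupport

lemma TestLevel.memLp (h : TestLevel R M φ) (q : ℝ≥0∞) : MemLp φ q (haar p n) :=
  h.continuous.memLp_of_hasCompactSupport h.hasCompactSupport

lemma exists_support_pball (h : HasCompactSupport φ) :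
    ∃ R : ℕ, ∀ x, x ∉ pball p n R → φ x = 0 := by
  obtain ⟨r, hr⟩ := h.isCompact.isBounded.subset_closedBall 0
  obtain ⟨k, hk⟩ := pow_unbounded_of_one_lt r (one_lt_prime (p := p))
  refine ⟨k, fun x hx => image_eq_zero_of_notMem_tsupport fun hc => hx ?_⟩
  have := hr hc
  rw [mem_closedBall_zero_iff] at this
  rw [mem_pball, zpow_natCast]
  exact this.trans hk.le

/-- The level sets form an open cover of the compact support; a Lebesgue number of this cover is a
uniform radius of constancy. -/
lemma exists_testLevel (h1 : IsLocallyConstant φ) (h2 : HasCompactSupport φ) :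
    ∃ R M : ℕ, TestLevel (p := p) (n := n) R (-M) φ := by
  obtain ⟨R, hR⟩ := exists_support_pball h2
  obtain ⟨δ, hδ, hc⟩ := lebesgue_number_lemma_of_metric (s := tsupport φ)
    (c := fun e : E => φ ⁻¹' {e}) h2.isCompact (fun e => h1 _) (fun x _ => by simp)
  obtain ⟨M, hM⟩ := exists_zpow_lt (p := p) hδ
  refine ⟨R, M, hR, ?_⟩
  have key : ∀ x ∈ tsupport φ, ∀ y ∈ pball p n (-M), φ (x + y) = φ x := by
    intro x hx y hy
    obtain ⟨e, he⟩ := hc x hx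
    have e1 : φ x = e := he (Metric.mem_ball_self hδ)
    have e2 : φ (x + y) = e := he (by
      rw [Metric.mem_ball, dist_eq_norm, add_sub_cancel_left]; exact (mem_pball.1 hy).trans_lt hM)
    rw [e1, e2]
  intro x y hy
  by_cases hx : x ∈ tsupport φ
  · exact key x hx y hy
  -- A point off the support may be moved into it; then the uniform constancy is applied at x + y
  -- with the translation -y.
  by_cases hxy : x + y ∈ tsupport φ
  · have := key (x + y) hxy (-y) (neg_mem hy)
    rw [add_neg_cancel_right] at this
    exact this.symm
  · rw [image_eq_zero_of_notMem_tsupport hx, image_eq_zero_of_notMem_tsupport hxy]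

lemma exists_testLevel_sub_le {u : (Fin n → ℚ_[p]) → E} (hu : Continuous u) {ε : ℝ} (hε : 0 < ε)
    {R : ℤ} (hR : ∀ x, x ∉ pball p n R → ‖u x‖ ≤ ε) :
    ∃ (M : ℤ) (θ : (Fin n → ℚ_[p]) → E), TestLevel R M θ ∧ ∀ x, ‖u x - θ x‖ ≤ ε := by
  classical
  have huc := (isCompact_pball R).uniformContinuousOn_of_continuous (hu.continuousOn)
  obtain ⟨δ, hδ, hd⟩ := Metric.uniformContinuousOn_iff.1 huc ε hε
  obtain ⟨k, hk⟩ := exists_zpow_lt (p := p) hδ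
  -- The bound M ≤ -k puts every point within δ of the representative of its coset; M ≤ R makes the
  -- ball of level R a union of cosets, so cutting off outside it keeps invariance.
  set M : ℤ := min (-k) R with hM
  let rep : (Fin n → ℚ_[p]) → (Fin n → ℚ_[p]) := fun x =>
    (QuotientAddGroup.mk x : (Fin n → ℚ_[p]) ⧸ pball p n M).out
  have hrep : ∀ x, -x + rep x ∈ pball p n M := fun x =>
    QuotientAddGroup.eq.1 (QuotientAddGroup.out_eq' (QuotientAddGroup.mk x)).symm
  refine ⟨M, fun x => if x ∈ pball p n R then u (rep x) else 0,
    ⟨fun x hx => if_neg hx, fun x y hy => ?_⟩, fun x => ?_⟩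
  · have h1 : rep (x + y) = rep x := by
      have : (QuotientAddGroup.mk (x + y) : (Fin n → ℚ_[p]) ⧸ pball p n M) =
          QuotientAddGroup.mk x := QuotientAddGroup.eq.2 (by simpa using hy)
      simp only [rep, this]
    have h2 : x + y ∈ pball p n R ↔ x ∈ pball p n R :=
      (pball p n R).add_mem_cancel_right (pball_mono (min_le_right _ _) hy)
    simp only [h1, h2]
  · beta_reduce
    by_cases hx : x ∈ pball p n R
    · have hx2 : rep x ∈ pball p n R := by
        have := add_mem hx (pball_mono (min_le_right (-(k : ℤ)) R) (hrep x))
        rwa [add_neg_cancel_left] at this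
      rw [if_pos hx, ← dist_eq_norm]
      refine (hd x hx _ hx2 ?_).le
      rw [dist_comm, dist_eq_norm, ← neg_add_eq_sub]
      exact ((pball_mono (min_le_left (-(k : ℤ)) R) (hrep x) :).trans_lt hk)
    · rw [if_neg hx, sub_zero]; exact hR x hx

lemma exists_testLevel_integral_sub_le {E : Type*} [NormedAddCommGroup E] [NormedSpace ℝ E]
    {G : (Fin n → ℚ_[p]) → E} (hG : Integrable G (haar p n))
    {ε : ℝ} (hε : 0 < ε) : ∃ (R M : ℤ) (θ : (Fin n → ℚ_[p]) → E), TestLevel R M θ ∧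
      ∫ x, ‖G x - θ x‖ ∂(haar p n) ≤ ε := by
  obtain ⟨g, hg1, hg2, hg3, hg4⟩ :=
    hG.exists_hasCompactSupport_integral_sub_le (half_pos hε)
  obtain ⟨R, hR⟩ := exists_support_pball hg1
  have hq : (0 : ℝ) < ((p : ℝ) ^ n) ^ (R : ℤ) := zpow_pos (pow_pos prime_pos n) _
  -- A uniform error δ on a ball of measure q^R costs ε/2 in L¹; the other ε/2 is spent on passing
  -- from G to g.
  set δ := ε / 2 / ((p : ℝ) ^ n) ^ (R : ℤ) with hδdef
  have hδ : 0 < δ := by positivity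
  obtain ⟨M, θ, hθ, hb⟩ := exists_testLevel_sub_le (R := R) hg3 hδ
    (fun x hx => by rw [hR x hx, norm_zero]; exact hδ.le)
  refine ⟨R, M, θ, hθ, ?_⟩
  have h1 : ∫ x, ‖g x - θ x‖ ∂(haar p n) ≤ ε / 2 := by
    have e : ∫ x, ‖g x - θ x‖ ∂(haar p n) =
        ∫ x in (pball p n R : Set (Fin n → ℚ_[p])), ‖g x - θ x‖ ∂(haar p n) := by
      rw [← integral_indicator (measurableSet_pball _)]
      congr 1; ext x
      by_cases hx : x ∈ pball p n R
      · rw [Set.indicator_of_mem (by exact hx)]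
      · rw [Set.indicator_of_notMem (by exact hx), hR x hx, hθ.1 x hx]; simp
    rw [e]
    calc _ ≤ ∫ x in (pball p n R : Set (Fin n → ℚ_[p])), δ ∂(haar p n) := by
          refine setIntegral_mono_on ((hg4.sub hθ.integrable).norm.integrableOn)
            (integrableOn_const (haar_pball_ne_top _)) (measurableSet_pball _) fun x _ => hb x
      _ = ε / 2 := by
          rw [setIntegral_const, haar_real_pball, smul_eq_mul, hδdef]; field_simp
  calc ∫ x, ‖G x - θ x‖ ∂(haar p n)
      ≤ ∫ x, (‖G x - g x‖ + ‖g x - θ x‖) ∂(haar p n) := by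
        refine integral_mono (hG.sub hθ.integrable).norm
          ((hG.sub hg4).norm.add (hg4.sub hθ.integrable).norm) fun x => ?_
        exact norm_sub_le_norm_sub_add_norm_sub _ _ _
    _ ≤ ε := by
        refine (integral_add (hG.sub hg4).norm (hg4.sub hθ.integrable).norm).trans_le ?_
        simp only [Pi.sub_apply]
        linarith

end TestLevel

lemma isTestFunction_iff {φ : (Fin n → ℚ_[p]) → ℝ} :
    IsTestFunction φ ↔ ∃ R M : ℤ, TestLevel R M φ := by
  constructor
  · rintro ⟨h1, h2⟩
    obtain ⟨R, M, h⟩ := exists_testLevel h1 h2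
    exact ⟨R, _, h⟩
  · rintro ⟨R, M, h⟩
    exact ⟨h.isLocallyConstant, h.hasCompactSupport⟩

lemma TestLevel.ofReal {R M : ℤ} {φ : (Fin n → ℚ_[p]) → ℝ} (h : TestLevel R M φ) :
    TestLevel R M fun x => (φ x : ℂ) :=
  ⟨fun x hx => by simp [h.1 x hx], fun x y hy => congrArg _ (h.2 x y hy)⟩

/-! ### The Fourier transform of integrable functions -/

/-- The inverse Fourier transform of an integrable function. -/
def fourierInv (g : (Fin n → ℚ_[p]) → ℂ) (x : Fin n → ℚ_[p]) : ℂ := fourierL1 g (-x)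

lemma continuous_chi_dot' (x : Fin n → ℚ_[p]) : Continuous fun ξ : Fin n → ℚ_[p] => chi (x ⬝ᵥ ξ) :=
  continuous_chi.comp (continuous_const.dotProduct continuous_id)

lemma integrable_chi_mul {f : (Fin n → ℚ_[p]) → ℂ} {μ : Measure (Fin n → ℚ_[p])}
    (hf : Integrable f μ) (ξ : Fin n → ℚ_[p]) : Integrable (fun x => chi (ξ ⬝ᵥ x) * f x) μ :=
  hf.bdd_mul (c := 1) (continuous_chi_dot' ξ).aestronglyMeasurable
    (Eventually.of_forall fun _ => (norm_chi _).le)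

lemma norm_fourierL1_le (f : (Fin n → ℚ_[p]) → ℂ) (ξ : Fin n → ℚ_[p]) :
    ‖fourierL1 f ξ‖ ≤ ∫ x, ‖f x‖ ∂(haar p n) := by
  refine (norm_integral_le_integral_norm _).trans (le_of_eq ?_)
  congr 1; ext x; rw [norm_mul, norm_chi, one_mul]

lemma fourierL1_sub {f g : (Fin n → ℚ_[p]) → ℂ} (hf : Integrable f (haar p n))
    (hg : Integrable g (haar p n)) (ξ : Fin n → ℚ_[p]) :
    fourierL1 (fun x => f x - g x) ξ = fourierL1 f ξ - fourierL1 g ξ := by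
  simp only [fourierL1, mul_sub]
  exact integral_sub (integrable_chi_mul hf ξ) (integrable_chi_mul hg ξ)

lemma fourierL1_add {f g : (Fin n → ℚ_[p]) → ℂ} (hf : Integrable f (haar p n))
    (hg : Integrable g (haar p n)) (ξ : Fin n → ℚ_[p]) :
    fourierL1 (fun x => f x + g x) ξ = fourierL1 f ξ + fourierL1 g ξ := by
  simp only [fourierL1, mul_add]
  exact integral_add (integrable_chi_mul hf ξ) (integrable_chi_mul hg ξ)

lemma fourierL1_const_mul (c : ℂ) (f : (Fin n → ℚ_[p]) → ℂ) (ξ : Fin n → ℚ_[p]) :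
    fourierL1 (fun x => c * f x) ξ = c * fourierL1 f ξ := by
  simp only [fourierL1, ← integral_const_mul]
  congr 1; ext x; ring

lemma fourierL1_congr_ae {f g : (Fin n → ℚ_[p]) → ℂ} (h : f =ᵐ[haar p n] g) :
    fourierL1 f = fourierL1 g := by
  ext ξ
  refine integral_congr_ae ?_
  filter_upwards [h] with x hx
  rw [hx]

lemma continuous_fourierL1 {f : (Fin n → ℚ_[p]) → ℂ} (hf : Integrable f (haar p n)) :
    Continuous (fourierL1 f) := by
  refine continuous_of_dominated (bound := fun x => ‖f x‖) (fun ξ => ?_) (fun ξ => ?_) hf.norm ?_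
  · exact (integrable_chi_mul hf ξ).aestronglyMeasurable
  · exact Eventually.of_forall fun x => by rw [norm_mul, norm_chi, one_mul]
  · exact Eventually.of_forall fun x => (continuous_chi_dot x).mul continuous_const

/-- The transform of a function supported in a ball is locally constant. -/
lemma fourierL1_add_of_support {f : (Fin n → ℚ_[p]) → ℂ} {R : ℤ}
    (hf : ∀ x, x ∉ pball p n R → f x = 0) (ξ : Fin n → ℚ_[p]) {η : Fin n → ℚ_[p]}
    (hη : η ∈ pball p n (-R)) : fourierL1 f (ξ + η) = fourierL1 f ξ := by
  simp only [fourierL1]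
  congr 1; ext x
  by_cases hx : x ∈ pball p n R
  · rw [add_dotProduct, chi_add, dotProduct_comm η x, chi_dot_eq_one hx hη, mul_one]
  · rw [hf x hx]; simp

/-- The transform of a function invariant under a ball has compact support. -/
lemma fourierL1_eq_zero_of_invariant {f : (Fin n → ℚ_[p]) → ℂ} {M : ℤ}
    (hf : ∀ x, ∀ y ∈ pball p n M, f (x + y) = f x) {ξ : Fin n → ℚ_[p]}
    (hξ : ξ ∉ pball p n (-M)) : fourierL1 f ξ = 0 := by
  obtain ⟨t, ht, hne⟩ := exists_chi_dot_ne_one hξ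
  have h : fourierL1 f ξ = chi (t ⬝ᵥ ξ) * fourierL1 f ξ := by
    conv_lhs => rw [fourierL1, ← integral_add_right_eq_self _ t]
    rw [fourierL1, ← integral_const_mul]
    congr 1; ext x
    rw [hf x t ht, dotProduct_add, chi_add, dotProduct_comm ξ t]; ring
  have h2 : (chi (t ⬝ᵥ ξ) - 1) * fourierL1 f ξ = 0 := by rw [sub_mul, ← h]; ring
  exact (mul_eq_zero.1 h2).resolve_left (sub_ne_zero.2 hne)

lemma TestLevel.fourierL1 {f : (Fin n → ℚ_[p]) → ℂ} {R M : ℤ} (h : TestLevel R M f) :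
    TestLevel (-M) (-R) (fourierL1 f) :=
  ⟨fun _ hξ => fourierL1_eq_zero_of_invariant h.2 hξ,
    fun ξ _ hη => fourierL1_add_of_support h.1 ξ hη⟩

lemma TestLevel.comp_neg {f : (Fin n → ℚ_[p]) → ℂ} {R M : ℤ} (h : TestLevel R M f) :
    TestLevel R M (fun x => f (-x)) :=
  ⟨fun x hx => h.1 _ (by simpa using hx), fun x y hy => by
    beta_reduce
    rw [neg_add]; exact h.2 _ _ (neg_mem hy)⟩

lemma TestLevel.fourierInv {f : (Fin n → ℚ_[p]) → ℂ} {R M : ℤ} (h : TestLevel R M f) :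
    TestLevel (-M) (-R) (fourierInv f) := h.fourierL1.comp_neg

lemma integrable_chi_mul_prod {f g : (Fin n → ℚ_[p]) → ℂ} (hf : Integrable f (haar p n))
    (hg : Integrable g (haar p n)) :
    Integrable (Function.uncurry fun ξ x => chi (ξ ⬝ᵥ x) * f x * g ξ)
      ((haar p n).prod (haar p n)) := by
  have h := (hg.mul_prod hf).bdd_mul (c := 1)
    (f := fun z : (Fin n → ℚ_[p]) × (Fin n → ℚ_[p]) => chi (z.1 ⬝ᵥ z.2))
    (continuous_chi.comp (continuous_fst.dotProduct continuous_snd)).aestronglyMeasurable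
    (Eventually.of_forall fun x => (norm_chi _).le)
  refine h.congr (Eventually.of_forall fun z => ?_)
  simp only [Function.uncurry]; ring

/-- Fubini and the symmetry of the pairing. The inversion formulas and the L² bound below come from
this identity for suitable g: a truncated character, the indicator of a ball, a truncated conjugate
transform, a test function. -/
lemma integral_fourierL1_mul {f g : (Fin n → ℚ_[p]) → ℂ} (hf : Integrable f (haar p n))
    (hg : Integrable g (haar p n)) :
    ∫ ξ, fourierL1 f ξ * g ξ ∂(haar p n) = ∫ x, f x * fourierL1 g x ∂(haar p n) := by
  simp only [fourierL1, ← integral_mul_const, ← integral_const_mul]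
  rw [integral_integral_swap (integrable_chi_mul_prod hf hg)]
  congr 1; ext x; congr 1; ext ξ
  rw [dotProduct_comm]; ring

/-- The mean of `f` over the ball of radius `p ^ (-j)` around `x`. -/
def ballMean (j : ℤ) (f : (Fin n → ℚ_[p]) → ℂ) (x : Fin n → ℚ_[p]) : ℂ :=
  (((p : ℝ) ^ n) ^ j : ℝ) * ∫ t in (pball p n (-j) : Set (Fin n → ℚ_[p])), f (x + t) ∂(haar p n)

/-- The multiplication formula moves the cut-off onto a truncated character, whose transform is, by
orthogonality, q^j times the indicator of the ball of radius p^(-j) around x. -/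
lemma fourierInv_indicator_fourierL1 {f : (Fin n → ℚ_[p]) → ℂ} (hf : Integrable f (haar p n))
    (j : ℤ) (x : Fin n → ℚ_[p]) :
    fourierInv ((pball p n j : Set (Fin n → ℚ_[p])).indicator (fourierL1 f)) x =
      ballMean j f x := by
  classical
  have hi : Integrable ((pball p n j : Set (Fin n → ℚ_[p])).indicator
      fun ξ => chi (ξ ⬝ᵥ (-x))) (haar p n) :=
    IntegrableOn.integrable_indicator
      ((continuous_chi_dot _).continuousOn.integrableOn_compact (isCompact_pball j))
      (measurableSet_pball j)
  have h1 : fourierInv ((pball p n j : Set (Fin n → ℚ_[p])).indicator (fourierL1 f)) x =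
      ∫ ξ, fourierL1 f ξ * (pball p n j : Set (Fin n → ℚ_[p])).indicator
        (fun ξ => chi (ξ ⬝ᵥ (-x))) ξ ∂(haar p n) := by
    rw [fourierInv, fourierL1]
    congr 1; ext ξ
    by_cases hξ : ξ ∈ pball p n j
    · rw [Set.indicator_of_mem (by exact hξ), Set.indicator_of_mem (by exact hξ),
        dotProduct_comm, mul_comm]
    · rw [Set.indicator_of_notMem (by exact hξ), Set.indicator_of_notMem (by exact hξ)]; simp
  have h2 : ∀ y, fourierL1 ((pball p n j : Set (Fin n → ℚ_[p])).indicator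
      fun ξ => chi (ξ ⬝ᵥ (-x))) y =
      if y - x ∈ pball p n (-j) then (((p : ℝ) ^ n) ^ j : ℂ) else 0 := by
    intro y
    rw [← integral_pball_chi, ← integral_indicator (measurableSet_pball j), fourierL1]
    congr 1; ext ξ
    by_cases hξ : ξ ∈ pball p n j
    · rw [Set.indicator_of_mem (by exact hξ), Set.indicator_of_mem (by exact hξ),
        dotProduct_comm y, ← chi_add, ← dotProduct_add, sub_eq_add_neg]
    · rw [Set.indicator_of_notMem (by exact hξ), Set.indicator_of_notMem (by exact hξ)]; simp
  rw [h1, integral_fourierL1_mul hf hi, ← integral_add_left_eq_self _ x, ballMean,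
    ← integral_indicator (measurableSet_pball _), ← integral_const_mul]
  congr 1; ext t
  rw [h2, add_sub_cancel_left]
  by_cases ht : t ∈ pball p n (-j)
  · rw [if_pos ht, Set.indicator_of_mem (by exact ht), mul_comm]; push_cast; rfl
  · rw [if_neg ht, Set.indicator_of_notMem (by exact ht)]; simp

lemma ballMean_of_invariant {j : ℤ} {f : (Fin n → ℚ_[p]) → ℂ} {x : Fin n → ℚ_[p]}
    (h : ∀ y ∈ pball p n (-j), f (x + y) = f x) : ballMean j f x = f x := by
  have hq : ((p : ℝ) ^ n) ≠ 0 := (pow_pos prime_pos n).ne'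
  rw [ballMean, setIntegral_congr_fun (g := fun _ => f x) (measurableSet_pball _)
    (fun t ht => h t ht), setIntegral_const, haar_real_pball, Complex.real_smul, ← mul_assoc,
    ← Complex.ofReal_mul, ← zpow_add₀ hq]
  simp

/-- The transform vanishes outside the ball of level -M, so cutting it off there changes nothing;
averaging f over the dual ball, under which f is invariant, changes nothing either. -/
lemma TestLevel.fourierInv_fourierL1 {f : (Fin n → ℚ_[p]) → ℂ} {R M : ℤ} (h : TestLevel R M f) :
    PadicFeller.fourierInv (PadicFeller.fourierL1 f) = f := by
  ext x
  rw [← ballMean_of_invariant (j := -M) (x := x) (f := f) (by rw [neg_neg]; exact h.2 x),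
    ← fourierInv_indicator_fourierL1 h.integrable]
  congr 1; ext ξ
  by_cases hξ : ξ ∈ pball p n (-M)
  · rw [Set.indicator_of_mem (by exact hξ)]
  · rw [Set.indicator_of_notMem (by exact hξ), h.fourierL1.1 ξ hξ]

lemma fourierL1_comp_neg (f : (Fin n → ℚ_[p]) → ℂ) (ξ : Fin n → ℚ_[p]) :
    fourierL1 (fun x => f (-x)) ξ = fourierL1 f (-ξ) := by
  rw [fourierL1, ← integral_neg_eq_self]
  simp [fourierL1]

lemma TestLevel.fourierL1_fourierInv {f : (Fin n → ℚ_[p]) → ℂ} {R M : ℤ} (h : TestLevel R M f) :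
    PadicFeller.fourierL1 (PadicFeller.fourierInv f) = f := by
  ext ξ
  have h1 := congrFun h.comp_neg.fourierInv_fourierL1 (-ξ)
  rw [neg_neg] at h1
  rw [← h1, PadicFeller.fourierInv, neg_neg]
  congr 1; ext x
  rw [PadicFeller.fourierInv, fourierL1_comp_neg]

/-- The inverse transform of an integrable function averages over balls after cut-off. -/
lemma fourierInv_indicator {g : (Fin n → ℚ_[p]) → ℂ} (hg : Integrable g (haar p n))
    (j : ℤ) (x : Fin n → ℚ_[p]) :
    fourierInv ((pball p n j : Set (Fin n → ℚ_[p])).indicator g) x =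
      ballMean j (fourierInv g) x := by
  classical
  have hq : ((p : ℝ) ^ n) ≠ 0 := (pow_pos prime_pos n).ne'
  have hi : Integrable ((pball p n (-j) : Set (Fin n → ℚ_[p])).indicator
      fun _ => (1 : ℂ)) (haar p n) :=
    IntegrableOn.integrable_indicator
      (continuous_const.continuousOn.integrableOn_compact (isCompact_pball _))
      (measurableSet_pball _)
  have hx : Integrable (fun ξ => chi ((-x) ⬝ᵥ ξ) * g ξ) (haar p n) := integrable_chi_mul hg _
  -- The ball integral of the inverse transform pairs an indicator with the transform of a modulated
  -- g, so the multiplication formula applies a second time.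
  have h1 : ∫ t in (pball p n (-j) : Set (Fin n → ℚ_[p])), fourierInv g (x + t) ∂(haar p n) =
      ∫ t, fourierL1 (fun ξ => chi ((-x) ⬝ᵥ ξ) * g ξ) t *
        (pball p n (-j) : Set (Fin n → ℚ_[p])).indicator (fun _ => (1 : ℂ)) t ∂(haar p n) := by
    rw [← integral_indicator (measurableSet_pball _), ← integral_neg_eq_self]
    congr 1; ext t
    by_cases ht : t ∈ pball p n (-j)
    · rw [Set.indicator_of_mem (by simpa using ht), Set.indicator_of_mem (by exact ht), mul_one,
        fourierInv, fourierL1, fourierL1]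
      congr 1; ext ξ
      rw [neg_add, neg_neg, add_dotProduct, chi_add]; ring
    · rw [Set.indicator_of_notMem (by simpa using ht), Set.indicator_of_notMem (by exact ht),
        mul_zero]
  have h2 : ∀ ξ, fourierL1 ((pball p n (-j) : Set (Fin n → ℚ_[p])).indicator
      (fun _ => (1 : ℂ))) ξ = if ξ ∈ pball p n j then (((p : ℝ) ^ n) ^ (-j) : ℂ) else 0 := by
    intro ξ
    have := integral_pball_chi (-j) ξ
    rw [neg_neg] at this
    rw [← this, ← integral_indicator (measurableSet_pball _), fourierL1]
    congr 1; ext t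
    by_cases ht : t ∈ pball p n (-j)
    · rw [Set.indicator_of_mem (by exact ht), Set.indicator_of_mem (by exact ht),
        dotProduct_comm, mul_one]
    · rw [Set.indicator_of_notMem (by exact ht), Set.indicator_of_notMem (by exact ht), mul_zero]
  rw [ballMean, h1, integral_fourierL1_mul hx hi, fourierInv, fourierL1, ← integral_const_mul]
  congr 1; ext ξ
  rw [h2]
  by_cases hξ : ξ ∈ pball p n j
  · rw [if_pos hξ, Set.indicator_of_mem (by exact hξ)]
    have : ((((p : ℝ) ^ n) ^ j : ℝ) : ℂ) * (((p : ℝ) ^ n) ^ (-j) : ℂ) = 1 := by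
      have h3 : (((p : ℝ) : ℂ) ^ n) ≠ 0 := by exact_mod_cast hq
      push_cast
      rw [← zpow_add₀ (by exact_mod_cast h3)]; simp
    linear_combination (-(chi (-x ⬝ᵥ ξ) * g ξ)) * this
  · rw [if_neg hξ, Set.indicator_of_notMem (by exact hξ)]; simp

/-- The Riemann-Lebesgue lemma. -/
lemma tendsto_fourierL1_cocompact {G : (Fin n → ℚ_[p]) → ℂ} (hG : Integrable G (haar p n)) :
    Tendsto (fourierL1 G) (cocompact (Fin n → ℚ_[p])) (𝓝 0) := by
  rw [Metric.tendsto_nhds]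
  intro ε hε
  obtain ⟨R, M, θ, hθ, hb⟩ := exists_testLevel_integral_sub_le hG (half_pos hε)
  filter_upwards [(isCompact_pball (-M)).compl_mem_cocompact] with ξ hξ
  rw [dist_zero_right]
  have h0 := hθ.fourierL1.1 ξ hξ
  have h1 := fourierL1_sub hG hθ.integrable ξ
  rw [h0, sub_zero] at h1
  rw [← h1]
  have := norm_fourierL1_le (fun x => G x - θ x) ξ
  linarith

/-! ### Radial negative definite functions -/

/-- A vector of norm `p ^ j` (if `n > 0`). -/
def radVec (p : ℕ) [Fact p.Prime] (n : ℕ) (j : ℤ) : Fin n → ℚ_[p] := fun _ => (p : ℚ_[p]) ^ (-j)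

lemma norm_radVec [Nonempty (Fin n)] (j : ℤ) : ‖radVec p n j‖ = (p : ℝ) ^ j := by
  unfold radVec
  rw [pi_norm_const, norm_prime_zpow]

lemma norm_eq_norm_radVec {j : ℤ} {x : Fin n → ℚ_[p]} (hx : x ∈ pball p n j)
    (hx' : x ∉ pball p n (j - 1)) : ‖x‖ = ‖radVec p n j‖ := by
  have : Nonempty (Fin n) := by
    by_contra hc
    rw [not_nonempty_iff] at hc
    exact hx' (Subsingleton.elim 0 x ▸ zero_mem _)
  rw [norm_radVec]
  rw [← norm_lt_zpow_add_one_iff, sub_add_cancel, not_lt] at hx'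
  exact le_antisymm hx hx'

lemma norm_add_radVec {j : ℤ} {x : Fin n → ℚ_[p]} (hx : x ∈ pball p n (j - 1)) :
    ‖x + radVec p n j‖ = ‖radVec p n j‖ := by
  rcases isEmpty_or_nonempty (Fin n) with h | h
  · congr 1; exact Subsingleton.elim _ _
  · rw [← norm_lt_zpow_add_one_iff, sub_add_cancel, ← norm_radVec (n := n)] at hx
    rw [IsUltrametricDist.norm_add_eq_max_of_norm_ne_norm hx.ne, max_eq_right hx.le]

lemma norm_sub_radVec {j : ℤ} {x : Fin n → ℚ_[p]} (hx : x ∈ pball p n (j - 1)) :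
    ‖x - radVec p n j‖ = ‖radVec p n j‖ := by
  rw [← norm_neg, neg_sub, sub_eq_add_neg, add_comm]
  exact norm_add_radVec (neg_mem hx)

/-- Means over balls of the radial function with values `c 0` on a ball and `c (k + 1)` on the
consecutive spheres around it; `q` is the index of consecutive balls. -/
def radMean (q : ℝ) (c : ℕ → ℝ) : ℕ → ℝ
  | 0 => c 0
  | k + 1 => radMean q c k / q + (1 - 1 / q) * c (k + 1)

/-- The values of a radial function on the ball `pball p n s` (taken at the centre) and on the
spheres around it. -/
def radValues (ψ : (Fin n → ℚ_[p]) → ℝ) (s : ℤ) : ℕ → ℝ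
  | 0 => ψ 0
  | k + 1 => ψ (radVec p n (s + (k + 1 : ℕ)))

/-- When the coefficients sum to zero, the contributions of ψ(x_i) and of the conjugate of ψ(x_j)
cancel, and only -ψ(x_i - x_j) remains. -/
lemma IsNegativeDefinite.sum_nonpos {ψ : (Fin n → ℚ_[p]) → ℝ}
    (h : IsNegativeDefinite fun ξ => (ψ ξ : ℂ)) {ι : Type} [Fintype ι]
    (x : ι → (Fin n → ℚ_[p])) (c : ι → ℝ) (hc : ∑ i, c i = 0) :
    ∑ i, ∑ j, ψ (x i - x j) * (c i * c j) ≤ 0 := by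
  have e := Fintype.equivFin ι
  have h1 := h (Fintype.card ι) (x ∘ e.symm) (fun i => (c (e.symm i) : ℂ))
  have h2 : (∑ i, ∑ j, ((ψ ((x ∘ e.symm) i) : ℂ) + (starRingEnd ℂ) (ψ ((x ∘ e.symm) j) : ℂ)
      - (ψ ((x ∘ e.symm) i - (x ∘ e.symm) j) : ℂ)) * (c (e.symm i) : ℂ)
      * (starRingEnd ℂ) (c (e.symm j) : ℂ)) =
      ((∑ i, ∑ j, (ψ (x i) + ψ (x j) - ψ (x i - x j)) * (c i * c j) : ℝ) : ℂ) := by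
    push_cast
    rw [← e.symm.sum_comp]
    refine Finset.sum_congr rfl fun i _ => ?_
    rw [← e.symm.sum_comp (fun j => ((ψ (x (e.symm i)) : ℂ) + ψ (x j) - ψ (x (e.symm i) - x j)) *
      (c (e.symm i) * c j))]
    refine Finset.sum_congr rfl fun j _ => ?_
    simp only [Function.comp_apply, Complex.conj_ofReal]
    ring
  rw [h2] at h1
  have h3 : 0 ≤ ∑ i, ∑ j, (ψ (x i) + ψ (x j) - ψ (x i - x j)) * (c i * c j) := by
    exact_mod_cast h1
  have h4 : ∑ i, ∑ j, (ψ (x i) + ψ (x j) - ψ (x i - x j)) * (c i * c j) =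
      (∑ i, ψ (x i) * c i) * (∑ j, c j) + (∑ i, c i) * (∑ j, ψ (x j) * c j)
      - ∑ i, ∑ j, ψ (x i - x j) * (c i * c j) := by
    rw [Finset.sum_mul_sum, Finset.sum_mul_sum, ← Finset.sum_add_distrib, ← Finset.sum_sub_distrib]
    refine Finset.sum_congr rfl fun i _ => ?_
    rw [← Finset.sum_add_distrib, ← Finset.sum_sub_distrib]
    refine Finset.sum_congr rfl fun j _ => ?_
    ring
  rw [h4, hc] at h3
  linarith

/-- Finite sampling of a ball stands in for integration over it. The sample is grown from the single
point 0 by adding all digit vectors of the next level, so the distribution of the differences x a -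
x b over the spheres matches the weights in `radMean`. -/
lemma exists_family_radMean {ψ : (Fin n → ℚ_[p]) → ℝ} (hr : IsRadial ψ) (s : ℤ) (k : ℕ) :
    ∃ (ι : Type) (_ : Fintype ι) (_ : Nonempty ι) (x : ι → (Fin n → ℚ_[p])),
      (∀ a, x a ∈ pball p n (s + k)) ∧
      ∑ a, ∑ b, ψ (x a - x b) =
        (Fintype.card ι : ℝ) ^ 2 * radMean ((p : ℝ) ^ n) (radValues ψ s) k := by
  classical
  have hq : ((p : ℝ) ^ n) ≠ 0 := (pow_pos prime_pos n).ne'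
  induction k with
  | zero =>
    refine ⟨Unit, inferInstance, inferInstance, fun _ => 0, fun _ => zero_mem _, ?_⟩
    simp [radMean, radValues]
  | succ k ih =>
    obtain ⟨ι, _, _, x, hx, hS⟩ := ih
    have : Nonempty (Fin p) := ⟨⟨0, hp.out.pos⟩⟩
    refine ⟨ι × (Fin n → Fin p), inferInstance, inferInstance,
      fun a => x a.1 + digitVec (s + (k + 1 : ℕ)) a.2, fun a => ?_, ?_⟩
    · exact add_mem (pball_mono (by push_cast; omega) (hx a.1)) (digitVec_mem _ _)
    -- Equal top digits cancel and leave a difference of the previous level. Distinct top digits put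
    -- the difference on the new sphere, where ψ is constant. A fraction 1/q of the pairs of digit
    -- vectors is diagonal, which gives the recursion of `radMean`.
    · have key : ∀ (a b : ι) (d e : Fin n → Fin p),
          ψ (x a + digitVec (s + (k + 1 : ℕ)) d - (x b + digitVec (s + (k + 1 : ℕ)) e)) =
          radValues ψ s (k + 1) +
            if d = e then ψ (x a - x b) - radValues ψ s (k + 1) else 0 := by
        intro a b d e
        split_ifs with hde
        · subst hde
          rw [add_sub_add_right_eq_sub]; ring
        · rw [add_zero]
          refine hr _ _ (norm_eq_norm_radVec ?_ ?_)
          · exact sub_mem (add_mem (pball_mono (by push_cast; omega) (hx a)) (digitVec_mem _ _))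
              (add_mem (pball_mono (by push_cast; omega) (hx b)) (digitVec_mem _ _))
          · intro hc
            apply digitVec_sub_notMem (j := s + (k + 1 : ℕ)) hde
            have h1 : x a - x b ∈ pball p n (s + (k + 1 : ℕ) - 1) :=
              pball_mono (by push_cast; omega) (sub_mem (hx a) (hx b))
            have h2 := sub_mem hc h1
            convert! h2 using 1
            abel
      have hcard : (Fintype.card (Fin n → Fin p) : ℝ) = (p : ℝ) ^ n := by simp
      simp only [Fintype.sum_prod_type, key]
      have inner : ∀ (a b : ι) (d : Fin n → Fin p), ∑ e : Fin n → Fin p,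
          (radValues ψ s (k + 1) + if d = e then ψ (x a - x b) - radValues ψ s (k + 1) else 0) =
          (p : ℝ) ^ n * radValues ψ s (k + 1) + (ψ (x a - x b) - radValues ψ s (k + 1)) := by
        intro a b d
        rw [Finset.sum_add_distrib, Finset.sum_ite_eq, Finset.sum_const, nsmul_eq_mul,
          Finset.card_univ, hcard]
        simp
      simp only [inner]
      rw [Finset.sum_congr rfl fun a _ => Finset.sum_comm]
      simp only [Finset.sum_const, Finset.card_univ, nsmul_eq_mul, hcard]
      simp only [mul_add, mul_sub, Finset.sum_add_distrib, Finset.sum_sub_distrib,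
        ← Finset.mul_sum, hS, Finset.sum_const, Finset.card_univ, nsmul_eq_mul,
        Fintype.card_prod, radMean]
      push_cast
      rw [← Nat.cast_pow]
      simp only [Fintype.card_fun, Fintype.card_fin]
      push_cast
      field_simp
      ring

/-- The mean of a radial negative definite function over a ball is at most its value on the next
sphere. -/
lemma radMean_le_radValues {ψ : (Fin n → ℚ_[p]) → ℝ} (hr : IsRadial ψ)
    (h : IsNegativeDefinite fun ξ => (ψ ξ : ℂ)) (s : ℤ) (k : ℕ) :
    radMean ((p : ℝ) ^ n) (radValues ψ s) k ≤ radValues ψ s (k + 1) := by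
  obtain ⟨ι, _, _, x, hx, hS⟩ := exists_family_radMean hr s k
  set η := radVec p n (s + (k + 1 : ℕ)) with hη
  -- Weights +1 on the sample and -1 on its translate by η: the two diagonal blocks each contribute
  -- |ι|² times the mean, the two mixed blocks each contribute -|ι|² times the value on the next
  -- sphere.
  have h1 := h.sum_nonpos (ι := ι ⊕ ι) (Sum.elim x fun a => x a + η)
    (Sum.elim (fun _ => 1) fun _ => -1) (by simp)
  have hmem : ∀ a b, x a - x b ∈ pball p n (s + (k + 1 : ℕ) - 1) := fun a b =>
    pball_mono (by push_cast; omega) (sub_mem (hx a) (hx b))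
  have e1 : ∀ a b, ψ (x a - (x b + η)) = radValues ψ s (k + 1) := fun a b => by
    rw [← sub_sub]; exact hr _ _ (norm_sub_radVec (hmem a b))
  have e2 : ∀ a b, ψ (x a + η - x b) = radValues ψ s (k + 1) := fun a b => by
    rw [add_sub_right_comm]; exact hr _ _ (norm_add_radVec (hmem a b))
  simp only [Fintype.sum_sum_type, Sum.elim_inl, Sum.elim_inr, e1, e2, add_sub_add_right_eq_sub,
    mul_one, mul_neg, Finset.sum_add_distrib, hS, Finset.sum_neg_distrib,
    Finset.sum_const, Finset.card_univ, nsmul_eq_mul] at h1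
  have hc : (0 : ℝ) < (Fintype.card ι : ℝ) ^ 2 := by
    have : 0 < Fintype.card ι := Fintype.card_pos
    positivity
  refine le_of_mul_le_mul_left ?_ hc
  nlinarith [h1]

/-! ### Convexity and the resolvent values on spheres. -/

lemma inv_convex_comb_le {α u v : ℝ} (h0 : 0 ≤ α) (h1 : α ≤ 1) (hu : 0 < u) (hv : 0 < v) :
    1 / (α * u + (1 - α) * v) ≤ α / u + (1 - α) / v := by
  have hpos : 0 < α * u + (1 - α) * v := by
    rcases h0.eq_or_lt with rfl | h0
    · simpa using hv
    · have : 0 ≤ (1 - α) * v := mul_nonneg (by linarith) hv.le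
      positivity
  rw [div_add_div _ _ hu.ne' hv.ne', div_le_div_iff₀ hpos (mul_pos hu hv)]
  nlinarith [mul_nonneg (mul_nonneg h0 (by linarith : 0 ≤ 1 - α)) (sq_nonneg (u - v))]

lemma radMean_nonneg {q : ℝ} (hq : 1 ≤ q) {c : ℕ → ℝ} (hc : ∀ k, 0 ≤ c k) (k : ℕ) :
    0 ≤ radMean q c k := by
  induction k with
  | zero => exact hc 0
  | succ k ih =>
    have h1 : 0 ≤ 1 - 1 / q := by rw [sub_nonneg]; exact div_le_one_of_le₀ hq (by linarith)
    exact add_nonneg (div_nonneg ih (by linarith)) (mul_nonneg h1 (hc _))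

/-- Jensen's inequality for the convex function t ↦ 1/(1+at). Since `radMean` is an iterated
two-point convex combination, the two-point inequality at each level suffices. -/
lemma resolvent_radMean_le {q : ℝ} (hq : 1 ≤ q) {c : ℕ → ℝ} (hc : ∀ k, 0 ≤ c k) {a : ℝ}
    (ha : 0 ≤ a) (k : ℕ) :
    1 / (1 + a * radMean q c k) ≤ radMean q (fun k => 1 / (1 + a * c k)) k := by
  have hq0 : 0 < q := by linarith
  induction k with
  | zero => exact le_rfl
  | succ k ih =>
    have h1 : 1 / q ≤ 1 := div_le_one_of_le₀ hq hq0.le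
    have hu : 0 < 1 + a * radMean q c k := by have := radMean_nonneg hq hc k; positivity
    have hv : 0 < 1 + a * c (k + 1) := by have := hc (k + 1); positivity
    have h2 := inv_convex_comb_le (α := 1 / q) (by positivity) h1 hu hv
    have e : 1 + a * radMean q c (k + 1) =
        1 / q * (1 + a * radMean q c k) + (1 - 1 / q) * (1 + a * c (k + 1)) := by
      simp only [radMean]; ring
    rw [e]
    refine h2.trans ?_
    simp only [radMean]
    have h3 : 1 / q / (1 + a * radMean q c k) ≤
        radMean q (fun k => 1 / (1 + a * c k)) k / q := by
      rw [div_right_comm]; gcongr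
    have h4 : (1 - 1 / q) / (1 + a * c (k + 1)) = (1 - 1 / q) * (1 / (1 + a * c (k + 1))) := by
      ring
    linarith

/-- For ψ the value on the next sphere dominates the mean; the decreasing function t ↦ 1/(1+at)
reverses this, and Jensen's inequality replaces the function of the mean by the mean of the
function. Analytically this says that the convolution kernel of the resolvent is nonnegative. -/
lemma resolvent_radValues_le {ψ : (Fin n → ℚ_[p]) → ℝ} (hr : IsRadial ψ)
    (h : IsNegativeDefinite fun ξ => (ψ ξ : ℂ)) (h0 : ∀ ξ, 0 ≤ ψ ξ) {a : ℝ} (ha : 0 ≤ a)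
    (s : ℤ) (k : ℕ) :
    radValues (fun ξ => 1 / (1 + a * ψ ξ)) s (k + 1) ≤
      radMean ((p : ℝ) ^ n) (radValues (fun ξ => 1 / (1 + a * ψ ξ)) s) k := by
  have hq : 1 ≤ ((p : ℝ) ^ n) := one_le_pow₀ one_lt_prime.le
  have hc : ∀ k, 0 ≤ radValues ψ s k := by
    rintro (_ | k)
    · exact h0 _
    · exact h0 _
  have e : radValues (fun ξ => 1 / (1 + a * ψ ξ)) s = fun k => 1 / (1 + a * radValues ψ s k) := by
    ext k; cases k <;> rfl
  rw [e]
  refine le_trans ?_ (resolvent_radMean_le hq hc ha k)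
  have h1 := radMean_le_radValues hr h s k
  have h2 := radMean_nonneg hq hc k
  beta_reduce
  gcongr

/-! ### Positivity of the resolvent -/

/-- The difference E_j - E_{j+1}/q is q^j times integration over the shell between two consecutive
balls, whose measure is q^(-j)(1 - 1/q). -/
lemma norm_ballMean_sub_le {f : (Fin n → ℚ_[p]) → ℂ} (hf : Continuous f) {S : ℝ}
    (hS : ∀ x, ‖f x‖ ≤ S) (j : ℤ) (x : Fin n → ℚ_[p]) :
    ‖ballMean j f x - ballMean (j + 1) f x / (((p : ℝ) ^ n : ℝ) : ℂ)‖ ≤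
      (1 - 1 / (p : ℝ) ^ n) * S := by
  have hq : (0 : ℝ) < (p : ℝ) ^ n := pow_pos prime_pos n
  have hqc : (((p : ℝ) ^ n : ℝ) : ℂ) ≠ 0 := by exact_mod_cast hq.ne'
  have hi : ∀ j, IntegrableOn (fun t => f (x + t)) (pball p n j : Set (Fin n → ℚ_[p]))
      (haar p n) := fun j =>
    (hf.comp (continuous_const.add continuous_id)).continuousOn.integrableOn_compact
      (isCompact_pball j)
  have hsub : (pball p n (-(j + 1)) : Set (Fin n → ℚ_[p])) ⊆ pball p n (-j) :=
    pball_mono (by omega)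
  have e : ballMean j f x - ballMean (j + 1) f x / (((p : ℝ) ^ n : ℝ) : ℂ) =
      (((p : ℝ) ^ n) ^ j : ℝ) * ∫ t in ((pball p n (-j) : Set (Fin n → ℚ_[p])) \
        (pball p n (-(j + 1)) : Set (Fin n → ℚ_[p]))), f (x + t) ∂(haar p n) := by
    rw [setIntegral_sdiff (measurableSet_pball _) (hi _) hsub, ballMean, ballMean,
      zpow_add_one₀ hq.ne', Complex.ofReal_mul]
    field_simp
  have hm : (haar p n).real ((pball p n (-j) : Set (Fin n → ℚ_[p])) \
      (pball p n (-(j + 1)) : Set (Fin n → ℚ_[p]))) =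
      ((p : ℝ) ^ n) ^ (-j) - ((p : ℝ) ^ n) ^ (-(j + 1)) := by
    rw [measureReal_sdiff hsub (measurableSet_pball _) (h₁ := haar_pball_ne_top _), haar_real_pball,
      haar_real_pball]
  have hb := norm_setIntegral_le_of_norm_le_const (μ := haar p n)
    (s := (pball p n (-j) : Set (Fin n → ℚ_[p])) \
        (pball p n (-(j + 1)) : Set (Fin n → ℚ_[p]))) (f := fun t => f (x + t)) (C := S)
    ((measure_mono Set.sdiff_subset).trans_lt (isCompact_pball _).measure_lt_top)
    (fun t _ => hS _)
  rw [hm] at hb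
  rw [e, norm_mul, Complex.norm_real, Real.norm_of_nonneg (zpow_pos hq _).le]
  calc _ ≤ ((p : ℝ) ^ n) ^ j * (S * (((p : ℝ) ^ n) ^ (-j) - ((p : ℝ) ^ n) ^ (-(j + 1)))) := by
        gcongr
    _ = _ := by
        rw [neg_add, zpow_add₀ hq.ne', zpow_neg, zpow_neg_one]
        field_simp

lemma norm_ballMean_le {f : (Fin n → ℚ_[p]) → ℂ} {S : ℝ}
    (hS : ∀ x, ‖f x‖ ≤ S) (j : ℤ) (x : Fin n → ℚ_[p]) : ‖ballMean j f x‖ ≤ S := by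
  have hq : (0 : ℝ) < (p : ℝ) ^ n := pow_pos prime_pos n
  have hb := norm_setIntegral_le_of_norm_le_const (μ := haar p n)
    (s := (pball p n (-j) : Set (Fin n → ℚ_[p]))) (f := fun t => f (x + t)) (C := S)
    (isCompact_pball _).measure_lt_top (fun t _ => hS _)
  rw [haar_real_pball] at hb
  rw [ballMean, norm_mul, Complex.norm_real, Real.norm_of_nonneg (zpow_pos hq _).le]
  calc _ ≤ ((p : ℝ) ^ n) ^ j * (S * (((p : ℝ) ^ n) ^ (-j))) := by gcongr
    _ = _ := by rw [zpow_neg]; field_simp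

/-- The function `h` cut off to the ball `pball p n (s + K)` and replaced by `h 0` on
`pball p n s`. -/
def cutOff (h : (Fin n → ℚ_[p]) → ℝ) (s : ℤ) (K : ℕ) (ξ : Fin n → ℚ_[p]) : ℝ :=
  open Classical in
  if ξ ∈ pball p n s then h 0 else if ξ ∈ pball p n (s + K) then h ξ else 0

lemma cutOff_zero (h : (Fin n → ℚ_[p]) → ℝ) (s : ℤ) (ξ : Fin n → ℚ_[p]) :
    cutOff h s 0 ξ = h 0 * (pball p n s : Set (Fin n → ℚ_[p])).indicator (fun _ => 1) ξ := by
  classical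
  rw [cutOff]
  by_cases hξ : ξ ∈ pball p n s
  · rw [if_pos hξ, Set.indicator_of_mem (by exact hξ), mul_one]
  · rw [if_neg hξ, if_neg (by simpa using hξ), Set.indicator_of_notMem (by exact hξ), mul_zero]

lemma cutOff_succ {h : (Fin n → ℚ_[p]) → ℝ} (hr : IsRadial h) (s : ℤ) (K : ℕ)
    (ξ : Fin n → ℚ_[p]) :
    cutOff h s (K + 1) ξ = cutOff h s K ξ + radValues h s (K + 1) *
      ((pball p n (s + K + 1) : Set (Fin n → ℚ_[p])).indicator (fun _ => 1) ξ -
        (pball p n (s + K) : Set (Fin n → ℚ_[p])).indicator (fun _ => 1) ξ) := by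
  classical
  have e : s + ((K + 1 : ℕ) : ℤ) = s + K + 1 := by push_cast; ring
  rw [cutOff, cutOff, radValues, e]
  by_cases h1 : ξ ∈ pball p n (s + K)
  · have h2 : ξ ∈ pball p n (s + K + 1) := pball_mono (by omega) h1
    rw [Set.indicator_of_mem (SetLike.mem_coe.2 h1), Set.indicator_of_mem (SetLike.mem_coe.2 h2), if_pos h1,
      if_pos h2]
    ring
  · have h3 : ξ ∉ pball p n s := fun hc => h1 (pball_mono (by omega) hc)
    rw [Set.indicator_of_notMem (mt SetLike.mem_coe.1 h1), if_neg h1, if_neg h3, if_neg h3]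
    by_cases h2 : ξ ∈ pball p n (s + K + 1)
    · rw [Set.indicator_of_mem (SetLike.mem_coe.2 h2), if_pos h2,
        hr ξ _ (norm_eq_norm_radVec h2 (by simpa using h1))]
      ring
    · rw [Set.indicator_of_notMem (mt SetLike.mem_coe.1 h2), if_neg h2]
      ring

/-- With s = -N and s + K = N, each nonzero point eventually lies where the cut-off equals h, and at
0 the value is h 0 by construction. No continuity of h is involved. -/
lemma tendsto_cutOff (h : (Fin n → ℚ_[p]) → ℝ) (ξ : Fin n → ℚ_[p]) :
    Tendsto (fun N : ℕ => cutOff h (-N) (2 * N) ξ) atTop (𝓝 (h ξ)) := by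
  classical
  refine tendsto_const_nhds.congr' ?_
  by_cases hξ : ξ = 0
  · subst hξ
    exact Eventually.of_forall fun N => (if_pos (zero_mem _)).symm
  · obtain ⟨k, hk⟩ := exists_mem_pball ξ
    obtain ⟨l, hl⟩ := exists_notMem_pball hξ
    filter_upwards [eventually_ge_atTop k, eventually_ge_atTop l] with N hN hN'
    rw [cutOff, if_neg, if_pos]
    · exact pball_mono (by push_cast; omega) hk
    · exact fun hc => hl (pball_mono (by omega) hc)

lemma norm_cutOff_le {h : (Fin n → ℚ_[p]) → ℝ} {B : ℝ} (hB : ∀ ξ, ‖h ξ‖ ≤ B) (s : ℤ) (K : ℕ)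
    (ξ : Fin n → ℚ_[p]) : ‖cutOff h s K ξ‖ ≤ B := by
  rw [cutOff]
  split_ifs
  · exact hB _
  · exact hB _
  · rw [norm_zero]; exact (norm_nonneg _).trans (hB 0)

lemma measurable_cutOff {h : (Fin n → ℚ_[p]) → ℝ} (hm : Measurable h) (s : ℤ) (K : ℕ) :
    Measurable (cutOff h s K) := by
  classical
  exact Measurable.ite (measurableSet_pball _) measurable_const
    (Measurable.ite (measurableSet_pball _) hm measurable_const)

lemma integrable_indicator_pball {G : (Fin n → ℚ_[p]) → ℂ} (hG : Integrable G (haar p n))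
    (j : ℤ) : Integrable ((pball p n j : Set (Fin n → ℚ_[p])).indicator G) (haar p n) :=
  hG.indicator (measurableSet_pball j)

lemma integrable_mul_of_bounded {G : (Fin n → ℚ_[p]) → ℂ} (hG : Integrable G (haar p n))
    {h : (Fin n → ℚ_[p]) → ℝ} (hm : Measurable h) {B : ℝ} (hB : ∀ ξ, ‖h ξ‖ ≤ B) :
    Integrable (fun ξ => (h ξ : ℂ) * G ξ) (haar p n) :=
  hG.bdd_mul (c := B) (Complex.measurable_ofReal.comp hm).aestronglyMeasurable
    (Eventually.of_forall fun ξ => by rw [Complex.norm_real]; exact hB ξ)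

/-- Abel summation. Let T_K be the operator with multiplier `cutOff h s K`, a_K the mean of that
multiplier over the ball of level s + K, and c the value of h on the next sphere. Then T_K - a_K
E_{s+K} grows at each step by (a_K - c)(E_{s+K} - E_{s+K+1}/q). By `hle` the coefficient is
nonnegative, so the bounds add up without loss. -/
lemma norm_fourierInv_cutOff_sub_le {h : (Fin n → ℚ_[p]) → ℝ} (hr : IsRadial h)
    (hm : Measurable h) {B : ℝ} (hB : ∀ ξ, ‖h ξ‖ ≤ B) {s : ℤ}
    (hle : ∀ k, radValues h s (k + 1) ≤ radMean ((p : ℝ) ^ n) (radValues h s) k)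
    {G : (Fin n → ℚ_[p]) → ℂ} (hG : Integrable G (haar p n)) {S : ℝ}
    (hS : ∀ x, ‖fourierInv G x‖ ≤ S) (K : ℕ) (x : Fin n → ℚ_[p]) :
    ‖fourierInv (fun ξ => (cutOff h s K ξ : ℂ) * G ξ) x -
      radMean ((p : ℝ) ^ n) (radValues h s) K * ballMean (s + K) (fourierInv G) x‖ ≤
      (h 0 - radMean ((p : ℝ) ^ n) (radValues h s) K) * S := by
  have hq : (0 : ℝ) < (p : ℝ) ^ n := pow_pos prime_pos n
  induction K with
  | zero =>
    have e : (fun ξ => (cutOff h s 0 ξ : ℂ) * G ξ) =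
        fun ξ => (h 0 : ℂ) * (pball p n s : Set (Fin n → ℚ_[p])).indicator G ξ := by
      ext ξ
      rw [cutOff_zero]
      by_cases hξ : ξ ∈ pball p n s
      · rw [Set.indicator_of_mem (by exact hξ), Set.indicator_of_mem (by exact hξ)]; simp
      · rw [Set.indicator_of_notMem (by exact hξ), Set.indicator_of_notMem (by exact hξ)]; simp
    rw [e]
    have e2 : fourierInv (fun ξ => (h 0 : ℂ) *
        (pball p n s : Set (Fin n → ℚ_[p])).indicator G ξ) x =
        (h 0 : ℂ) * ballMean s (fourierInv G) x := by
      rw [← fourierInv_indicator hG, fourierInv, fourierInv, fourierL1_const_mul]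
    rw [e2]
    simp [radMean, radValues]
  | succ K ih =>
    set c : ℝ := radValues h s (K + 1) with hc
    set a : ℝ := radMean ((p : ℝ) ^ n) (radValues h s) K with ha
    have e : (fun ξ => (cutOff h s (K + 1) ξ : ℂ) * G ξ) =
        fun ξ => (cutOff h s K ξ : ℂ) * G ξ + (c : ℂ) *
          ((pball p n (s + K + 1) : Set (Fin n → ℚ_[p])).indicator G ξ -
            (pball p n (s + K) : Set (Fin n → ℚ_[p])).indicator G ξ) := by
      ext ξ
      rw [cutOff_succ hr]
      have : ∀ j, (pball p n j : Set (Fin n → ℚ_[p])).indicator G ξ =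
          (((pball p n j : Set (Fin n → ℚ_[p])).indicator (fun _ => (1 : ℝ)) ξ : ℝ) : ℂ) * G ξ := by
        intro j
        by_cases hξ : ξ ∈ pball p n j
        · rw [Set.indicator_of_mem (by exact hξ), Set.indicator_of_mem (by exact hξ)]; simp
        · rw [Set.indicator_of_notMem (by exact hξ), Set.indicator_of_notMem (by exact hξ)]; simp
      rw [this, this, hc]
      push_cast
      ring
    have e2 : fourierInv (fun ξ => (cutOff h s (K + 1) ξ : ℂ) * G ξ) x =
        fourierInv (fun ξ => (cutOff h s K ξ : ℂ) * G ξ) x +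
          c * (ballMean (s + K + 1) (fourierInv G) x - ballMean (s + K) (fourierInv G) x) := by
      have i1 := integrable_indicator_pball hG (s + K + 1)
      have i2 := integrable_indicator_pball hG (s + K)
      rw [e, ← fourierInv_indicator hG, ← fourierInv_indicator hG]
      simp only [fourierInv]
      rw [fourierL1_add (integrable_mul_of_bounded hG (measurable_cutOff hm s K)
        (norm_cutOff_le hB s K)) (by exact (i1.sub i2).const_mul _), fourierL1_const_mul,
        fourierL1_sub i1 i2]
    have e3 : s + ((K + 1 : ℕ) : ℤ) = s + K + 1 := by push_cast; ring
    have e4 : radMean ((p : ℝ) ^ n) (radValues h s) (K + 1) =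
        a / (p : ℝ) ^ n + (1 - 1 / (p : ℝ) ^ n) * c := rfl
    have hR := norm_ballMean_sub_le (continuous_fourierL1 hG |>.comp continuous_neg) hS (s + K) x
    have hac : 0 ≤ a - c := sub_nonneg.2 (hle K)
    rw [e2, e3, e4]
    have e5 : fourierInv (fun ξ => (cutOff h s K ξ : ℂ) * G ξ) x +
          c * (ballMean (s + K + 1) (fourierInv G) x - ballMean (s + K) (fourierInv G) x) -
        ((a / (p : ℝ) ^ n + (1 - 1 / (p : ℝ) ^ n) * c : ℝ) : ℂ) *
          ballMean (s + K + 1) (fourierInv G) x =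
        (fourierInv (fun ξ => (cutOff h s K ξ : ℂ) * G ξ) x -
          a * ballMean (s + K) (fourierInv G) x) +
        ((a - c : ℝ) : ℂ) * (ballMean (s + K) (fourierInv G) x -
          ballMean (s + K + 1) (fourierInv G) x / (((p : ℝ) ^ n : ℝ) : ℂ)) := by
      push_cast; ring
    rw [e5]
    refine (norm_add_le _ _).trans ?_
    rw [norm_mul, Complex.norm_real, Real.norm_of_nonneg hac]
    have h6 : (a - c) * ‖ballMean (s + K) (fourierInv G) x -
          ballMean (s + K + 1) (fourierInv G) x / (((p : ℝ) ^ n : ℝ) : ℂ)‖ ≤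
        (a - c) * ((1 - 1 / (p : ℝ) ^ n) * S) := mul_le_mul_of_nonneg_left hR hac
    -- The recursion for the mean gives (a - c)(1 - 1/q) = a - a_{K+1}, so the bound telescopes.
    refine (add_le_add ih h6).trans (le_of_eq ?_)
    ring

/-- The resolvent of a radial negative definite symbol is a contraction for the sup norm. -/
lemma norm_fourierInv_resolvent_le {σ : (Fin n → ℚ_[p]) → ℝ} (hr : IsRadial σ)
    (hm : Measurable σ) (hneg : IsNegativeDefinite fun ξ => (σ ξ : ℂ)) (h0 : ∀ ξ, 0 ≤ σ ξ)
    {a : ℝ} (ha : 0 ≤ a) {G : (Fin n → ℚ_[p]) → ℂ} (hG : Integrable G (haar p n)) {S : ℝ}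
    (hS : ∀ x, ‖fourierInv G x‖ ≤ S) (x : Fin n → ℚ_[p]) :
    ‖fourierInv (fun ξ => ((1 / (1 + a * σ ξ) : ℝ) : ℂ) * G ξ) x‖ ≤ S := by
  have hq : 1 ≤ ((p : ℝ) ^ n) := one_le_pow₀ one_lt_prime.le
  have hS0 : 0 ≤ S := (norm_nonneg _).trans (hS 0)
  set h : (Fin n → ℚ_[p]) → ℝ := fun ξ => 1 / (1 + a * σ ξ) with hh
  have hpos : ∀ ξ, 0 < 1 + a * σ ξ := fun ξ => by have := h0 ξ; positivity
  have hhpos : ∀ ξ, 0 ≤ h ξ := fun ξ => (div_pos one_pos (hpos ξ)).le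
  have hhle : ∀ ξ, h ξ ≤ 1 := fun ξ =>
    div_le_one_of_le₀ (by have := mul_nonneg ha (h0 ξ); linarith) (hpos ξ).le
  have hB : ∀ ξ, ‖h ξ‖ ≤ 1 := fun ξ => by rw [Real.norm_of_nonneg (hhpos ξ)]; exact hhle ξ
  have hhr : IsRadial h := fun ξ η e => by simp only [hh, hr ξ η e]
  have hhm : Measurable h := measurable_const.div (measurable_const.add (hm.const_mul a))
  have hbound : ∀ N : ℕ, ‖fourierInv (fun ξ => (cutOff h (-N) (2 * N) ξ : ℂ) * G ξ) x‖ ≤ S := by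
    intro N
    have h1 := norm_fourierInv_cutOff_sub_le hhr hhm hB
      (resolvent_radValues_le hr hneg h0 ha (-N)) hG hS (2 * N) x
    have h2 := norm_ballMean_le hS (-(N : ℤ) + (2 * N : ℕ)) x
    have hc : ∀ k, 0 ≤ radValues h (-N) k := by
      rintro (_ | k)
      · exact hhpos _
      · exact hhpos _
    set A := radMean ((p : ℝ) ^ n) (radValues h (-N)) (2 * N) with hA
    have h3 : 0 ≤ A := radMean_nonneg hq hc _
    -- Restoring the subtracted ball mean costs A * S, which turns the bound (h 0 - A) * S into h 0
    -- * S ≤ S, uniformly in N.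
    have h4 : ‖(A : ℂ) * ballMean (-(N : ℤ) + (2 * N : ℕ)) (fourierInv G) x‖ ≤ A * S := by
      rw [norm_mul, Complex.norm_real, Real.norm_of_nonneg h3]; gcongr
    have h5 : h 0 * S ≤ S := mul_le_of_le_one_left hS0 (hhle 0)
    have h6 := norm_le_norm_sub_add (fourierInv (fun ξ => (cutOff h (-N) (2 * N) ξ : ℂ) * G ξ) x)
      ((A : ℂ) * ballMean (-(N : ℤ) + (2 * N : ℕ)) (fourierInv G) x)
    linarith
  suffices h : Tendsto (fun N : ℕ => fourierInv (fun ξ => (cutOff h (-N) (2 * N) ξ : ℂ) * G ξ) x)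
      atTop (𝓝 (fourierInv (fun ξ => (h ξ : ℂ) * G ξ) x)) from
    le_of_tendsto h.norm (Eventually.of_forall hbound)
  simp only [fourierInv, fourierL1]
  refine tendsto_integral_of_dominated_convergence (fun ξ => ‖G ξ‖) (fun N => ?_) hG.norm
    (fun N => ?_) ?_
  · exact (integrable_chi_mul (integrable_mul_of_bounded hG (measurable_cutOff hhm _ _)
      (norm_cutOff_le hB _ _)) _).aestronglyMeasurable
  · refine Eventually.of_forall fun ξ => ?_
    rw [norm_mul, norm_chi, one_mul, norm_mul, Complex.norm_real]
    exact mul_le_of_le_one_left (norm_nonneg _) (norm_cutOff_le hB _ _ _)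
  · refine Eventually.of_forall fun ξ => ?_
    exact (((Complex.continuous_ofReal.tendsto _).comp (tendsto_cutOff h ξ)).mul_const _).const_mul _

/-! ### The Fourier transform on `L²` -/

lemma eLpNorm_two_sq {α E : Type*} [MeasurableSpace α] [NormedAddCommGroup E] {μ : Measure α}
    (f : α → E) : eLpNorm f 2 μ ^ 2 = ∫⁻ x, ‖f x‖ₑ ^ 2 ∂μ := by
  have := eLpNorm_nnreal_pow_eq_lintegral (μ := μ) (f := f) (p := 2) two_ne_zero
  simpa using this

lemma eLpNorm_two_le {α E F : Type*} [MeasurableSpace α] [NormedAddCommGroup E]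
    [NormedAddCommGroup F] {μ : Measure α} {f : α → E} {g : α → F}
    (h : ∫⁻ x, ‖f x‖ₑ ^ 2 ∂μ ≤ ∫⁻ x, ‖g x‖ₑ ^ 2 ∂μ) : eLpNorm f 2 μ ≤ eLpNorm g 2 μ := by
  rw [← eLpNorm_two_sq, ← eLpNorm_two_sq] at h
  exact (ENNReal.pow_le_pow_left_iff two_ne_zero).1 h

lemma ballMean_enorm_le (j : ℤ) (f : (Fin n → ℚ_[p]) → ℂ) (x : Fin n → ℚ_[p]) :
    ‖ballMean j f x‖ₑ ≤ ENNReal.ofReal (((p : ℝ) ^ n) ^ j) *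
      ∫⁻ t in (pball p n (-j) : Set (Fin n → ℚ_[p])), ‖f (x + t)‖ₑ ∂(haar p n) := by
  have hq : (0 : ℝ) < (p : ℝ) ^ n := pow_pos prime_pos n
  rw [ballMean, enorm_mul]
  gcongr
  · rw [← ofReal_norm, Complex.norm_real, Real.norm_of_nonneg (zpow_pos hq _).le]
  · exact enorm_integral_le_lintegral_enorm _

lemma lintegral_mul_translate_le {g : (Fin n → ℚ_[p]) → ℝ≥0∞} (hg : Measurable g)
    (t : Fin n → ℚ_[p]) :
    ∫⁻ x, g x * g (x + t) ∂(haar p n) ≤ ∫⁻ x, g x ^ 2 ∂(haar p n) := by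
  have h1 : ∀ a b : ℝ≥0∞, a * b ≤ 2⁻¹ * (a ^ 2 + b ^ 2) := by
    intro a b
    by_cases ha : a = ∞
    · subst ha
      simp
    by_cases hb : b = ∞
    · subst hb
      simp
    lift a to NNReal using ha
    lift b to NNReal using hb
    have h2 : a * b ≤ 2⁻¹ * (a ^ 2 + b ^ 2) := by
      rw [← NNReal.coe_le_coe]
      push_cast
      nlinarith [sq_nonneg ((a : ℝ) - b)]
    have h3 : ((2⁻¹ : NNReal) : ℝ≥0∞) = 2⁻¹ := by simp
    rw [← h3]
    exact_mod_cast h2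
  calc _ ≤ ∫⁻ x, 2⁻¹ * (g x ^ 2 + g (x + t) ^ 2) ∂(haar p n) := lintegral_mono fun x => h1 _ _
    _ = 2⁻¹ * (∫⁻ x, g x ^ 2 ∂(haar p n) + ∫⁻ x, g (x + t) ^ 2 ∂(haar p n)) := by
        rw [lintegral_const_mul', lintegral_add_left (hg.pow_const 2)]
        simp
    _ = _ := by
        rw [lintegral_add_right_eq_self (fun x => g x ^ 2) t, ← two_mul, ← mul_assoc,
          ENNReal.inv_mul_cancel two_ne_zero ENNReal.ofNat_ne_top, one_mul]

/-- The multiplication formula, applied to the conjugate of the truncated transform, gives ∫_B |Ĝ|²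
= ∫ G · conj(E_M G). As E_M averages translates of G, `lintegral_mul_translate_le` bounds this by ∫
|G|². Only this half of Plancherel is used in the sequel. -/
lemma setLIntegral_fourierL1_sq_le {G : (Fin n → ℚ_[p]) → ℂ} (hG : Integrable G (haar p n))
    (hm : Measurable G) (M : ℤ) :
    ∫⁻ ξ in (pball p n M : Set (Fin n → ℚ_[p])), ‖fourierL1 G ξ‖ₑ ^ 2 ∂(haar p n) ≤
      ∫⁻ x, ‖G x‖ₑ ^ 2 ∂(haar p n) := by
  have hq : (0 : ℝ) < (p : ℝ) ^ n := pow_pos prime_pos n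
  set B : Set (Fin n → ℚ_[p]) := (pball p n M : Set (Fin n → ℚ_[p])) with hB
  set H : (Fin n → ℚ_[p]) → ℂ := fun ξ => (starRingEnd ℂ) (B.indicator (fourierL1 G) ξ) with hH
  have hcont := continuous_fourierL1 hG
  have hi : Integrable (B.indicator (fourierL1 G)) (haar p n) :=
    (hcont.continuousOn.integrableOn_compact (isCompact_pball M)).integrable_indicator
      (measurableSet_pball M)
  have hHi : Integrable H (haar p n) := (LinearIsometryEquiv.integrable_comp_iff Complex.conjLIE).2 hi
  have hFH : ∀ x, fourierL1 H x = (starRingEnd ℂ) (ballMean M G x) := by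
    intro x
    rw [← fourierInv_indicator_fourierL1 hG, fourierInv, fourierL1, fourierL1, ← integral_conj]
    congr 1; ext ξ
    rw [map_mul, ← chi_neg, neg_dotProduct, neg_neg]
  have h1 : ((∫ ξ in B, ‖fourierL1 G ξ‖ ^ 2 ∂(haar p n) : ℝ) : ℂ) =
      ∫ x, G x * (starRingEnd ℂ) (ballMean M G x) ∂(haar p n) := by
    simp only [← hFH]
    rw [← integral_fourierL1_mul hG hHi, ← integral_complex_ofReal,
      ← integral_indicator (measurableSet_pball M)]
    congr 1; ext ξ
    by_cases hξ : ξ ∈ B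
    · simp only [hH]
      rw [Set.indicator_of_mem hξ, Set.indicator_of_mem hξ, Complex.mul_conj,
        Complex.normSq_eq_norm_sq]
    · simp only [hH]
      rw [Set.indicator_of_notMem hξ, Set.indicator_of_notMem hξ]; simp
  have h2 : ∫⁻ ξ in B, ‖fourierL1 G ξ‖ₑ ^ 2 ∂(haar p n) =
      ‖((∫ ξ in B, ‖fourierL1 G ξ‖ ^ 2 ∂(haar p n) : ℝ) : ℂ)‖ₑ := by
    have hnn : 0 ≤ ∫ ξ in B, ‖fourierL1 G ξ‖ ^ 2 ∂(haar p n) :=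
      integral_nonneg fun _ => by positivity
    rw [← ofReal_norm, Complex.norm_real, Real.norm_of_nonneg hnn,
      ofReal_integral_eq_lintegral_ofReal
        (f := fun ξ => ‖fourierL1 G ξ‖ ^ 2)
        ((hcont.norm.pow 2).continuousOn.integrableOn_compact (isCompact_pball M))
        (Eventually.of_forall fun _ => sq_nonneg _)]
    congr 1; ext ξ
    rw [ENNReal.ofReal_pow (norm_nonneg _), ofReal_norm]
  rw [h2, h1]
  have hmeas : Measurable fun x => ‖G x‖ₑ := hm.enorm
  calc ‖∫ x, G x * (starRingEnd ℂ) (ballMean M G x) ∂(haar p n)‖ₑ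
      ≤ ∫⁻ x, ‖G x * (starRingEnd ℂ) (ballMean M G x)‖ₑ ∂(haar p n) :=
        enorm_integral_le_lintegral_enorm _
    _ ≤ ∫⁻ x, ENNReal.ofReal (((p : ℝ) ^ n) ^ M) *
          ∫⁻ t in (pball p n (-M) : Set (Fin n → ℚ_[p])), ‖G x‖ₑ * ‖G (x + t)‖ₑ ∂(haar p n)
          ∂(haar p n) := by
        refine lintegral_mono fun x => ?_
        rw [lintegral_const_mul' _ _ enorm_ne_top, enorm_mul, RCLike.enorm_conj, mul_left_comm]
        gcongr
        exact ballMean_enorm_le M G x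
    _ = ENNReal.ofReal (((p : ℝ) ^ n) ^ M) *
          ∫⁻ t in (pball p n (-M) : Set (Fin n → ℚ_[p])), ∫⁻ x, ‖G x‖ₑ * ‖G (x + t)‖ₑ ∂(haar p n)
          ∂(haar p n) := by
        rw [lintegral_const_mul' _ _ ENNReal.ofReal_ne_top, lintegral_lintegral_swap]
        exact ((hmeas.comp measurable_fst).mul
          (hmeas.comp (measurable_fst.add measurable_snd))).aemeasurable
    _ ≤ ENNReal.ofReal (((p : ℝ) ^ n) ^ M) *
          ∫⁻ t in (pball p n (-M) : Set (Fin n → ℚ_[p])), ∫⁻ x, ‖G x‖ₑ ^ 2 ∂(haar p n)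
          ∂(haar p n) := by
        refine mul_le_mul_right (lintegral_mono fun t => ?_) _
        exact lintegral_mul_translate_le hmeas t
    _ = _ := by
        rw [setLIntegral_const, haar_pball, mul_comm (∫⁻ x, ‖G x‖ₑ ^ 2 ∂(haar p n)), ← mul_assoc,
          ← ENNReal.ofReal_mul (zpow_pos hq _).le, ← zpow_add₀ hq.ne']
        simp

lemma iUnion_pball : ⋃ k : ℕ, (pball p n k : Set (Fin n → ℚ_[p])) = Set.univ :=
  Set.eq_univ_of_forall fun x => Set.mem_iUnion.2 (exists_mem_pball x)

lemma eLpNorm_fourierL1_le {G : (Fin n → ℚ_[p]) → ℂ} (hG : Integrable G (haar p n)) :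
    eLpNorm (fourierL1 G) 2 (haar p n) ≤ eLpNorm G 2 (haar p n) := by
  have hae := hG.1.ae_eq_mk
  set G' := hG.1.mk G with hG'
  have hm : Measurable G' := hG.1.stronglyMeasurable_mk.measurable
  rw [fourierL1_congr_ae hae, eLpNorm_congr_ae hae]
  refine eLpNorm_two_le ?_
  rw [← setLIntegral_univ, ← iUnion_pball, setLIntegral_iUnion_of_directed]
  · exact iSup_le fun k => setLIntegral_fourierL1_sq_le (hG.congr hae) hm k
  · exact Monotone.directed_le fun i j hij => pball_mono (by exact_mod_cast hij)

lemma eLpNorm_fourierInv_le {G : (Fin n → ℚ_[p]) → ℂ} (hG : Integrable G (haar p n)) :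
    eLpNorm (fourierInv G) 2 (haar p n) ≤ eLpNorm G 2 (haar p n) := by
  refine le_trans (le_of_eq ?_) (eLpNorm_fourierL1_le hG)
  exact eLpNorm_comp_measurePreserving (continuous_fourierL1 hG).aestronglyMeasurable
    (Measure.measurePreserving_neg (haar p n))

lemma continuous_fourierInv {f : (Fin n → ℚ_[p]) → ℂ} (hf : Integrable f (haar p n)) :
    Continuous (fourierInv f) := (continuous_fourierL1 hf).comp continuous_neg

lemma closedBall_eq_pball (k : ℕ) : Metric.closedBall (0 : Fin n → ℚ_[p]) ((p : ℝ) ^ k) =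
    (pball p n k : Set (Fin n → ℚ_[p])) := by
  rw [coe_pball, zpow_natCast]

lemma setIntegral_eq_fourierL1 (f : (Fin n → ℚ_[p]) → ℂ) (k : ℕ) (ξ : Fin n → ℚ_[p]) :
    ∫ x in Metric.closedBall 0 ((p : ℝ) ^ k), chi (ξ ⬝ᵥ x) * f x ∂(haar p n) =
      fourierL1 ((pball p n k : Set (Fin n → ℚ_[p])).indicator f) ξ := by
  rw [closedBall_eq_pball, ← integral_indicator (measurableSet_pball _), fourierL1]
  congr 1; ext x
  by_cases hx : x ∈ (pball p n k : Set (Fin n → ℚ_[p]))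
  · rw [Set.indicator_of_mem hx, Set.indicator_of_mem hx]
  · rw [Set.indicator_of_notMem hx, Set.indicator_of_notMem hx, mul_zero]

lemma setIntegral_eq_fourierInv (f : (Fin n → ℚ_[p]) → ℂ) (k : ℕ) (x : Fin n → ℚ_[p]) :
    ∫ ξ in Metric.closedBall 0 ((p : ℝ) ^ k), chi (-(x ⬝ᵥ ξ)) * f ξ ∂(haar p n) =
      fourierInv ((pball p n k : Set (Fin n → ℚ_[p])).indicator f) x := by
  rw [fourierInv, ← setIntegral_eq_fourierL1]
  simp

lemma tendsto_eLpNorm_sub_indicator {G : (Fin n → ℚ_[p]) → ℂ} (hG : MemLp G 2 (haar p n)) :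
    Tendsto (fun k : ℕ => eLpNorm (fun ξ => (pball p n k : Set (Fin n → ℚ_[p])).indicator G ξ
      - G ξ) 2 (haar p n)) atTop (𝓝 0) := by
  have h0 : Tendsto (fun k : ℕ => ∫⁻ ξ, ‖(pball p n k : Set (Fin n → ℚ_[p])).indicator G ξ
      - G ξ‖ₑ ^ 2 ∂(haar p n)) atTop (𝓝 (∫⁻ _, 0 ∂(haar p n))) := by
    refine tendsto_lintegral_of_dominated_convergence' (fun ξ => ‖G ξ‖ₑ ^ 2) (fun k => ?_)
      (fun k => Eventually.of_forall fun ξ => ?_) ?_ (Eventually.of_forall fun ξ => ?_)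
    · exact ((hG.1.indicator (measurableSet_pball _)).sub hG.1).enorm.pow_const 2
    · beta_reduce
      by_cases hξ : ξ ∈ (pball p n k : Set (Fin n → ℚ_[p]))
      · rw [Set.indicator_of_mem hξ]; simp
      · rw [Set.indicator_of_notMem hξ]; simp
    · rw [← eLpNorm_two_sq]
      exact ENNReal.pow_ne_top hG.2.ne
    · obtain ⟨k, hk⟩ := exists_mem_pball ξ
      refine tendsto_const_nhds.congr' ?_
      filter_upwards [eventually_ge_atTop k] with l hl
      have : ξ ∈ (pball p n l : Set (Fin n → ℚ_[p])) := pball_mono (by exact_mod_cast hl) hk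
      rw [Set.indicator_of_mem this]; simp
  rw [lintegral_zero] at h0
  simp only [← eLpNorm_two_sq] at h0
  have h1 := (ENNReal.continuous_rpow_const (y := (1 / 2 : ℝ))).tendsto 0 |>.comp h0
  simp only [Function.comp_def, ← ENNReal.rpow_natCast, ← ENNReal.rpow_mul] at h1
  simpa using h1

/-- The inversion formula on `L¹ ∩ L²` defines an inverse transform in the sense of `L²`. -/
lemma isInvFourierL2_fourierInv {G : (Fin n → ℚ_[p]) → ℂ} (hG : Integrable G (haar p n))
    (hG2 : MemLp G 2 (haar p n)) : IsInvFourierL2 G (fourierInv G) := by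
  refine ⟨hG2, ⟨(continuous_fourierInv hG).aestronglyMeasurable,
    (eLpNorm_fourierInv_le hG).trans_lt hG2.2⟩, ?_⟩
  refine tendsto_of_tendsto_of_tendsto_of_le_of_le tendsto_const_nhds
    (tendsto_eLpNorm_sub_indicator hG2) (fun _ => zero_le) fun k => ?_
  have hi := integrable_indicator_pball hG (k : ℤ)
  have e : (fun x => (∫ ξ in Metric.closedBall 0 ((p : ℝ) ^ k),
      chi (-(x ⬝ᵥ ξ)) * G ξ ∂(haar p n)) - fourierInv G x) =
      fourierInv fun ξ => (pball p n k : Set (Fin n → ℚ_[p])).indicator G ξ - G ξ := by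
    ext x
    rw [setIntegral_eq_fourierInv, fourierInv, fourierInv, fourierInv, fourierL1_sub hi hG]
  beta_reduce
  rw [e]
  exact eLpNorm_fourierInv_le (hi.sub hG)

lemma TestLevel.isFourierL2 {f : (Fin n → ℚ_[p]) → ℂ} {R M : ℤ} (h : TestLevel R M f) :
    IsFourierL2 f (PadicFeller.fourierL1 f) := by
  refine ⟨h.memLp 2, h.fourierL1.memLp 2, tendsto_const_nhds.congr' ?_⟩
  filter_upwards [eventually_ge_atTop R.toNat] with k hk
  have e : (pball p n k : Set (Fin n → ℚ_[p])).indicator f = f := by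
    ext x
    by_cases hx : x ∈ (pball p n k : Set (Fin n → ℚ_[p]))
    · rw [Set.indicator_of_mem hx]
    · rw [Set.indicator_of_notMem hx, h.1 x fun hc => hx (pball_mono (by omega) hc)]
  simp only [setIntegral_eq_fourierL1, e, sub_self]
  simp

lemma integrable_indicator_of_memLp {f : (Fin n → ℚ_[p]) → ℂ} (hf : MemLp f 2 (haar p n))
    (j : ℤ) : Integrable ((pball p n j : Set (Fin n → ℚ_[p])).indicator f) (haar p n) := by
  rw [integrable_indicator_iff (measurableSet_pball j)]
  have : IsFiniteMeasure ((haar p n).restrict (pball p n j : Set (Fin n → ℚ_[p]))) :=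
    ⟨by rw [Measure.restrict_apply_univ]; exact (isCompact_pball j).measure_lt_top⟩
  exact (hf.restrict _).integrable one_le_two

lemma continuous_setIntegral_chi {f : (Fin n → ℚ_[p]) → ℂ} (hf : MemLp f 2 (haar p n)) (k : ℕ) :
    Continuous fun ξ => ∫ x in Metric.closedBall 0 ((p : ℝ) ^ k),
      chi (ξ ⬝ᵥ x) * f x ∂(haar p n) := by
  simp only [setIntegral_eq_fourierL1]
  exact continuous_fourierL1 (integrable_indicator_of_memLp hf _)

/-- Transforms enter the function spaces through an existential, and the operator is built from a
choice of them; uniqueness makes it linear and independent of the choice. -/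
lemma IsFourierL2.ae_eq {f g g' : (Fin n → ℚ_[p]) → ℂ} (h : IsFourierL2 f g)
    (h' : IsFourierL2 f g') : g =ᵐ[haar p n] g' := by
  have hm := fun k => (continuous_setIntegral_chi h.1 k).aestronglyMeasurable (μ := haar p n)
  have h1 : eLpNorm (g - g') 2 (haar p n) = 0 := by
    refine le_antisymm (ge_of_tendsto (x := atTop) (by simpa using h'.2.2.add h.2.2)
      (Eventually.of_forall fun k => ?_)) zero_le
    have := eLpNorm_sub_le (p := 2) ((hm k).sub h'.2.1.1) ((hm k).sub h.2.1.1) one_le_two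
    convert! this using 2
    abel
  have h2 := (eLpNorm_eq_zero_iff (h.2.1.1.sub h'.2.1.1) two_ne_zero).1 h1
  filter_upwards [h2] with x hx
  exact sub_eq_zero.1 hx

lemma IsFourierL2.add {f g f' g' : (Fin n → ℚ_[p]) → ℂ} (h : IsFourierL2 f g)
    (h' : IsFourierL2 f' g') : IsFourierL2 (fun x => f x + f' x) (fun ξ => g ξ + g' ξ) := by
  have hm := fun k => (continuous_setIntegral_chi h.1 k).aestronglyMeasurable (μ := haar p n)
  have hm' := fun k => (continuous_setIntegral_chi h'.1 k).aestronglyMeasurable (μ := haar p n)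
  refine ⟨h.1.add h'.1, h.2.1.add h'.2.1, ?_⟩
  refine tendsto_of_tendsto_of_tendsto_of_le_of_le tendsto_const_nhds
    (by simpa using h.2.2.add h'.2.2) (fun _ => zero_le) fun k => ?_
  refine le_trans (le_of_eq ?_)
    (eLpNorm_add_le ((hm k).sub h.2.1.1) ((hm' k).sub h'.2.1.1) one_le_two)
  congr 1; ext ξ
  simp only [Pi.add_apply, setIntegral_eq_fourierL1]
  rw [show (pball p n k : Set (Fin n → ℚ_[p])).indicator (fun x => f x + f' x) = fun x =>
    (pball p n k : Set (Fin n → ℚ_[p])).indicator f x +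
    (pball p n k : Set (Fin n → ℚ_[p])).indicator f' x from Set.indicator_add _ _ _,
    fourierL1_add (integrable_indicator_of_memLp h.1 _) (integrable_indicator_of_memLp h'.1 _)]
  ring

lemma IsFourierL2.const_mul {f g : (Fin n → ℚ_[p]) → ℂ} (h : IsFourierL2 f g) (c : ℂ) :
    IsFourierL2 (fun x => c * f x) (fun ξ => c * g ξ) := by
  refine ⟨h.1.const_mul c, h.2.1.const_mul c, ?_⟩
  have e : ∀ k : ℕ, eLpNorm (fun ξ => (∫ x in Metric.closedBall 0 ((p : ℝ) ^ k),
      chi (ξ ⬝ᵥ x) * (c * f x) ∂(haar p n)) - c * g ξ) 2 (haar p n) = ‖c‖ₑ *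
      eLpNorm (fun ξ => (∫ x in Metric.closedBall 0 ((p : ℝ) ^ k),
      chi (ξ ⬝ᵥ x) * f x ∂(haar p n)) - g ξ) 2 (haar p n) := by
    intro k
    rw [← eLpNorm_const_smul]
    congr 1; ext ξ
    simp only [Pi.smul_apply, smul_eq_mul, mul_left_comm _ c, integral_const_mul, mul_sub]
  simp only [e]
  simpa using ENNReal.Tendsto.const_mul h.2.2 (Or.inr enorm_ne_top)

lemma IsFourierL2.congr_ae {f f' g : (Fin n → ℚ_[p]) → ℂ} (h : IsFourierL2 f g)
    (hf : f =ᵐ[haar p n] f') : IsFourierL2 f' g := by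
  refine ⟨(memLp_congr_ae hf).1 h.1, h.2.1, ?_⟩
  have e : ∀ (k : ℕ) (ξ : Fin n → ℚ_[p]), ∫ x in Metric.closedBall 0 ((p : ℝ) ^ k),
      chi (ξ ⬝ᵥ x) * f' x ∂(haar p n) = ∫ x in Metric.closedBall 0 ((p : ℝ) ^ k),
      chi (ξ ⬝ᵥ x) * f x ∂(haar p n) := by
    intro k ξ
    refine integral_congr_ae (ae_restrict_of_ae ?_)
    filter_upwards [hf] with x hx
    rw [hx]
  simp only [e]
  exact h.2.2

/-! ### Inversion for transforms in `L¹` -/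

lemma tendsto_integral_mul_of_eLpNorm {α : Type*} [MeasurableSpace α] {μ : Measure α}
    {F : ℕ → α → ℂ} {g θ : α → ℂ} (hF : ∀ k, AEStronglyMeasurable (F k) μ) (hg : MemLp g 2 μ)
    (hθ : MemLp θ 2 μ) (h : Tendsto (fun k => eLpNorm (fun x => F k x - g x) 2 μ) atTop (𝓝 0)) :
    Tendsto (fun k => ∫ x, F k x * θ x ∂μ) atTop (𝓝 (∫ x, g x * θ x ∂μ)) := by
  have hb : ∀ k, eLpNorm (fun x => F k x * θ x - g x * θ x) 1 μ ≤
      eLpNorm (fun x => F k x - g x) 2 μ * eLpNorm θ 2 μ := by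
    intro k
    have := eLpNorm_smul_le_mul_eLpNorm (p := 2) (q := 2) (r := 1) hθ.1 ((hF k).sub hg.1)
    refine le_trans (le_of_eq ?_) this
    congr 1; ext x; simp [sub_mul]
  refine tendsto_integral_of_L1' _ (hg.integrable_mul hθ).1 ?_ ?_
  · have h1 : ∀ᶠ k in atTop, eLpNorm (fun x => F k x - g x) 2 μ < 1 :=
      h.eventually (gt_mem_nhds one_pos)
    filter_upwards [h1] with k hk
    have h2 : MemLp (F k) 2 μ := by
      have : MemLp (fun x => F k x - g x) 2 μ := ⟨(hF k).sub hg.1, hk.trans ENNReal.one_lt_top⟩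
      have h3 := this.add hg
      rwa [show (fun x => F k x - g x) + g = F k by ext x; simp] at h3
    exact h2.integrable_mul hθ
  · refine tendsto_of_tendsto_of_tendsto_of_le_of_le tendsto_const_nhds ?_ (fun _ => zero_le) hb
    simpa using ENNReal.Tendsto.mul_const h (Or.inr hθ.2.ne)

/-- The transform of θ has compact support, so the truncations of f in the definition of its
transform are eventually invisible to the pairing. -/
lemma IsFourierL2.integral_mul_test {f g θ : (Fin n → ℚ_[p]) → ℂ} (h : IsFourierL2 f g)
    {R M : ℤ} (hθ : TestLevel R M θ) :
    ∫ ξ, g ξ * θ ξ ∂(haar p n) = ∫ x, f x * fourierL1 θ x ∂(haar p n) := by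
  refine tendsto_nhds_unique (tendsto_integral_mul_of_eLpNorm
    (fun k => (continuous_setIntegral_chi h.1 k).aestronglyMeasurable) h.2.1 (hθ.memLp 2) h.2.2) ?_
  refine tendsto_const_nhds.congr' ?_
  filter_upwards [eventually_ge_atTop (-M).toNat] with k hk
  simp only [setIntegral_eq_fourierL1]
  rw [integral_fourierL1_mul (integrable_indicator_of_memLp h.1 _) hθ.integrable]
  congr 1; ext x
  by_cases hx : x ∈ (pball p n k : Set (Fin n → ℚ_[p]))
  · rw [Set.indicator_of_mem hx]
  · rw [Set.indicator_of_notMem hx, hθ.fourierL1.1 x fun hc => hx (pball_mono (by omega) hc)]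
    simp

/-- A locally integrable function which is orthogonal to all test functions vanishes. -/
lemma ae_eq_zero_of_integral_mul_test {D : (Fin n → ℚ_[p]) → ℂ}
    (hD : LocallyIntegrable D (haar p n))
    (h : ∀ (R M : ℤ) (η : (Fin n → ℚ_[p]) → ℂ), TestLevel R M η →
      ∫ x, D x * η x ∂(haar p n) = 0) : D =ᵐ[haar p n] 0 := by
  classical
  refine ae_eq_zero_of_forall_setIntegral_isCompact_eq_zero' hD fun K hK => ?_
  obtain ⟨r, hr⟩ := hK.isBounded.subset_closedBall 0
  obtain ⟨R, hR⟩ := pow_unbounded_of_one_lt r (one_lt_prime (p := p))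
  have hKR : ∀ x ∈ K, x ∈ pball p n R := fun x hx => by
    rw [mem_pball, zpow_natCast]
    exact (mem_closedBall_zero_iff.1 (hr hx)).trans hR.le
  -- T N is the p^(-N)-neighbourhood of K. It is a union of cosets of a ball, so its indicator is a
  -- test function, and these indicators converge to that of the closed set K.
  let T : ℕ → Set (Fin n → ℚ_[p]) := fun N => {x | ∃ y ∈ K, x - y ∈ pball p n (-N)}
  have hT : ∀ (N : ℕ) x y, y ∈ pball p n (-N) → (x + y ∈ T N ↔ x ∈ T N) := by
    intro N x y hy
    constructor
    · rintro ⟨z, hz, hxz⟩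
      refine ⟨z, hz, ?_⟩
      have := sub_mem hxz hy
      rwa [add_sub_right_comm, add_sub_cancel_right] at this
    · rintro ⟨z, hz, hxz⟩
      refine ⟨z, hz, ?_⟩
      have := add_mem hxz hy
      rwa [← add_sub_right_comm] at this
  have hTR : ∀ N, T N ⊆ (pball p n R : Set (Fin n → ℚ_[p])) := by
    rintro N x ⟨y, hy, hxy⟩
    have := add_mem (pball_mono (j := R) (by omega) hxy) (hKR y hy)
    simpa using this
  have htest : ∀ N : ℕ, TestLevel R (-N) ((T N).indicator (fun _ => (1 : ℂ))) := by
    intro N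
    refine ⟨fun x hx => Set.indicator_of_notMem (fun hc => hx (hTR N hc)) _, fun x y hy => ?_⟩
    simp only [Set.indicator_apply, hT N x y hy]
  have hlim : Tendsto (fun N : ℕ => ∫ x, D x * (T N).indicator (fun _ => (1 : ℂ)) x ∂(haar p n))
      atTop (𝓝 (∫ x, K.indicator D x ∂(haar p n))) := by
    refine tendsto_integral_of_dominated_convergence
      (fun x => ‖(pball p n R : Set (Fin n → ℚ_[p])).indicator D x‖) (fun N => ?_) ?_
      (fun N => Eventually.of_forall fun x => ?_) (Eventually.of_forall fun x => ?_)
    · exact hD.aestronglyMeasurable.mul (htest N).continuous.aestronglyMeasurable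
    · exact ((hD.integrableOn_isCompact (isCompact_pball _)).integrable_indicator
        (measurableSet_pball _)).norm
    · by_cases hx : x ∈ T N
      · rw [Set.indicator_of_mem hx, Set.indicator_of_mem (hTR N hx), mul_one]
      · rw [Set.indicator_of_notMem hx]; simp
    · refine tendsto_const_nhds.congr' ?_
      by_cases hx : x ∈ K
      · refine Eventually.of_forall fun N => ?_
        have : x ∈ T N := ⟨x, hx, by simp⟩
        beta_reduce
        rw [Set.indicator_of_mem hx, Set.indicator_of_mem this, mul_one]
      · obtain ⟨ε, hε, hb⟩ := Metric.isOpen_iff.1 hK.isClosed.isOpen_compl x hx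
        obtain ⟨k, hk⟩ := exists_zpow_lt (p := p) hε
        filter_upwards [eventually_ge_atTop k] with N hN
        have : x ∉ T N := by
          rintro ⟨y, hy, hxy⟩
          refine hb ?_ hy
          rw [Metric.mem_ball, dist_comm, dist_eq_norm]
          exact (pball_mono (by omega : -(N : ℤ) ≤ -(k : ℤ)) hxy :).trans_lt hk
        rw [Set.indicator_of_notMem hx, Set.indicator_of_notMem this, mul_zero]
  rw [← integral_indicator hK.measurableSet]
  refine tendsto_nhds_unique hlim ?_
  simp only [h _ _ _ (htest _)]
  exact tendsto_const_nhds

/-- Both sides have the same pairing with every test function η, as is seen by writing η as the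
transform of its inverse transform. -/
lemma IsFourierL2.ae_eq_fourierInv {f g : (Fin n → ℚ_[p]) → ℂ} (h : IsFourierL2 f g)
    (hg : Integrable g (haar p n)) : f =ᵐ[haar p n] fourierInv g := by
  have hc := continuous_fourierInv hg
  have hD : LocallyIntegrable (fun x => f x - fourierInv g x) (haar p n) :=
    (h.1.locallyIntegrable one_le_two).sub hc.locallyIntegrable
  have := ae_eq_zero_of_integral_mul_test hD fun R M η hη => ?_
  · filter_upwards [this] with x hx
    exact sub_eq_zero.1 hx
  · have h1 := h.integral_mul_test hη.fourierInv
    rw [hη.fourierL1_fourierInv] at h1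
    have h2 : ∫ x, fourierInv g x * η x ∂(haar p n) =
        ∫ ξ, g ξ * fourierInv η ξ ∂(haar p n) := by
      rw [← integral_neg_eq_self]
      simp only [fourierInv, neg_neg]
      rw [integral_fourierL1_mul hg hη.comp_neg.integrable]
      simp only [fourierL1_comp_neg]
    simp only [sub_mul]
    rw [integral_sub, h2, h1, sub_self]
    · exact h.1.integrable_mul (hη.memLp 2)
    · exact (hc.mul hη.continuous).integrable_of_hasCompactSupport hη.hasCompactSupport.mul_left

/-! ### Weighted approximation by test functions -/

/-- `g` is the Fourier transform of the real function `f`, and it is the limit of transforms of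
real test functions in `L²` with weight `v ^ 2`. -/
def WeightedApprox (v : (Fin n → ℚ_[p]) → ℝ) (f : (Fin n → ℚ_[p]) → ℝ)
    (g : (Fin n → ℚ_[p]) → ℂ) : Prop :=
  IsFourierL2 (fun x => (f x : ℂ)) g ∧
    ∃ φ : ℕ → (Fin n → ℚ_[p]) → ℝ, (∀ k, IsTestFunction (φ k)) ∧
      Tendsto (fun k => eLpNorm (fun ξ =>
        (v ξ : ℂ) * (fourierL1 (fun x => (φ k x : ℂ)) ξ - g ξ)) 2 (haar p n)) atTop (𝓝 0)

lemma tendsto_sq_zero_iff {ι : Type*} {l : Filter ι} {f : ι → ℝ≥0∞} :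
    Tendsto (fun k => f k ^ 2) l (𝓝 0) ↔ Tendsto f l (𝓝 0) := by
  constructor
  · intro h
    have h1 := (ENNReal.continuous_rpow_const (y := (1 / 2 : ℝ))).tendsto 0 |>.comp h
    simp only [Function.comp_def, ← ENNReal.rpow_natCast, ← ENNReal.rpow_mul] at h1
    simpa using h1
  · intro h
    have h1 := ((ENNReal.continuous_pow 2).tendsto 0).comp h
    simpa [Function.comp_def] using h1

/-- Moving the square root of the weight inside the L² norm makes Minkowski's and Hölder's
inequalities for `eLpNorm` available. -/
lemma memB_iff {w : (Fin n → ℚ_[p]) → ℝ} {l : ℕ} {f : (Fin n → ℚ_[p]) → ℝ} :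
    MemB w l f ↔ ∃ g, WeightedApprox (fun ξ => Real.sqrt ((max 1 |w ξ|) ^ l)) f g := by
  refine exists_congr fun g => and_congr_right fun _ => exists_congr fun φ =>
    and_congr_right fun _ => ?_
  refine Iff.trans ?_ tendsto_sq_zero_iff
  refine tendsto_congr fun k => ?_
  rw [eLpNorm_two_sq]
  refine lintegral_congr fun ξ => ?_
  have h0 : 0 ≤ (max 1 |w ξ|) ^ l := by positivity
  rw [← ofReal_norm, ← ENNReal.ofReal_pow (norm_nonneg _), norm_mul, Complex.norm_real,
    Real.norm_of_nonneg (Real.sqrt_nonneg _), mul_pow, Real.sq_sqrt h0]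

namespace WeightedApprox

variable {v : (Fin n → ℚ_[p]) → ℝ} {f f' : (Fin n → ℚ_[p]) → ℝ} {g g' : (Fin n → ℚ_[p]) → ℂ}

lemma mono {v' : (Fin n → ℚ_[p]) → ℝ} (h : WeightedApprox v' f g) {C : ℝ}
    (hC : ∀ ξ, |v ξ| ≤ C * |v' ξ|) : WeightedApprox v f g := by
  obtain ⟨h1, φ, hφ, hlim⟩ := h
  refine ⟨h1, φ, hφ, ?_⟩
  refine tendsto_of_tendsto_of_tendsto_of_le_of_le tendsto_const_nhds
    (by simpa using ENNReal.Tendsto.const_mul hlim (Or.inr (ENNReal.ofReal_ne_top (r := C))))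
    (fun _ => zero_le) fun k => ?_
  refine eLpNorm_le_mul_eLpNorm_of_ae_le_mul (Eventually.of_forall fun ξ => ?_) 2
  rw [norm_mul, norm_mul, Complex.norm_real, Complex.norm_real, ← mul_assoc]
  exact mul_le_mul_of_nonneg_right (hC ξ) (norm_nonneg _)

lemma congr_left (h : WeightedApprox v f g) (hf : f =ᵐ[haar p n] f') :
    WeightedApprox v f' g := by
  refine ⟨h.1.congr_ae ?_, h.2⟩
  filter_upwards [hf] with x hx
  rw [hx]

lemma continuous_transform {φ : (Fin n → ℚ_[p]) → ℝ} (hφ : IsTestFunction φ) :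
    Continuous (fourierL1 fun x => (φ x : ℂ)) := by
  obtain ⟨R, M, h⟩ := isTestFunction_iff.1 hφ
  exact h.ofReal.fourierL1.continuous

lemma integrable_ofReal {φ : (Fin n → ℚ_[p]) → ℝ} (hφ : IsTestFunction φ) :
    Integrable (fun x => (φ x : ℂ)) (haar p n) := by
  obtain ⟨R, M, h⟩ := isTestFunction_iff.1 hφ
  exact h.ofReal.integrable

lemma aestronglyMeasurable_diff (hv : Measurable v) (h : IsFourierL2 (fun x => (f x : ℂ)) g)
    {φ : (Fin n → ℚ_[p]) → ℝ} (hφ : IsTestFunction φ) :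
    AEStronglyMeasurable (fun ξ => (v ξ : ℂ) * (fourierL1 (fun x => (φ x : ℂ)) ξ - g ξ))
      (haar p n) :=
  (Complex.measurable_ofReal.comp hv).aestronglyMeasurable.mul
    ((continuous_transform hφ).aestronglyMeasurable.sub h.2.1.1)

lemma add (hv : Measurable v) (h : WeightedApprox v f g) (h' : WeightedApprox v f' g') :
    WeightedApprox v (fun x => f x + f' x) (fun ξ => g ξ + g' ξ) := by
  obtain ⟨h1, φ, hφ, hlim⟩ := h
  obtain ⟨h1', φ', hφ', hlim'⟩ := h'
  refine ⟨by simpa using h1.add h1', fun k x => φ k x + φ' k x, fun k => ?_, ?_⟩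
  · exact ⟨(hφ k).1.add (hφ' k).1, (hφ k).2.add (hφ' k).2⟩
  · refine tendsto_of_tendsto_of_tendsto_of_le_of_le tendsto_const_nhds
      (by simpa using hlim.add hlim') (fun _ => zero_le) fun k => ?_
    refine le_trans (le_of_eq ?_) (eLpNorm_add_le (aestronglyMeasurable_diff hv h1 (hφ k))
      (aestronglyMeasurable_diff hv h1' (hφ' k)) one_le_two)
    congr 1; ext ξ
    simp only [Pi.add_apply, Complex.ofReal_add]
    rw [fourierL1_add (integrable_ofReal (hφ k)) (integrable_ofReal (hφ' k))]
    ring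

lemma const_mul (h : WeightedApprox v f g) (c : ℝ) :
    WeightedApprox v (fun x => c * f x) (fun ξ => (c : ℂ) * g ξ) := by
  obtain ⟨h1, φ, hφ, hlim⟩ := h
  refine ⟨by simpa using h1.const_mul (c : ℂ), fun k x => c * φ k x, fun k => ?_, ?_⟩
  · obtain ⟨R, M, ht⟩ := isTestFunction_iff.1 (hφ k)
    exact isTestFunction_iff.2 ⟨R, M, fun x hx => by simp [ht.1 x hx],
      fun x y hy => congrArg _ (ht.2 x y hy)⟩
  · have e : ∀ k, eLpNorm (fun ξ => (v ξ : ℂ) * (fourierL1 (fun x => ((c * φ k x : ℝ) : ℂ)) ξ -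
        c * g ξ)) 2 (haar p n) = ‖(c : ℂ)‖ₑ * eLpNorm (fun ξ =>
        (v ξ : ℂ) * (fourierL1 (fun x => (φ k x : ℂ)) ξ - g ξ)) 2 (haar p n) := by
      intro k
      rw [← eLpNorm_const_smul]
      congr 1; ext ξ
      simp only [Complex.ofReal_mul, fourierL1_const_mul, Pi.smul_apply, smul_eq_mul]
      ring
    simp only [e]
    simpa using ENNReal.Tendsto.const_mul hlim (Or.inr enorm_ne_top)

lemma of_test {φ : (Fin n → ℚ_[p]) → ℝ} (hφ : IsTestFunction φ) :
    WeightedApprox v φ (fourierL1 fun x => (φ x : ℂ)) := by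
  obtain ⟨R, M, h⟩ := isTestFunction_iff.1 hφ
  exact ⟨h.ofReal.isFourierL2, fun _ => φ, fun _ => hφ, by simp⟩

end WeightedApprox

section MemBInfty

variable {w : (Fin n → ℚ_[p]) → ℝ} {f f' : (Fin n → ℚ_[p]) → ℝ}

lemma MemBInfty.add (hw : Continuous w) (h : MemBInfty w f) (h' : MemBInfty w f') :
    MemBInfty w (fun x => f x + f' x) := by
  intro l
  obtain ⟨g, hg⟩ := memB_iff.1 (h l)
  obtain ⟨g', hg'⟩ := memB_iff.1 (h' l)
  exact memB_iff.2 ⟨_, hg.add (by fun_prop) hg'⟩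

lemma MemBInfty.const_mul (h : MemBInfty w f) (c : ℝ) : MemBInfty w (fun x => c * f x) := by
  intro l
  obtain ⟨g, hg⟩ := memB_iff.1 (h l)
  exact memB_iff.2 ⟨_, hg.const_mul c⟩

lemma MemBInfty.congr_ae (h : MemBInfty w f) (hf : f =ᵐ[haar p n] f') : MemBInfty w f' := by
  intro l
  obtain ⟨g, hg⟩ := memB_iff.1 (h l)
  exact memB_iff.2 ⟨_, hg.congr_left hf⟩

lemma IsTestFunction.memBInfty (h : IsTestFunction f) : MemBInfty w f := fun _ =>
  memB_iff.2 ⟨_, WeightedApprox.of_test h⟩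

end MemBInfty

/-! ### Comparison of the weight with the norm and with the symbol -/

lemma IsAttachedWeight.continuous {b : Fin m → ℝ} {ψ : Fin m → (Fin n → ℚ_[p]) → ℝ}
    {w : (Fin n → ℚ_[p]) → ℝ} (hw : IsAttachedWeight b ψ w) (hc : ∀ j, Continuous (ψ j)) :
    Continuous w := by
  rcases hw with ⟨-, -, C, β, -, hβ, -, hw⟩ | ⟨-, -, C, -, hw⟩
  · rw [show w = fun ξ => ‖ξ‖ ^ β from funext hw]
    exact continuous_norm.rpow_const fun _ => Or.inr (by linarith)
  · classical
    rw [show w = _ from funext hw]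
    exact continuous_const.mul (continuous_finsetSum _ fun j _ => hc j)

/-- In case (i) max(1,|w|) equals max(1,‖ξ‖)^β, and β ≥ 1. In case (ii) w dominates each type 2
summand up to a constant; one such summand already outgrows every power of the norm, hence the norm
itself and the functions of type 1, while those of type 0 are bounded. -/
lemma IsAttachedWeight.bounds {b : Fin m → ℝ} (hb : ∀ j, 0 < b j)
    {ψ : Fin m → (Fin n → ℚ_[p]) → ℝ} (h0 : ∀ j ξ, 0 ≤ ψ j ξ)
    {w : (Fin n → ℚ_[p]) → ℝ} (hw : IsAttachedWeight b ψ w) :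
    ∃ C : ℝ, 0 < C ∧ ∀ ξ, max 1 ‖ξ‖ ≤ C * max 1 |w ξ| ∧ symbol b ψ ξ ≤ C * max 1 |w ξ| := by
  classical
  rcases hw with ⟨-, -, C, β, hC, hβ, hσ, hw⟩ | ⟨hty, ⟨i, hi⟩, C, hC, hw⟩
  · have key : ∀ ξ : Fin n → ℚ_[p], (max 1 ‖ξ‖) ^ β = max 1 |w ξ| := by
      intro ξ
      rw [hw, abs_of_nonneg (by positivity)]
      rcases le_total 1 ‖ξ‖ with h | h
      · rw [max_eq_right h, max_eq_right (Real.one_le_rpow h (by linarith))]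
      · rw [max_eq_left h, max_eq_left (Real.rpow_le_one (norm_nonneg _) h (by linarith)),
          Real.one_rpow]
    refine ⟨max 1 C, by positivity, fun ξ => ?_⟩
    rw [← key]
    have h1 : max 1 ‖ξ‖ ≤ (max 1 ‖ξ‖) ^ β := by
      conv_lhs => rw [← Real.rpow_one (max 1 ‖ξ‖)]
      exact Real.rpow_le_rpow_of_exponent_le (le_max_left _ _) hβ
    have h2 : 0 ≤ (max 1 ‖ξ‖) ^ β := by positivity
    constructor
    · exact h1.trans (le_mul_of_one_le_left h2 (le_max_left _ _))
    · exact (hσ ξ).trans (mul_le_mul_of_nonneg_right (le_max_right _ _) h2)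
  · have hle : ∀ j, IsType2 (ψ j) → ∀ ξ, ψ j ξ ≤ C⁻¹ * max 1 |w ξ| := by
      intro j hj ξ
      have h1 : ψ j ξ ≤ ∑ j with IsType2 (ψ j), ψ j ξ :=
        Finset.single_le_sum (f := fun j => ψ j ξ) (fun j _ => h0 j ξ) (by simpa using hj)
      rw [inv_mul_eq_div, le_div_iff₀ hC]
      calc ψ j ξ * C ≤ w ξ := by rw [hw, mul_comm]; gcongr
        _ ≤ _ := (le_abs_self _).trans (le_max_right _ _)
    have hgrow : ∀ β : ℝ, ∃ D : ℝ, 0 < D ∧ ∀ ξ : Fin n → ℚ_[p],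
        (max 1 ‖ξ‖) ^ β ≤ D * max 1 |w ξ| := by
      intro β
      -- Type 2 only speaks of exponents at least 1; raising the exponent is harmless because the
      -- base is at least 1.
      obtain ⟨c, hc, hb⟩ := hi (max 1 β) (le_max_left _ _)
      refine ⟨c⁻¹ * max 1 C⁻¹, by positivity, fun ξ => ?_⟩
      have h1 : (max 1 ‖ξ‖) ^ β ≤ (max 1 ‖ξ‖) ^ (max 1 β) :=
        Real.rpow_le_rpow_of_exponent_le (le_max_left _ _) (le_max_right _ _)
      have h2 : max 1 |ψ i ξ| ≤ max 1 C⁻¹ * max 1 |w ξ| := by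
        refine max_le ?_ ?_
        · exact one_le_mul_of_one_le_of_one_le (le_max_left _ _) (le_max_left _ _)
        · rw [abs_of_nonneg (h0 i ξ)]
          refine (hle i hi ξ).trans ?_
          gcongr
          exact le_max_right _ _
      have h3 := (hb ξ).le.trans h2
      rw [mul_assoc, inv_mul_eq_div, le_div_iff₀ hc, mul_comm]
      exact (mul_le_mul_of_nonneg_left h1 hc.le).trans h3
    have hj : ∀ j, ∃ D : ℝ, 0 ≤ D ∧ ∀ ξ, ψ j ξ ≤ D * max 1 |w ξ| := by
      intro j
      rcases hty j with ⟨D, hD, hb⟩ | ⟨C₀, C₁, β₀, β₁, -, hC₁, -, -, hb⟩ | h2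
      · exact ⟨D, hD.le, fun ξ => ((le_abs_self _).trans (hb ξ)).trans
          (le_mul_of_one_le_right hD.le (le_max_left _ _))⟩
      · obtain ⟨D, hD, hg⟩ := hgrow β₁
        refine ⟨C₁ * D, by positivity, fun ξ => ?_⟩
        rw [mul_assoc]
        exact ((le_abs_self _).trans (le_max_right _ _)).trans ((hb ξ).2.trans (by
          gcongr
          exact hg ξ))
      · exact ⟨C⁻¹, by positivity, hle j h2⟩
    choose D hD0 hD using hj
    obtain ⟨D', hD', hg⟩ := hgrow 1
    have hS : 0 ≤ ∑ j, b j * D j := Finset.sum_nonneg fun j _ => mul_nonneg (hb j).le (hD0 j)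
    refine ⟨D' + ∑ j, b j * D j, by positivity, fun ξ => ⟨?_, ?_⟩⟩
    · have := hg ξ
      rw [Real.rpow_one] at this
      refine this.trans ?_
      gcongr
      linarith
    · calc symbol b ψ ξ ≤ ∑ j, b j * (D j * max 1 |w ξ|) :=
            Finset.sum_le_sum fun j _ => mul_le_mul_of_nonneg_left (hD j ξ) (hb j).le
        _ = (∑ j, b j * D j) * max 1 |w ξ| := by
            rw [Finset.sum_mul]; simp only [mul_assoc]
        _ ≤ _ := by
            gcongr
            linarith

lemma exists_nat_norm_bound (ξ : Fin n → ℚ_[p]) :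
    ∃ j : ℕ, ξ ∈ pball p n j ∧ (p : ℝ) ^ j ≤ max 1 ‖ξ‖ := by
  classical
  have h := exists_mem_pball ξ
  refine ⟨Nat.find h, Nat.find_spec h, ?_⟩
  rcases Nat.eq_zero_or_pos (Nat.find h) with h0 | h0
  · rw [h0, pow_zero]; exact le_max_left _ _
  · refine le_max_of_le_right ?_
    have h1 := Nat.find_min h (Nat.sub_one_lt h0.ne')
    rw [← norm_lt_zpow_add_one_iff, not_lt] at h1
    convert! h1 using 1
    rw [← zpow_natCast]
    congr 1
    omega

/-- Comparison with a sum over balls: the ball of level j has measure p^(jn) and carries the value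
p^(-j(n+1)), which leaves the geometric series of p^(-j). -/
lemma lintegral_norm_weight_lt_top :
    ∫⁻ ξ : Fin n → ℚ_[p], ENNReal.ofReal (((max 1 ‖ξ‖) ^ (n + 1))⁻¹) ∂(haar p n) < ∞ := by
  have hr : ENNReal.ofReal ((p : ℝ)⁻¹) < 1 := by
    rw [ENNReal.ofReal_lt_one]
    exact inv_lt_one_of_one_lt₀ one_lt_prime
  have hb : ∀ ξ : Fin n → ℚ_[p], ENNReal.ofReal (((max 1 ‖ξ‖) ^ (n + 1))⁻¹) ≤
      ∑' j : ℕ, (pball p n j : Set (Fin n → ℚ_[p])).indicator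
        (fun _ => ENNReal.ofReal ((((p : ℝ) ^ j) ^ (n + 1))⁻¹)) ξ := by
    intro ξ
    obtain ⟨j, hj, hle⟩ := exists_nat_norm_bound ξ
    refine le_trans ?_ (ENNReal.le_tsum j)
    rw [Set.indicator_of_mem (by exact hj)]
    have : (0 : ℝ) < (p : ℝ) ^ j := pow_pos prime_pos j
    gcongr
  refine (lintegral_mono hb).trans_lt ?_
  rw [lintegral_tsum fun j => (measurable_const.indicator (measurableSet_pball _)).aemeasurable]
  have e : ∀ j : ℕ, ∫⁻ ξ, (pball p n j : Set (Fin n → ℚ_[p])).indicator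
        (fun _ => ENNReal.ofReal ((((p : ℝ) ^ j) ^ (n + 1))⁻¹)) ξ ∂(haar p n) =
      ENNReal.ofReal ((p : ℝ)⁻¹) ^ j := by
    intro j
    have hp0 : (p : ℝ) ≠ 0 := (prime_pos (p := p)).ne'
    rw [lintegral_indicator_const (measurableSet_pball _), haar_pball,
      ← ENNReal.ofReal_mul (by positivity), ← ENNReal.ofReal_pow (by positivity)]
    congr 1
    rw [zpow_natCast, inv_pow, ← pow_mul, ← pow_mul, mul_add, mul_comm n j, pow_add, mul_one]
    field_simp
  simp only [e]
  rw [ENNReal.tsum_geometric]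
  exact ENNReal.inv_lt_top.2 (tsub_pos_of_lt hr)

lemma memLp_norm_weight :
    MemLp (fun ξ : Fin n → ℚ_[p] => ((((max 1 ‖ξ‖) ^ (n + 1))⁻¹ : ℝ) : ℂ)) 2 (haar p n) := by
  have hc : Continuous fun ξ : Fin n → ℚ_[p] => ((((max 1 ‖ξ‖) ^ (n + 1))⁻¹ : ℝ) : ℂ) := by
    refine Complex.continuous_ofReal.comp (Continuous.inv₀ (by fun_prop) fun ξ => ?_)
    positivity
  refine ⟨hc.aestronglyMeasurable, ?_⟩
  refine lt_of_not_ge fun htop => ?_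
  have hsq : eLpNorm (fun ξ : Fin n → ℚ_[p] => ((((max 1 ‖ξ‖) ^ (n + 1))⁻¹ : ℝ) : ℂ)) 2
      (haar p n) ^ 2 = ∞ := by rw [top_le_iff.1 htop]; simp
  rw [eLpNorm_two_sq] at hsq
  refine hsq.not_lt ?_
  refine (lintegral_mono fun ξ => ?_).trans_lt lintegral_norm_weight_lt_top
  have h1 : (1 : ℝ) ≤ (max 1 ‖ξ‖) ^ (n + 1) := one_le_pow₀ (le_max_left _ _)
  have h2 : ((max 1 ‖ξ‖) ^ (n + 1))⁻¹ ≤ 1 := inv_le_one_of_one_le₀ h1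
  have h3 : 0 ≤ ((max 1 ‖ξ‖) ^ (n + 1))⁻¹ := by positivity
  rw [← ofReal_norm, ← ENNReal.ofReal_pow (norm_nonneg _), Complex.norm_real,
    Real.norm_of_nonneg h3]
  exact ENNReal.ofReal_le_ofReal (by nlinarith)

/-! ### Transforms of elements of `B_{w,∞}` -/

/-- The transform of a real function is Hermitian, and a real even multiplier preserves this
symmetry, so the inverse transform is real. -/
lemma conj_fourierInv_mul_fourierL1 (φ τ : (Fin n → ℚ_[p]) → ℝ) (hτ : ∀ ξ, τ (-ξ) = τ ξ)
    (x : Fin n → ℚ_[p]) :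
    (fourierInv (fun ξ => (τ ξ : ℂ) * fourierL1 (fun y => (φ y : ℂ)) ξ) x).im = 0 := by
  rw [← Complex.conj_eq_iff_im]
  have h1 : ∀ ξ, (starRingEnd ℂ) (fourierL1 (fun y => (φ y : ℂ)) ξ) =
      fourierL1 (fun y => (φ y : ℂ)) (-ξ) := by
    intro ξ
    rw [fourierL1, fourierL1, ← integral_conj]
    congr 1; ext y
    rw [map_mul, Complex.conj_ofReal, ← chi_neg, neg_dotProduct]
  rw [fourierInv, fourierL1, ← integral_conj, ← integral_neg_eq_self]
  congr 1; ext ξ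
  rw [map_mul, map_mul, h1, Complex.conj_ofReal, hτ, neg_neg, ← chi_neg, dotProduct_neg, neg_neg]

/-- The weight which controls the `L¹` and `L²` norms of the transform times `1 + σ`. -/
def coreWeight (σ : (Fin n → ℚ_[p]) → ℝ) (ξ : Fin n → ℚ_[p]) : ℝ :=
  (1 + σ ξ) * (max 1 ‖ξ‖) ^ (n + 1)

section Core

variable {σ : (Fin n → ℚ_[p]) → ℝ} {w : (Fin n → ℚ_[p]) → ℝ} {f : (Fin n → ℚ_[p]) → ℝ}
  {g : (Fin n → ℚ_[p]) → ℂ}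

lemma MemBInfty.exists_coreWeight (hσ0 : ∀ ξ, 0 ≤ σ ξ) {C : ℝ} (hC : 0 < C)
    (hw : ∀ ξ, max 1 ‖ξ‖ ≤ C * max 1 |w ξ| ∧ σ ξ ≤ C * max 1 |w ξ|) (h : MemBInfty w f) :
    ∃ g, WeightedApprox (coreWeight σ) f g := by
  -- The factor 1 + σ costs one power of max(1,|w|) and the power of the norm costs n + 1 more; the
  -- total is doubled because the weight sits inside a squared norm.
  obtain ⟨g, hg⟩ := memB_iff.1 (h (2 * (n + 2)))
  refine ⟨g, hg.mono (C := (1 + C) * C ^ (n + 1)) fun ξ => ?_⟩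
  obtain ⟨h1, h2⟩ := hw ξ
  have hW : 1 ≤ max 1 |w ξ| := le_max_left _ _
  have h0 : 0 ≤ σ ξ := hσ0 ξ
  have e1 : |Real.sqrt ((max 1 |w ξ|) ^ (2 * (n + 2)))| = (max 1 |w ξ|) ^ (n + 2) := by
    rw [mul_comm 2, pow_mul, Real.sqrt_sq (by positivity), abs_of_nonneg (by positivity)]
  have e2 : |coreWeight σ ξ| = (1 + σ ξ) * (max 1 ‖ξ‖) ^ (n + 1) :=
    abs_of_nonneg (mul_nonneg (by positivity) (by positivity))
  rw [e1, e2]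
  calc (1 + σ ξ) * (max 1 ‖ξ‖) ^ (n + 1)
      ≤ ((1 + C) * max 1 |w ξ|) * (C * max 1 |w ξ|) ^ (n + 1) := by
        gcongr
        linarith
    _ = _ := by ring

/-- A weighted `L²` approximation is an `L¹` approximation after multiplication by `τ ≤ 1 + σ`. -/
lemma tendsto_eLpNorm_one_of_coreWeight (hσ0 : ∀ ξ, 0 ≤ σ ξ) (hσ : Continuous σ)
    (h : IsFourierL2 (fun x => (f x : ℂ)) g) {φ : ℕ → (Fin n → ℚ_[p]) → ℝ}
    (hφ : ∀ k, IsTestFunction (φ k))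
    (hlim : Tendsto (fun k => eLpNorm (fun ξ => (coreWeight σ ξ : ℂ) *
      (fourierL1 (fun x => (φ k x : ℂ)) ξ - g ξ)) 2 (haar p n)) atTop (𝓝 0))
    {τ : (Fin n → ℚ_[p]) → ℝ} (hτ : ∀ ξ, |τ ξ| ≤ 1 + σ ξ) :
    Tendsto (fun k => eLpNorm (fun ξ => (τ ξ : ℂ) *
      (fourierL1 (fun x => (φ k x : ℂ)) ξ - g ξ)) 1 (haar p n)) atTop (𝓝 0) := by
  have hcw : Measurable (coreWeight σ) :=
    Continuous.measurable (show Continuous fun ξ => (1 + σ ξ) * (max 1 ‖ξ‖) ^ (n + 1) by fun_prop)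
  -- Cauchy-Schwarz: the factor max(1,‖ξ‖)^(-n-1) lies in L² and compensates the extra power in
  -- `coreWeight`.
  have hlim' := ENNReal.Tendsto.const_mul hlim (Or.inr (memLp_norm_weight (p := p) (n := n)).2.ne)
  rw [mul_zero] at hlim'
  refine tendsto_of_tendsto_of_tendsto_of_le_of_le tendsto_const_nhds hlim' (fun _ => zero_le) fun k => ?_
  refine le_trans ?_ (eLpNorm_smul_le_mul_eLpNorm (p := 2) (q := 2) (r := 1)
    (WeightedApprox.aestronglyMeasurable_diff hcw h (hφ k)) memLp_norm_weight.1)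
  refine eLpNorm_mono fun ξ => ?_
  have h1 : (0 : ℝ) < (max 1 ‖ξ‖) ^ (n + 1) := by positivity
  have h2 := hσ0 ξ
  simp only [Pi.smul_apply', smul_eq_mul, norm_mul, Complex.norm_real, coreWeight]
  rw [← mul_assoc]
  refine mul_le_mul_of_nonneg_right ?_ (norm_nonneg _)
  rw [Real.norm_of_nonneg (by positivity : 0 ≤ ((max 1 ‖ξ‖) ^ (n + 1))⁻¹),
    Real.norm_of_nonneg (by positivity : 0 ≤ 1 + σ ξ), Real.norm_of_nonneg h1.le,
    Real.norm_eq_abs]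
  refine (hτ ξ).trans (le_of_eq ?_)
  field_simp

lemma tendsto_eLpNorm_two_of_coreWeight (hσ0 : ∀ ξ, 0 ≤ σ ξ)
    {φ : ℕ → (Fin n → ℚ_[p]) → ℝ}
    (hlim : Tendsto (fun k => eLpNorm (fun ξ => (coreWeight σ ξ : ℂ) *
      (fourierL1 (fun x => (φ k x : ℂ)) ξ - g ξ)) 2 (haar p n)) atTop (𝓝 0))
    {τ : (Fin n → ℚ_[p]) → ℝ} (hτ : ∀ ξ, |τ ξ| ≤ 1 + σ ξ) :
    Tendsto (fun k => eLpNorm (fun ξ => (τ ξ : ℂ) *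
      (fourierL1 (fun x => (φ k x : ℂ)) ξ - g ξ)) 2 (haar p n)) atTop (𝓝 0) := by
  refine tendsto_of_tendsto_of_tendsto_of_le_of_le tendsto_const_nhds hlim
    (fun _ => zero_le) fun k => ?_
  refine eLpNorm_mono fun ξ => ?_
  have h1 : (1 : ℝ) ≤ (max 1 ‖ξ‖) ^ (n + 1) := one_le_pow₀ (le_max_left _ _)
  have h2 := hσ0 ξ
  simp only [norm_mul, Complex.norm_real, coreWeight]
  refine mul_le_mul_of_nonneg_right ?_ (norm_nonneg _)
  rw [Real.norm_of_nonneg (by positivity : 0 ≤ 1 + σ ξ),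
    Real.norm_of_nonneg (by positivity : 0 ≤ (max 1 ‖ξ‖) ^ (n + 1)), Real.norm_eq_abs]
  exact (hτ ξ).trans (le_mul_of_one_le_right (by positivity) h1)

lemma memLp_mul_transform {τ : (Fin n → ℚ_[p]) → ℝ} (hτ : Continuous τ)
    {φ : (Fin n → ℚ_[p]) → ℝ} (hφ : IsTestFunction φ) (q : ℝ≥0∞) :
    MemLp (fun ξ => (τ ξ : ℂ) * fourierL1 (fun x => (φ x : ℂ)) ξ) q (haar p n) := by
  obtain ⟨R, M, ht⟩ := isTestFunction_iff.1 hφ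
  have := ht.ofReal.fourierL1
  exact ((Complex.continuous_ofReal.comp hτ).mul this.continuous).memLp_of_hasCompactSupport
    this.hasCompactSupport.mul_left

/-- At a stage where the error has norm below 1, τg is the difference of two functions in L^q: τ
times a test transform, and the error. -/
lemma memLp_mul_of_tendsto (hg : AEStronglyMeasurable g (haar p n))
    {φ : ℕ → (Fin n → ℚ_[p]) → ℝ} (hφ : ∀ k, IsTestFunction (φ k))
    {τ : (Fin n → ℚ_[p]) → ℝ} (hτ : Continuous τ) {q : ℝ≥0∞}
    (hlim : Tendsto (fun k => eLpNorm (fun ξ => (τ ξ : ℂ) *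
      (fourierL1 (fun x => (φ k x : ℂ)) ξ - g ξ)) q (haar p n)) atTop (𝓝 0)) :
    MemLp (fun ξ => (τ ξ : ℂ) * g ξ) q (haar p n) := by
  obtain ⟨k, hk⟩ := (hlim.eventually (gt_mem_nhds one_pos)).exists
  have h1 : MemLp (fun ξ => (τ ξ : ℂ) * (fourierL1 (fun x => (φ k x : ℂ)) ξ - g ξ)) q
      (haar p n) :=
    ⟨(Complex.continuous_ofReal.comp hτ).aestronglyMeasurable.mul
      ((WeightedApprox.continuous_transform (hφ k)).aestronglyMeasurable.sub hg),
      hk.trans ENNReal.one_lt_top⟩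
  refine ((memLp_mul_transform hτ (hφ k) q).sub h1).ae_eq (Eventually.of_forall fun ξ => ?_)
  simp only [Pi.sub_apply]
  ring

/-- The properties of the transform of an element of `B_{w,∞}` which are needed for the symbol
`σ`. -/
structure IsCoreTransform (σ : (Fin n → ℚ_[p]) → ℝ) (f : (Fin n → ℚ_[p]) → ℝ)
    (g : (Fin n → ℚ_[p]) → ℂ) : Prop where
  isFourierL2 : IsFourierL2 (fun x => (f x : ℂ)) g
  integrable : ∀ τ : (Fin n → ℚ_[p]) → ℝ, Continuous τ → (∀ ξ, |τ ξ| ≤ 1 + σ ξ) →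
    Integrable (fun ξ => (τ ξ : ℂ) * g ξ) (haar p n)
  memLp : ∀ τ : (Fin n → ℚ_[p]) → ℝ, Continuous τ → (∀ ξ, |τ ξ| ≤ 1 + σ ξ) →
    MemLp (fun ξ => (τ ξ : ℂ) * g ξ) 2 (haar p n)
  im_eq_zero : ∀ τ : (Fin n → ℚ_[p]) → ℝ, Continuous τ → (∀ ξ, |τ ξ| ≤ 1 + σ ξ) →
    (∀ ξ, τ (-ξ) = τ ξ) → ∀ x, (fourierInv (fun ξ => (τ ξ : ℂ) * g ξ) x).im = 0

lemma WeightedApprox.isCoreTransform (hσ0 : ∀ ξ, 0 ≤ σ ξ) (hσ : Continuous σ)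
    (h : WeightedApprox (coreWeight σ) f g) : IsCoreTransform σ f g := by
  obtain ⟨h1, φ, hφ, hlim⟩ := h
  have l1 : ∀ τ : (Fin n → ℚ_[p]) → ℝ, (∀ ξ, |τ ξ| ≤ 1 + σ ξ) → _ := fun τ hτ =>
    tendsto_eLpNorm_one_of_coreWeight (τ := τ) hσ0 hσ h1 hφ hlim hτ
  have int : ∀ τ : (Fin n → ℚ_[p]) → ℝ, Continuous τ → (∀ ξ, |τ ξ| ≤ 1 + σ ξ) →
      Integrable (fun ξ => (τ ξ : ℂ) * g ξ) (haar p n) := fun τ hτ hle =>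
    memLp_one_iff_integrable.1 (memLp_mul_of_tendsto h1.2.1.1 hφ hτ (l1 τ hle))
  refine ⟨h1, int, fun τ hτ hle => memLp_mul_of_tendsto h1.2.1.1 hφ hτ
    (tendsto_eLpNorm_two_of_coreWeight hσ0 hlim hle), fun τ hτ hle heven x => ?_⟩
  -- Pointwise values of the inverse transform are continuous for L¹ convergence, so reality passes
  -- from test functions to the limit.
  have hlim2 : Tendsto (fun k => fourierInv (fun ξ => (τ ξ : ℂ) *
      fourierL1 (fun y => (φ k y : ℂ)) ξ) x) atTop
      (𝓝 (fourierInv (fun ξ => (τ ξ : ℂ) * g ξ) x)) := by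
    refine tendsto_integral_of_L1' _ (integrable_chi_mul (int τ hτ hle) _).1
      (Eventually.of_forall fun k => integrable_chi_mul
        (memLp_one_iff_integrable.1 (memLp_mul_transform hτ (hφ k) 1)) _) ?_
    refine (l1 τ hle).congr fun k => eLpNorm_congr_norm_ae (Eventually.of_forall fun ξ => ?_)
    simp only [Pi.sub_apply]
    rw [← mul_sub, ← mul_sub, norm_mul (chi _), norm_chi, one_mul]
  have h3 := (Complex.continuous_im.tendsto _).comp hlim2
  refine tendsto_nhds_unique h3 ?_
  simp only [Function.comp_def, conj_fourierInv_mul_fourierL1 _ _ heven]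
  exact tendsto_const_nhds

end Core

/-! ### Densely defined dissipative operators -/

section Dissipative

variable {X : Type*} [NormedAddCommGroup X] [NormedSpace ℝ X] {A : X →ₗ.[ℝ] X}

/-- Dissipativity at u + y passes to limits of (u, A u) in the graph. The fixed y is kept because A
y need not be controlled in those limits; closability uses it with y of size c. -/
lemma norm_le_of_mem_closure_graph (hA : ∀ c : ℝ, 0 < c → ∀ u : A.domain,
    ‖(u : X)‖ ≤ ‖(u : X) - c • A u‖) {z : X × X} (hz : z ∈ A.graph.topologicalClosure) {c : ℝ}
    (hc : 0 < c) (y : A.domain) : ‖z.1 + (y : X)‖ ≤ ‖z.1 + y - c • (z.2 + A y)‖ := by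
  have hcl : IsClosed {z : X × X | ‖z.1 + (y : X)‖ ≤ ‖z.1 + y - c • (z.2 + A y)‖} :=
    isClosed_le (by fun_prop) (by fun_prop)
  have hsub : (A.graph : Set (X × X)) ⊆
      {z : X × X | ‖z.1 + (y : X)‖ ≤ ‖z.1 + y - c • (z.2 + A y)‖} := by
    intro z hz
    obtain ⟨u, hu1, hu2⟩ := A.mem_graph_iff.1 hz
    have := hA c hc (u + y)
    rw [A.map_add] at this
    change ‖z.1 + (y : X)‖ ≤ ‖z.1 + y - c • (z.2 + A y)‖
    rw [← hu1, ← hu2]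
    exact this
  exact closure_minimal hsub hcl hz

/-- If (0, v) is in the closure of the graph, the inequality perturbed by c • y, divided by c, tends
to ‖y‖ ≤ ‖y - v‖ as c → 0. By density it holds for y = v, which forces v = 0. -/
lemma isClosable_of_dissipative (hA : ∀ c : ℝ, 0 < c → ∀ u : A.domain,
    ‖(u : X)‖ ≤ ‖(u : X) - c • A u‖) (hd : Dense (A.domain : Set X)) : A.IsClosable := by
  have key : ∀ z ∈ A.graph.topologicalClosure, z.1 = 0 → z.2 = 0 := by
    rintro ⟨u, v⟩ hz rfl
    have h1 : ∀ y : A.domain, ‖(y : X)‖ ≤ ‖(y : X) - v‖ := by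
      intro y
      have h2 : ∀ c : ℝ, 0 < c → ‖(y : X)‖ ≤ ‖(y : X) - v - c • A y‖ := by
        intro c hc
        have h3 := norm_le_of_mem_closure_graph hA hz hc (c • y)
        have e1 : (0 : X) + ((c • y : A.domain) : X) = c • (y : X) := by simp
        have e2 : c • (y : X) - c • (v + A (c • y)) = c • ((y : X) - v - c • A y) := by
          rw [A.map_smul]
          module
        simp only [e1, e2, norm_smul] at h3
        exact le_of_mul_le_mul_left h3 (norm_pos_iff.2 hc.ne')
      have h4 : Tendsto (fun c : ℝ => ‖(y : X) - v - c • A y‖) (𝓝[>] 0) (𝓝 ‖(y : X) - v‖) := by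
        have : Continuous fun c : ℝ => ‖(y : X) - v - c • A y‖ := by fun_prop
        have h5 := (this.tendsto 0).mono_left (nhdsWithin_le_nhds (s := Set.Ioi 0))
        simpa using h5
      exact ge_of_tendsto h4 (eventually_nhdsWithin_of_forall h2)
    have h6 : v ∈ {x : X | ‖x‖ ≤ ‖x - v‖} := by
      have hcl : IsClosed {x : X | ‖x‖ ≤ ‖x - v‖} := isClosed_le (by fun_prop) (by fun_prop)
      exact closure_minimal (fun x hx => h1 ⟨x, hx⟩) hcl (hd v)
    simpa using h6
  exact ⟨A.graph.topologicalClosure.toLinearPMap,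
    (Submodule.toLinearPMap_graph_eq _ key).symm⟩

/-- The closure of a densely defined dissipative operator `A` is m-dissipative if the ranges of
`I - c A` are dense. -/
theorem isMDissipative_closure [CompleteSpace X] (hA : ∀ c : ℝ, 0 < c → ∀ u : A.domain,
    ‖(u : X)‖ ≤ ‖(u : X) - c • A u‖) (hd : Dense (A.domain : Set X))
    (hr : ∀ c : ℝ, 0 < c → ∀ (f : X) (ε : ℝ), 0 < ε →
      ∃ u : A.domain, ‖(u : X) - c • A u - f‖ ≤ ε) : IsMDissipative A.closure := by
  have hcl := isClosable_of_dissipative hA hd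
  have hg := hcl.graph_closure_eq_closure_graph
  refine ⟨fun c hc u => ?_, fun c hc f => ?_⟩
  · have hz : ((u : X), A.closure u) ∈ A.graph.topologicalClosure := by
      rw [hg]; exact A.closure.mem_graph u
    simpa using norm_le_of_mem_closure_graph hA hz hc 0
  · choose u hu using fun k : ℕ => hr c hc f (1 / ((k : ℝ) + 1)) (by positivity)
    have hf : Tendsto (fun k => (u k : X) - c • A (u k)) atTop (𝓝 f) := by
      rw [tendsto_iff_norm_sub_tendsto_zero]
      exact squeeze_zero (fun _ => norm_nonneg _) hu tendsto_one_div_add_atTop_nhds_zero_nat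
    -- Dissipativity makes the inverse of I - cA nonexpansive, so approximate solutions inherit the
    -- Cauchy property from their images.
    have hcau : CauchySeq fun k => (u k : X) := by
      rw [Metric.cauchySeq_iff]
      intro ε hε
      obtain ⟨N, hN⟩ := Metric.cauchySeq_iff.1 hf.cauchySeq ε hε
      refine ⟨N, fun k hk l hl => lt_of_le_of_lt ?_ (hN k hk l hl)⟩
      have := hA c hc (u k - u l)
      rw [A.map_sub] at this
      rw [dist_eq_norm, dist_eq_norm]
      refine this.trans (le_of_eq ?_)
      congr 1
      push_cast
      module
    obtain ⟨v, hv⟩ := cauchySeq_tendsto_of_complete hcau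
    -- The equation itself recovers A (u k) from two convergent sequences, so the limit pair lies in
    -- the closed graph.
    have hAv : Tendsto (fun k => A (u k)) atTop (𝓝 (c⁻¹ • (v - f))) := by
      refine ((hv.sub hf).const_smul c⁻¹).congr fun k => ?_
      rw [sub_sub_cancel, smul_smul, inv_mul_cancel₀ hc.ne', one_smul]
    have hmem : (v, c⁻¹ • (v - f)) ∈ A.graph.topologicalClosure :=
      mem_closure_of_tendsto (hv.prodMk_nhds hAv) (Eventually.of_forall fun k => A.mem_graph (u k))
    rw [hg] at hmem
    obtain ⟨y, hy1, hy2⟩ := A.closure.mem_graph_iff.1 hmem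
    refine ⟨y, ?_⟩
    simp only at hy1 hy2
    rw [hy1, hy2, smul_smul, mul_inv_cancel₀ hc.ne', one_smul, sub_sub_cancel]

end Dissipative

/-! ### The operator -/

/-- The real part of the inverse transform of an integrable function. -/
def reFourierInv (G : (Fin n → ℚ_[p]) → ℂ) (hG : Integrable G (haar p n)) :
    C₀(Fin n → ℚ_[p], ℝ) where
  toFun x := (fourierInv G x).re
  continuous_toFun := Complex.continuous_re.comp (continuous_fourierInv hG)
  zero_at_infty' := by
    have h1 := (tendsto_fourierL1_cocompact hG).comp
      (Homeomorph.neg (Fin n → ℚ_[p])).isClosedEmbedding.tendsto_cocompact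
    exact (Complex.continuous_re.tendsto 0).comp h1

lemma reFourierInv_apply {G : (Fin n → ℚ_[p]) → ℂ} (hG : Integrable G (haar p n))
    (x : Fin n → ℚ_[p]) : reFourierInv G hG x = (fourierInv G x).re := rfl

/-- An even continuous non-negative symbol with polynomial bounds in terms of the weight `w`. -/
structure IsAdmissible (σ w : (Fin n → ℚ_[p]) → ℝ) : Prop where
  nonneg : ∀ ξ, 0 ≤ σ ξ
  continuous : Continuous σ
  even : ∀ ξ, σ (-ξ) = σ ξ
  continuous_weight : Continuous w
  bounds : ∃ C : ℝ, 0 < C ∧ ∀ ξ, max 1 ‖ξ‖ ≤ C * max 1 |w ξ| ∧ σ ξ ≤ C * max 1 |w ξ|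

section Operator

variable {σ w : (Fin n → ℚ_[p]) → ℝ}

lemma IsAdmissible.exists_isCoreTransform (h : IsAdmissible σ w) {f : (Fin n → ℚ_[p]) → ℝ}
    (hf : MemBInfty w f) : ∃ g, IsCoreTransform σ f g := by
  obtain ⟨C, hC, hb⟩ := h.bounds
  obtain ⟨g, hg⟩ := hf.exists_coreWeight h.nonneg hC hb
  exact ⟨g, hg.isCoreTransform h.nonneg h.continuous⟩

namespace IsCoreTransform

variable {f f' : (Fin n → ℚ_[p]) → ℝ} {g g' : (Fin n → ℚ_[p]) → ℂ}

lemma integrable_symbol (h : IsCoreTransform σ f g) (hσ : IsAdmissible σ w) :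
    Integrable (fun ξ => (σ ξ : ℂ) * g ξ) (haar p n) :=
  h.integrable σ hσ.continuous fun ξ => by rw [abs_of_nonneg (hσ.nonneg ξ)]; linarith

lemma memLp_symbol (h : IsCoreTransform σ f g) (hσ : IsAdmissible σ w) :
    MemLp (fun ξ => (σ ξ : ℂ) * g ξ) 2 (haar p n) :=
  h.memLp σ hσ.continuous fun ξ => by rw [abs_of_nonneg (hσ.nonneg ξ)]; linarith

lemma im_symbol (h : IsCoreTransform σ f g) (hσ : IsAdmissible σ w) (x : Fin n → ℚ_[p]) :
    (fourierInv (fun ξ => (σ ξ : ℂ) * g ξ) x).im = 0 :=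
  h.im_eq_zero σ hσ.continuous (fun ξ => by rw [abs_of_nonneg (hσ.nonneg ξ)]; linarith) hσ.even x

lemma integrable_self (h : IsCoreTransform σ f g) (hσ : IsAdmissible σ w) :
    Integrable g (haar p n) := by
  simpa using h.integrable (fun _ => 1) continuous_const
    (fun ξ => by have := hσ.nonneg ξ; rw [abs_one]; linarith)

lemma eq_fourierInv (h : IsCoreTransform σ f g) (hσ : IsAdmissible σ w) (hf : Continuous f)
    (x : Fin n → ℚ_[p]) : (f x : ℂ) = fourierInv g x := by
  have h1 := h.isFourierL2.ae_eq_fourierInv (h.integrable_self hσ)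
  exact congrFun ((Continuous.ae_eq_iff_eq _ (Complex.continuous_ofReal.comp hf)
    (continuous_fourierInv (h.integrable_self hσ))).1 h1) x

lemma symbol_congr (h : IsCoreTransform σ f g)
    (hg' : IsFourierL2 (fun x => (f x : ℂ)) g') :
    fourierInv (fun ξ => (σ ξ : ℂ) * g ξ) = fourierInv (fun ξ => (σ ξ : ℂ) * g' ξ) := by
  have h1 : (fun ξ => (σ ξ : ℂ) * g ξ) =ᵐ[haar p n] fun ξ => (σ ξ : ℂ) * g' ξ := by
    filter_upwards [h.isFourierL2.ae_eq hg'] with ξ hξ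
    rw [hξ]
  ext x
  rw [fourierInv, fourierInv, fourierL1_congr_ae h1]

end IsCoreTransform

/-- The operator `P(∂)` with symbol `-σ` and domain `B_{w,∞}`. -/
def pseudoDiffOperator (hσ : IsAdmissible σ w) :
    C₀(Fin n → ℚ_[p], ℝ) →ₗ.[ℝ] C₀(Fin n → ℚ_[p], ℝ) where
  domain :=
    { carrier := {u | MemBInfty w u}
      add_mem' := fun hu hv => hu.add hσ.continuous_weight hv
      zero_mem' := by
        have h : IsTestFunction (fun _ : Fin n → ℚ_[p] => (0 : ℝ)) :=
          ⟨IsLocallyConstant.const 0, HasCompactSupport.zero⟩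
        exact h.memBInfty
      smul_mem' := fun c u hu => hu.const_mul c }
  toFun :=
    { toFun := fun u => -reFourierInv _
        ((hσ.exists_isCoreTransform u.2).choose_spec.integrable_symbol hσ)
      map_add' := fun u v => by
        have hu := (hσ.exists_isCoreTransform u.2).choose_spec
        have hv := (hσ.exists_isCoreTransform v.2).choose_spec
        have huv := (hσ.exists_isCoreTransform (u + v).2).choose_spec
        ext x
        simp only [ZeroAtInftyContinuousMap.coe_neg, ZeroAtInftyContinuousMap.coe_add,
          Pi.neg_apply, Pi.add_apply, reFourierInv_apply]
        rw [huv.symbol_congr (by simpa using hu.isFourierL2.add hv.isFourierL2)]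
        simp only [mul_add, fourierInv]
        rw [fourierL1_add (hu.integrable_symbol hσ) (hv.integrable_symbol hσ), Complex.add_re]
        ring
      map_smul' := fun c u => by
        have hu := (hσ.exists_isCoreTransform u.2).choose_spec
        have hcu := (hσ.exists_isCoreTransform (c • u).2).choose_spec
        ext x
        simp only [ZeroAtInftyContinuousMap.coe_neg, ZeroAtInftyContinuousMap.coe_smul,
          Pi.neg_apply, Pi.smul_apply, reFourierInv_apply, RingHom.id_apply, smul_eq_mul]
        rw [hcu.symbol_congr (by simpa using hu.isFourierL2.const_mul (c : ℂ))]
        simp only [mul_left_comm _ (c : ℂ), fourierInv]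
        rw [fourierL1_const_mul, Complex.re_ofReal_mul]
        ring }

/-- This frees the operator from the transform chosen in its definition, and records that taking the
real part there discards nothing. -/
lemma pseudoDiffOperator_apply (hσ : IsAdmissible σ w) (u : (pseudoDiffOperator hσ).domain)
    {g : (Fin n → ℚ_[p]) → ℂ}
    (hg : IsFourierL2 (fun x => ((u : C₀(Fin n → ℚ_[p], ℝ)) x : ℂ)) g) (x : Fin n → ℚ_[p]) :
    ((pseudoDiffOperator hσ u x : ℝ) : ℂ) = -fourierInv (fun ξ => (σ ξ : ℂ) * g ξ) x := by
  have hu := (hσ.exists_isCoreTransform u.2).choose_spec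
  rw [← hu.symbol_congr hg]
  have h1 : pseudoDiffOperator hσ u x = -(fourierInv _ x).re := rfl
  rw [h1]
  apply Complex.ext
  · simp
  · simp [hu.im_symbol hσ x]

lemma isPseudoDiffOperator_pseudoDiffOperator (hσ : IsAdmissible σ w) :
    IsPseudoDiffOperator σ w (pseudoDiffOperator hσ) where
  embedding f hf := by
    obtain ⟨g, hg⟩ := hσ.exists_isCoreTransform hf
    have h1 : f =ᵐ[haar p n] reFourierInv g (hg.integrable_self hσ) := by
      filter_upwards [hg.isFourierL2.ae_eq_fourierInv (hg.integrable_self hσ)] with x hx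
      rw [reFourierInv_apply, ← hx, Complex.ofReal_re]
    exact ⟨_, hf.congr_ae h1, h1⟩
  mem_domain_iff u := Iff.rfl
  apply_eq u := by
    obtain ⟨g, hg⟩ := hσ.exists_isCoreTransform u.2
    refine ⟨g, hg.isFourierL2, ?_⟩
    have h1 : (fun x => -((pseudoDiffOperator hσ u x : ℝ) : ℂ)) =
        fourierInv (fun ξ => (σ ξ : ℂ) * g ξ) := by
      ext x
      rw [pseudoDiffOperator_apply hσ u hg.isFourierL2, neg_neg]
    rw [h1]
    exact isInvFourierL2_fourierInv (hg.integrable_symbol hσ) (hg.memLp_symbol hσ)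

/-! ### Dissipativity of the operator. -/

lemma zeroAtInfty_norm_le {u : C₀(Fin n → ℚ_[p], ℝ)} {C : ℝ} (h : ∀ x, ‖u x‖ ≤ C) : ‖u‖ ≤ C := by
  rw [← ZeroAtInftyContinuousMap.norm_toBCF_eq_norm]
  exact (BoundedContinuousFunction.norm_le ((norm_nonneg _).trans (h 0))).2 h

lemma norm_apply_le_norm (u : C₀(Fin n → ℚ_[p], ℝ)) (x : Fin n → ℚ_[p]) : ‖u x‖ ≤ ‖u‖ := by
  rw [← ZeroAtInftyContinuousMap.norm_toBCF_eq_norm]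
  exact u.toBCF.norm_coe_le_norm x

lemma sub_smul_pseudoDiffOperator_apply (hσ : IsAdmissible σ w)
    (u : (pseudoDiffOperator hσ).domain) {g : (Fin n → ℚ_[p]) → ℂ}
    (hg : IsCoreTransform σ (u : C₀(Fin n → ℚ_[p], ℝ)) g) (c : ℝ) (x : Fin n → ℚ_[p]) :
    ((((u : C₀(Fin n → ℚ_[p], ℝ)) - c • pseudoDiffOperator hσ u) x : ℝ) : ℂ) =
      fourierInv (fun ξ => ((1 + c * σ ξ : ℝ) : ℂ) * g ξ) x := by
  simp only [ZeroAtInftyContinuousMap.coe_sub, ZeroAtInftyContinuousMap.coe_smul, Pi.sub_apply,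
    Pi.smul_apply, smul_eq_mul, Complex.ofReal_sub, Complex.ofReal_mul]
  rw [pseudoDiffOperator_apply hσ u hg.isFourierL2, hg.eq_fourierInv hσ (map_continuous _)]
  have e : (fun ξ => ((1 + c * σ ξ : ℝ) : ℂ) * g ξ) =
      fun ξ => g ξ + (c : ℂ) * ((σ ξ : ℂ) * g ξ) := by
    ext ξ; push_cast; ring
  rw [e, fourierInv, fourierInv, fourierInv, fourierL1_add (hg.integrable_self hσ)
    ((hg.integrable_symbol hσ).const_mul _), fourierL1_const_mul]
  ring

/-- The function u - cP(∂)u is the inverse transform of (1 + cσ)g; the resolvent multiplier takes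
this back to g, and it is a sup norm contraction. -/
lemma dissipative_pseudoDiffOperator (hσ : IsAdmissible σ w) (hr : IsRadial σ)
    (hneg : IsNegativeDefinite fun ξ => (σ ξ : ℂ)) (c : ℝ) (hc : 0 < c)
    (u : (pseudoDiffOperator hσ).domain) :
    ‖(u : C₀(Fin n → ℚ_[p], ℝ))‖ ≤
      ‖(u : C₀(Fin n → ℚ_[p], ℝ)) - c • pseudoDiffOperator hσ u‖ := by
  obtain ⟨g, hg⟩ := hσ.exists_isCoreTransform u.2
  set F := (u : C₀(Fin n → ℚ_[p], ℝ)) - c • pseudoDiffOperator hσ u with hF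
  have hG : Integrable (fun ξ => ((1 + c * σ ξ : ℝ) : ℂ) * g ξ) (haar p n) := by
    refine ((hg.integrable_self hσ).add ((hg.integrable_symbol hσ).const_mul (c : ℂ))).congr
      (Eventually.of_forall fun ξ => ?_)
    simp only [Pi.add_apply]
    push_cast; ring
  have hS : ∀ x, ‖fourierInv (fun ξ => ((1 + c * σ ξ : ℝ) : ℂ) * g ξ) x‖ ≤ ‖F‖ := by
    intro x
    rw [← sub_smul_pseudoDiffOperator_apply hσ u hg, Complex.norm_real]
    exact norm_apply_le_norm F x
  refine zeroAtInfty_norm_le fun x => ?_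
  have h1 := norm_fourierInv_resolvent_le hr hσ.continuous.measurable hneg hσ.nonneg hc.le hG hS x
  have e : (fun ξ => ((1 / (1 + c * σ ξ) : ℝ) : ℂ) * (((1 + c * σ ξ : ℝ) : ℂ) * g ξ)) = g := by
    ext ξ
    have h0 : (0 : ℝ) < 1 + c * σ ξ := by have := hσ.nonneg ξ; positivity
    rw [← mul_assoc, ← Complex.ofReal_mul, one_div_mul_cancel h0.ne', Complex.ofReal_one, one_mul]
  rw [e, ← hg.eq_fourierInv hσ (map_continuous _), Complex.norm_real] at h1
  exact h1

/-! ### Density of the domain and of the ranges. -/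

lemma exists_test_norm_sub_le (f : C₀(Fin n → ℚ_[p], ℝ)) {ε : ℝ} (hε : 0 < ε) :
    ∃ θ : (Fin n → ℚ_[p]) → ℝ, IsTestFunction θ ∧ ∀ x, ‖f x - θ x‖ ≤ ε := by
  have h1 : ∀ᶠ x in cocompact (Fin n → ℚ_[p]), ‖f x‖ < ε := by
    have := (zero_at_infty f).norm
    rw [norm_zero] at this
    exact this.eventually (gt_mem_nhds hε)
  obtain ⟨K, hK, hsub⟩ := mem_cocompact.1 h1
  obtain ⟨r, hr⟩ := hK.isBounded.subset_closedBall 0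
  obtain ⟨R, hR⟩ := pow_unbounded_of_one_lt r (one_lt_prime (p := p))
  obtain ⟨M, θ, hθ, hb⟩ := exists_testLevel_sub_le (R := (R : ℤ)) (map_continuous f) hε
    (fun x hx => by
      refine le_of_lt (hsub fun hc => hx ?_)
      rw [mem_pball, zpow_natCast]
      exact (mem_closedBall_zero_iff.1 (hr hc)).trans hR.le)
  exact ⟨θ, isTestFunction_iff.2 ⟨R, M, hθ⟩, hb⟩

/-- A test function as an element of `C₀`. -/
def IsTestFunction.toZeroAtInfty {θ : (Fin n → ℚ_[p]) → ℝ} (h : IsTestFunction θ) :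
    C₀(Fin n → ℚ_[p], ℝ) where
  toFun := θ
  continuous_toFun := h.1.continuous
  zero_at_infty' := h.2.is_zero_at_infty

lemma dense_domain_pseudoDiffOperator (hσ : IsAdmissible σ w) :
    Dense ((pseudoDiffOperator hσ).domain : Set C₀(Fin n → ℚ_[p], ℝ)) := by
  intro f
  rw [Metric.mem_closure_iff]
  intro ε hε
  obtain ⟨θ, hθ, hb⟩ := exists_test_norm_sub_le f (half_pos hε)
  refine ⟨hθ.toZeroAtInfty, hθ.memBInfty, ?_⟩
  rw [dist_eq_norm]
  refine (zeroAtInfty_norm_le hb).trans_lt (half_lt_self hε)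

/-- If ‖y‖ < ‖x‖ then ‖x + y‖ = ‖x‖, so a radial function is locally constant away from 0. Freezing
it at h 0 on a small ball removes the only obstruction to being a test function. -/
lemma testLevel_cutOff {h : (Fin n → ℚ_[p]) → ℝ} (hr : IsRadial h) (s : ℤ) (K : ℕ) :
    TestLevel (s + K) s (cutOff h s K) := by
  classical
  refine ⟨fun x hx => ?_, fun x y hy => ?_⟩
  · rw [cutOff, if_neg fun hc => hx (pball_mono (by omega) hc), if_neg hx]
  · have h1 : ∀ j, s ≤ j → (x + y ∈ pball p n j ↔ x ∈ pball p n j) := fun j hj =>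
      (pball p n j).add_mem_cancel_right (pball_mono hj hy)
    simp only [cutOff, h1 s le_rfl, h1 (s + K) (by omega)]
    split_ifs with h2 h3
    · rfl
    · refine hr _ _ ?_
      rw [mem_pball, not_le] at h2
      have h4 : ‖y‖ < ‖x‖ := (mem_pball.1 hy).trans_lt h2
      rw [IsUltrametricDist.norm_add_eq_max_of_norm_ne_norm h4.ne', max_eq_left h4.le]
    · rfl

lemma even_cutOff {h : (Fin n → ℚ_[p]) → ℝ} (hr : ∀ ξ, h (-ξ) = h ξ) (s : ℤ) (K : ℕ)
    (ξ : Fin n → ℚ_[p]) : cutOff h s K (-ξ) = cutOff h s K ξ := by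
  classical
  have h1 : ∀ j, -ξ ∈ pball p n j ↔ ξ ∈ pball p n j := fun j => neg_mem_iff
  simp only [cutOff, hr, h1]

/-- A test function whose transform is the cut-off of the transform of a given test function. -/
lemma exists_test_cutOff {h : (Fin n → ℚ_[p]) → ℝ} (hr : IsRadial h) (s : ℤ) (K : ℕ)
    {θ : (Fin n → ℚ_[p]) → ℝ} (hθ : IsTestFunction θ) :
    ∃ φ : (Fin n → ℚ_[p]) → ℝ, IsTestFunction φ ∧ fourierL1 (fun x => (φ x : ℂ)) =
      fun ξ => (cutOff h s K ξ : ℂ) * fourierL1 (fun x => (θ x : ℂ)) ξ := by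
  obtain ⟨R, M, ht⟩ := isTestFunction_iff.1 hθ
  have h1 := ht.ofReal.fourierL1
  have h2 := (testLevel_cutOff hr s K).ofReal
  set T : (Fin n → ℚ_[p]) → ℂ := fun ξ => (cutOff h s K ξ : ℂ) * fourierL1 (fun x => (θ x : ℂ)) ξ
    with hT
  have h3 : TestLevel (-M) (min (-R) s) T :=
    ⟨fun x hx => by simp [hT, h1.1 x hx], fun x y hy => by
      have e1 := h1.2 x y (pball_mono (min_le_left _ _) hy)
      have e2 := h2.2 x y (pball_mono (min_le_right _ _) hy)
      simp only at e2
      simp only [hT, e1, e2]⟩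
  have him : ∀ x, (fourierInv T x).im = 0 := conj_fourierInv_mul_fourierL1 θ _
    (even_cutOff (fun ξ => hr _ _ (norm_neg ξ)) s K)
  have hre : (fun x => (((fourierInv T x).re : ℝ) : ℂ)) = fourierInv T := by
    ext x
    apply Complex.ext
    · simp
    · simp [him x]
  refine ⟨fun x => (fourierInv T x).re, isTestFunction_iff.2 ⟨-(min (-R) s), - -M, fun x hx => ?_,
    fun x y hy => ?_⟩, ?_⟩
  · simp [h3.fourierInv.1 x hx]
  · exact congrArg Complex.re (h3.fourierInv.2 x y hy)
  · rw [hre, h3.fourierL1_fourierInv]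

/-- The exact solution for a test function θ has transform hT, with T the transform of θ, and need
not be a test function. Replacing h by its cut-off gives a test function, and the resulting defect
is bounded in sup norm by the L¹ norm of its transform, which tends to 0. -/
lemma dense_range_pseudoDiffOperator (hσ : IsAdmissible σ w) (hr : IsRadial σ) (c : ℝ)
    (hc : 0 < c) (f : C₀(Fin n → ℚ_[p], ℝ)) (ε : ℝ) (hε : 0 < ε) :
    ∃ u : (pseudoDiffOperator hσ).domain,
      ‖(u : C₀(Fin n → ℚ_[p], ℝ)) - c • pseudoDiffOperator hσ u - f‖ ≤ ε := by
  obtain ⟨θ, hθ, hb⟩ := exists_test_norm_sub_le f (half_pos hε)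
  obtain ⟨R, M, ht⟩ := isTestFunction_iff.1 hθ
  set h : (Fin n → ℚ_[p]) → ℝ := fun ξ => 1 / (1 + c * σ ξ) with hh
  set T := fourierL1 (fun x => (θ x : ℂ)) with hT
  have hTt := ht.ofReal.fourierL1
  have hpos : ∀ ξ, 0 < 1 + c * σ ξ := fun ξ => by
    have := hσ.nonneg ξ; positivity
  have hhr : IsRadial h := fun ξ η e => by simp only [hh, hr ξ η e]
  have hhc : Continuous h :=
    continuous_const.div (continuous_const.add (continuous_const.mul hσ.continuous))
      fun ξ => (hpos ξ).ne'
  have hB : ∀ ξ, ‖h ξ‖ ≤ 1 := fun ξ => by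
    rw [Real.norm_of_nonneg (div_pos one_pos (hpos ξ)).le]
    exact div_le_one_of_le₀ (by have := mul_nonneg hc.le (hσ.nonneg ξ); linarith) (hpos ξ).le
  have hTi : Integrable T (haar p n) := hTt.integrable
  have hwt : Continuous fun ξ => ((1 + c * σ ξ : ℝ) : ℂ) :=
    Complex.continuous_ofReal.comp (continuous_const.add (continuous_const.mul hσ.continuous))
  have hσT : Integrable (fun ξ => ((1 + c * σ ξ : ℝ) : ℂ) * T ξ) (haar p n) :=
    (hwt.mul hTt.continuous).integrable_of_hasCompactSupport hTt.hasCompactSupport.mul_left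
  have hcut : ∀ N : ℕ, Integrable (fun ξ => ((1 + c * σ ξ : ℝ) : ℂ) *
      ((cutOff h (-N) (2 * N) ξ : ℂ) * T ξ)) (haar p n) := fun N => by
    refine (integrable_mul_of_bounded hσT (measurable_cutOff hhc.measurable (-N) (2 * N))
      (norm_cutOff_le hB _ _)).congr (Eventually.of_forall fun ξ => ?_)
    ring
  -- Dominated convergence: the cut-offs are bounded by 1, and T has compact support, so T and (1 +
  -- cσ)T are integrable.
  have hlim : Tendsto (fun N : ℕ => ∫ ξ, ‖((1 + c * σ ξ : ℝ) : ℂ) *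
      ((cutOff h (-N) (2 * N) ξ : ℂ) * T ξ) - T ξ‖ ∂(haar p n)) atTop (𝓝 0) := by
    rw [← integral_zero (Fin n → ℚ_[p]) ℝ (μ := haar p n)]
    refine tendsto_integral_of_dominated_convergence
      (fun ξ => ‖((1 + c * σ ξ : ℝ) : ℂ) * T ξ‖ + ‖T ξ‖)
      (fun N => ((hcut N).sub hTi).norm.1) (hσT.norm.add hTi.norm)
      (fun N => Eventually.of_forall fun ξ => ?_) (Eventually.of_forall fun ξ => ?_)
    · rw [norm_norm]
      refine (norm_sub_le _ _).trans (add_le_add_left ?_ _)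
      rw [norm_mul, norm_mul, norm_mul]
      refine mul_le_mul_of_nonneg_left ?_ (norm_nonneg _)
      rw [Complex.norm_real]
      exact mul_le_of_le_one_left (norm_nonneg _) (norm_cutOff_le hB _ _ _)
    · have h1 : Tendsto (fun N : ℕ => ((1 + c * σ ξ : ℝ) : ℂ) *
          ((cutOff h (-N) (2 * N) ξ : ℂ) * T ξ) - T ξ) atTop
          (𝓝 (((1 + c * σ ξ : ℝ) : ℂ) * ((h ξ : ℂ) * T ξ) - T ξ)) :=
        (((((Complex.continuous_ofReal.tendsto _).comp (tendsto_cutOff h ξ)).mul_const _).const_mul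
          _).sub_const _)
      have h2 : ((1 + c * σ ξ : ℝ) : ℂ) * ((h ξ : ℂ) * T ξ) - T ξ = 0 := by
        rw [← mul_assoc, ← Complex.ofReal_mul, mul_one_div_cancel (hpos ξ).ne',
          Complex.ofReal_one, one_mul, sub_self]
      rw [h2] at h1
      simpa using h1.norm
  obtain ⟨N, hN⟩ := (hlim.eventually (gt_mem_nhds (half_pos hε))).exists
  obtain ⟨φ, hφ, hφT⟩ := exists_test_cutOff hhr (-N) (2 * N) hθ
  let u : (pseudoDiffOperator hσ).domain := ⟨hφ.toZeroAtInfty, hφ.memBInfty⟩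
  refine ⟨u, zeroAtInfty_norm_le fun x => ?_⟩
  obtain ⟨g, hg⟩ := hσ.exists_isCoreTransform u.2
  obtain ⟨R', M', ht'⟩ := isTestFunction_iff.1 hφ
  have hgT : g =ᵐ[haar p n] fun ξ => (cutOff h (-N) (2 * N) ξ : ℂ) * T ξ := by
    rw [← hφT]
    exact hg.isFourierL2.ae_eq ht'.ofReal.isFourierL2
  have h1 : ((((u : C₀(Fin n → ℚ_[p], ℝ)) - c • pseudoDiffOperator hσ u) x : ℝ) : ℂ) =
      fourierInv (fun ξ => ((1 + c * σ ξ : ℝ) : ℂ) * ((cutOff h (-N) (2 * N) ξ : ℂ) * T ξ)) x := by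
    rw [sub_smul_pseudoDiffOperator_apply hσ u hg, fourierInv, fourierInv,
      fourierL1_congr_ae]
    filter_upwards [hgT] with ξ hξ
    rw [hξ]
  have h2 : (θ x : ℂ) = fourierInv T x := by
    rw [hT, ht.ofReal.fourierInv_fourierL1]
  have h3 : ‖((u : C₀(Fin n → ℚ_[p], ℝ)) - c • pseudoDiffOperator hσ u) x - θ x‖ ≤ ε / 2 := by
    rw [← Complex.norm_real, Complex.ofReal_sub, h1, h2, fourierInv, fourierInv,
      ← fourierL1_sub (hcut N) hTi]
    exact (norm_fourierL1_le _ _).trans hN.le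
  have h4 := hb x
  rw [norm_sub_rev] at h4
  have h5 := norm_add_le (((u : C₀(Fin n → ℚ_[p], ℝ)) - c • pseudoDiffOperator hσ u) x - θ x)
    (θ x - f x)
  rw [sub_add_sub_cancel] at h5
  refine le_trans h5 ?_
  linarith

end Operator

/-! ### The symbol as a positive combination, and the theorem. -/

lemma isNegativeDefinite_symbol {b : Fin m → ℝ} (hb : ∀ j, 0 < b j)
    {ψ : Fin m → (Fin n → ℚ_[p]) → ℝ}
    (h : ∀ j, IsNegativeDefinite (fun ξ => (ψ j ξ : ℂ))) :
    IsNegativeDefinite fun ξ => (symbol b ψ ξ : ℂ) := by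
  intro N x c
  have e : ∑ i, ∑ k, ((symbol b ψ (x i) : ℂ) + (starRingEnd ℂ) (symbol b ψ (x k) : ℂ) -
      (symbol b ψ (x i - x k) : ℂ)) * c i * (starRingEnd ℂ) (c k) =
      ∑ j, (b j : ℂ) * ∑ i, ∑ k, ((ψ j (x i) : ℂ) + (starRingEnd ℂ) (ψ j (x k) : ℂ) -
        (ψ j (x i - x k) : ℂ)) * c i * (starRingEnd ℂ) (c k) := by
    simp only [Finset.mul_sum]
    rw [Finset.sum_comm (s := (Finset.univ : Finset (Fin m)))]
    refine Finset.sum_congr rfl fun i _ => ?_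
    rw [Finset.sum_comm (s := (Finset.univ : Finset (Fin m)))]
    refine Finset.sum_congr rfl fun k _ => ?_
    simp only [Complex.conj_ofReal]
    simp only [symbol, Complex.ofReal_sum, Complex.ofReal_mul,
      ← Finset.sum_add_distrib, ← Finset.sum_sub_distrib, Finset.sum_mul]
    refine Finset.sum_congr rfl fun j _ => ?_
    ring
  rw [e]
  have hbc : ∀ j, (0 : ℂ) ≤ (b j : ℂ) := fun j => Complex.zero_le_real.2 (hb j).le
  exact Finset.sum_nonneg fun j _ => mul_nonneg (hbc j) (h j N x c)

end PadicFeller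

end

theorem mainTheorem6 (p : ℕ) [Fact p.Prime] (n m : ℕ)
    (b : Fin m → ℝ) (hb : ∀ j, 0 < b j)
    (ψ : Fin m → (Fin n → ℚ_[p]) → ℝ)
    (hψ_nonneg : ∀ j ξ, 0 ≤ ψ j ξ)
    (hψ_radial : ∀ j, PadicFeller.IsRadial (ψ j))
    (hψ_cont : ∀ j, Continuous (ψ j))
    (hψ_neg : ∀ j, PadicFeller.IsNegativeDefinite (fun ξ => (ψ j ξ : ℂ)))
    (w : (Fin n → ℚ_[p]) → ℝ) (hw : PadicFeller.IsAttachedWeight b ψ w) :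
    ∃ A : C₀(Fin n → ℚ_[p], ℝ) →ₗ.[ℝ] C₀(Fin n → ℚ_[p], ℝ),
      PadicFeller.IsPseudoDiffOperator (PadicFeller.symbol b ψ) w A ∧
      A.IsClosable ∧ PadicFeller.IsMDissipative A.closure := by
  have hr : PadicFeller.IsRadial (PadicFeller.symbol b ψ) := fun ξ η e =>
    Finset.sum_congr rfl fun j _ => by rw [hψ_radial j ξ η e]
  have hσ : PadicFeller.IsAdmissible (PadicFeller.symbol b ψ) w :=
    { nonneg := fun ξ => Finset.sum_nonneg fun j _ => mul_nonneg (hb j).le (hψ_nonneg j ξ)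
      continuous := continuous_finsetSum _ fun j _ => continuous_const.mul (hψ_cont j)
      even := fun ξ => hr _ _ (norm_neg ξ)
      continuous_weight := hw.continuous hψ_cont
      bounds := hw.bounds hb hψ_nonneg }
  have hneg := PadicFeller.isNegativeDefinite_symbol hb hψ_neg
  have hdiss := PadicFeller.dissipative_pseudoDiffOperator hσ hr hneg
  have hdense := PadicFeller.dense_domain_pseudoDiffOperator hσ
  exact ⟨PadicFeller.pseudoDiffOperator hσ,
    PadicFeller.isPseudoDiffOperator_pseudoDiffOperator hσ,
    PadicFeller.isClosable_of_dissipative hdiss hdense,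
    PadicFeller.isMDissipative_closure hdiss hdense
      (PadicFeller.dense_range_pseudoDiffOperator hσ hr)⟩
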